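/- Let $\mathcal E,h,\mu,\omega\in\mathbb R$ with $\mathcal E+h>0$, $\mu>0$, $\omega>0$, and put $$V_I(z)=\mathcal E+h+\frac{\mu}{|z|}\quad(z\in\mathbb R^2\setminus\{0\}),\qquad V_E(z)=\mathcal E-\frac{\omega^2}{2}|z|^2 .$$ For $V\in\{V_I,V_E\}$, a classical solution on $[0,T]$ of $(HS_I)$, respectively $(HS_E)$, is a curve $z:[0,T]\to\mathbb R^2$ (avoiding $0$ for $V_I$) with $z''=\nabla V(z)$ and $\tfrac12|z'|^2-V(z)=0$ on $[0,T]$. An ejection-collision solution of $(HS_I)$ on $[0,T]$ is a continuous curve which vanishes at exactly one instant $c\in(0,T)$ and satisfies $(HS_I)$ on $[0,T]\setminus\{c\}$. Let $C_0>0$ and let $f(\xi;\epsilon)$ be a function of class $C^2$ on $\mathbb R/2\pi\mathbb Z\times[-C_0,C_0]$. Put $\gamma_\epsilon(\xi)=(1+\epsilon f(\xi;\epsilon))e^{i\xi}$ and $D_\epsilon=\{re^{i\xi}:0\le r<1+\epsilon f(\xi;\epsilon)\}$. For a curve $z:[0,T]\to\mathbb R^2\setminus\{0\}$ whose endpoints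 are not on opposite rays from $0$, let $I(z([0,T]),0)=\frac1{2\pi i}\int_\Gamma\frac{d\zeta}{\zeta}$, where $\Gamma$ is the closed curve that follows $z$, then the shortest arc of the circle $|\zeta|=|z(T)|$ from $z(T)$ to the ray through $z(0)$, then this ray up to $z(0)$. Below, $|\xi_0-\xi_1|$ is the distance in $\mathbb R/2\pi\mathbb Z$. **Inner arcs.** There are $\bar\epsilon_I\in(0,C_0]$, $\bar\delta_I\in(0,\pi]$ and $C>0$ such that for all $\epsilon$ with $|\epsilon|<\bar\epsilon_I$ and all $\xi_0,\xi_1$ with $|\xi_0-\xi_1|<\bar\delta_I$ there are a unique $T=T(\xi_0,\xi_1)>0$ and a unique $z(\cdot)=z(\cdot;\xi_0,\xi_1;\epsilon):[0,T]\to\mathbb R^2$ such that $z(0)=\gamma_\epsilon(\xi_0)$, $z(T)=\gamma_\epsilon(\xi_1)$, $z(s)\in D_\epsilon$ for $s\in(0,T)$, and * if $\xi_0\neq\xi_1$, $z$ is a classical solution of $(HS_I)$ with $|I(z([0,T]),0)|=1$; * if $\xi_0=\xi_1$, $z$ is an ejection-collision solution of $(HS_I)$. For each such $\epsilon$ the family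 is of class $C^1$ in $(\xi_0,\xi_1)$, in the following sense: $T(\xi_0,\xi_1)$ is of class $C^1$; $z(s;\xi_0,\xi_1;\epsilon)$ is jointly of class $C^1$ in $(s,\xi_0,\xi_1)$ at all points where $z\ne0$; and in the Levi-Civita time $\tau$, defined along each arc by $ds/d\tau=2|z|$ with $s$ strictly increasing in $\tau$ and $\tau=0$ at $s=0$, the duration of the arc is of class $C^1$ in $(\xi_0,\xi_1)$, and the physical time $s$ and the position $z$ are jointly of class $C^1$ in $(\tau,\xi_0,\xi_1)$, collisions included. Moreover the angles $\beta_0=\angle(\dot\gamma_\epsilon(\xi_0),z'(0))$ and $\beta_1=\angle(\dot\gamma_\epsilon(\xi_1),z'(T))$ satisfy $C<|\beta_j|<\pi-C$ for $j=0,1$. **Outer arcs.** Suppose in addition that $\mathcal E>\omega^2$. There are $\bar\epsilon_E\in(0,C_0]$ and $\bar\delta_E\in(0,\pi]$ such that for all $\epsilon$ with $|\epsilon|<\bar\epsilon_E$ and all $\xi_0,\xi_1$ with $|\xi_0-\xi_1|<\bar\delta_E$ there are $T\in(0,\pi/\omega)$ and $z:[0,T]\to\mathbb R^2$ such that * $z$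 is a classical solution of $(HS_E)$ on $[0,T]$ with $z(0)=\gamma_\epsilon(\xi_0)$, $z(T)=\gamma_\epsilon(\xi_1)$, and it is the only one on this interval $[0,T]$; * $z(s)\notin\overline{D_\epsilon}$ for $s\in(0,T)$; * $(T,z)$ is unique: if $T'\in(0,\pi/\omega)$ and $z'$ is a classical solution of $(HS_E)$ on $[0,T']$ with the same two endpoints and $z'(s)\notin\overline{D_\epsilon}$ for $s\in(0,T')$, then $T'=T$ and $z'=z$. -/

import Mathlib

open Set

noncomputable section

namespace RefractionBilliard

/-! The plane `ℝ²` is identified with `ℂ` (Mathlib's real inner product structure on `ℂ`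
is the Euclidean one), and `ℝ / 2πℤ` is handled through real lifts of angles. -/

/-- The inner (Kepler) potential `V_I(z) = E + h + μ / |z|`, for `z ≠ 0`. -/
def innerPotential (E h μ : ℝ) (z : ℂ) : ℝ := E + h + μ / ‖z‖

/-- The outer (harmonic) potential `V_E(z) = E - (ω² / 2) |z|²`. -/
def outerPotential (E ω : ℝ) (z : ℂ) : ℝ := E - ω ^ 2 / 2 * ‖z‖ ^ 2

/-- The curve `z : [0, T] → ℂ` satisfies at time `s` the equation `z'' = ∇V(z)` together with
the zero energy law `|z'|² / 2 - V(z) = 0`; derivatives are one-sided at the ends of `[0, T]`. -/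
structure HSAt (V : ℂ → ℝ) (T : ℝ) (z : ℝ → ℂ) (s : ℝ) : Prop where
  differentiable : DifferentiableWithinAt ℝ z (Icc 0 T) s
  newton : HasDerivWithinAt (derivWithin z (Icc 0 T)) (gradient V (z s)) (Icc 0 T) s
  energy : 1 / 2 * ‖derivWithin z (Icc 0 T) s‖ ^ 2 - V (z s) = 0

/-- Classical solution on `[0, T]` of the inner problem: it never meets the singularity `0`. -/
def IsInnerClassical (E h μ T : ℝ) (z : ℝ → ℂ) : Prop :=
  ∀ s ∈ Icc 0 T, z s ≠ 0 ∧ HSAt (innerPotential E h μ) T z s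

/-- Ejection-collision solution on `[0, T]` of the inner problem: a continuous curve which
is at the singularity `0` at exactly one instant `c ∈ (0, T)`, and which solves the inner problem
at all other times. -/
def IsEjectionCollision (E h μ T : ℝ) (z : ℝ → ℂ) : Prop :=
  ContinuousOn z (Icc 0 T) ∧
    ∃ c ∈ Ioo 0 T, z c = 0 ∧
      ∀ s ∈ Icc 0 T, s ≠ c → z s ≠ 0 ∧ HSAt (innerPotential E h μ) T z s

/-- Classical solution on `[0, T]` of the outer problem. -/
def IsOuterClassical (E ω T : ℝ) (z : ℝ → ℂ) : Prop :=
  ∀ s ∈ Icc 0 T, HSAt (outerPotential E ω) T z s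

/-- The boundary curve `γ_ε(ξ) = (1 + ε f(ξ; ε)) e^{iξ}`. -/
def boundaryCurve (f : ℝ → ℝ → ℝ) (ε ξ : ℝ) : ℂ :=
  ((1 + ε * f ξ ε : ℝ) : ℂ) * Complex.exp (ξ * Complex.I)

/-- The domain `D_ε` bounded by `γ_ε`: the points `r e^{iξ}` with `0 ≤ r < 1 + ε f(ξ; ε)`. -/
def domain (f : ℝ → ℝ → ℝ) (ε : ℝ) : Set ℂ :=
  {z | ‖z‖ < 1 + ε * f z.arg ε}

/-- `∫ dz / z` along the curve `α` restricted to `[a, b]`. -/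
def logIntegral (α : ℝ → ℂ) (a b : ℝ) : ℂ := ∫ t in a..b, deriv α t / α t

/-- The winding index `I(z([0, T]), 0) = (2πi)⁻¹ ∫_Γ dz / z` of an arc from `p₀ = z(0)` to
`p₁ = z(T)`. The closed curve `Γ` follows the arc, then the shortest arc of the circle centred
at `0` from `p₁` to the point `q` on the ray of `p₀` with `|q| = |p₁|`, then the segment
from `q` to `p₀`. -/
def windingIndex (T : ℝ) (z : ℝ → ℂ) : ℂ :=
  let d : ℝ := (z 0 / z T).arg
  let q : ℂ := z T * Complex.exp (d * Complex.I)
  (2 * Real.pi * Complex.I)⁻¹ *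
    (logIntegral z 0 T
      + logIntegral (fun t : ℝ => z T * Complex.exp ((t * d : ℝ) * Complex.I)) 0 1
      + logIntegral (fun t : ℝ => ((1 - t : ℝ) : ℂ) * q + (t : ℂ) * z 0) 0 1)

/-- `z : [0, T] → ℂ` is an inner arc from `γ_ε(ξ₀)` to `γ_ε(ξ₁)` inside `D_ε`: a classical solution
of winding index `±1` if `ξ₀ ≠ ξ₁`, an ejection-collision solution if `ξ₀ = ξ₁`. -/
structure IsInnerArc (E h μ : ℝ) (f : ℝ → ℝ → ℝ) (ε ξ₀ ξ₁ T : ℝ) (z : ℝ → ℂ) : Prop where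
  pos : 0 < T
  start : z 0 = boundaryCurve f ε ξ₀
  finish : z T = boundaryCurve f ε ξ₁
  inside : ∀ s ∈ Ioo 0 T, z s ∈ domain f ε
  classical : ξ₀ ≠ ξ₁ → IsInnerClassical E h μ T z ∧ ‖windingIndex T z‖ = 1
  ejectionCollision : ξ₀ = ξ₁ → IsEjectionCollision E h μ T z

/-- `z : [0, T] → ℂ` is a classical solution of the outer problem with ends `γ_ε(ξ₀)`, `γ_ε(ξ₁)`. -/
structure IsOuterFixedEnds (E ω : ℝ) (f : ℝ → ℝ → ℝ) (ε ξ₀ ξ₁ T : ℝ) (z : ℝ → ℂ) : Prop where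
  pos : 0 < T
  start : z 0 = boundaryCurve f ε ξ₀
  finish : z T = boundaryCurve f ε ξ₁
  classical : IsOuterClassical E ω T z

/-- An outer arc from `γ_ε(ξ₀)` to `γ_ε(ξ₁)`: it also stays outside the closure of `D_ε`. -/
def IsOuterArc (E ω : ℝ) (f : ℝ → ℝ → ℝ) (ε ξ₀ ξ₁ T : ℝ) (z : ℝ → ℂ) : Prop :=
  IsOuterFixedEnds E ω f ε ξ₀ ξ₁ T z ∧ ∀ s ∈ Ioo 0 T, z s ∉ closure (domain f ε)

/-- The family of arcs `z(· ; ξ₀, ξ₁) : [0, T(ξ₀, ξ₁)] → ℂ`, for `|ξ₀ - ξ₁| < δ`, is of class `C¹`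
with respect to the end angles:
* `T` is of class `C¹`;
* `z` is jointly of class `C¹` in `(s, ξ₀, ξ₁)` wherever `z ≠ 0` (at a collision the velocity
  blows up, and no regularity of this kind is possible in the physical time);
* in the Levi-Civita time `τ`, where `ds / dτ = 2 |z|`, the whole family, collisions
  included, is jointly of class `C¹`; here `σ ξ₀ ξ₁ τ` is the physical time `s` at `τ`, and `L ξ₀ ξ₁`
  is the Levi-Civita duration of the arc. -/
def IsC1InEndpoints (δ : ℝ) (T : ℝ → ℝ → ℝ) (z : ℝ → ℝ → ℝ → ℂ) : Prop :=
  ContDiffOn ℝ 1 (fun p : ℝ × ℝ => T p.1 p.2) {p | |p.1 - p.2| < δ} ∧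
  ContDiffOn ℝ 1 (fun p : ℝ × ℝ × ℝ => z p.2.1 p.2.2 p.1)
    {p | |p.2.1 - p.2.2| < δ ∧ p.1 ∈ Icc 0 (T p.2.1 p.2.2) ∧ z p.2.1 p.2.2 p.1 ≠ 0} ∧
  ∃ (L : ℝ → ℝ → ℝ) (σ : ℝ → ℝ → ℝ → ℝ),
    (∀ ξ₀ ξ₁, |ξ₀ - ξ₁| < δ →
      0 < L ξ₀ ξ₁ ∧ σ ξ₀ ξ₁ 0 = 0 ∧ σ ξ₀ ξ₁ (L ξ₀ ξ₁) = T ξ₀ ξ₁ ∧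
      StrictMonoOn (σ ξ₀ ξ₁) (Icc 0 (L ξ₀ ξ₁)) ∧
      ∀ τ ∈ Icc 0 (L ξ₀ ξ₁),
        HasDerivWithinAt (σ ξ₀ ξ₁) (2 * ‖z ξ₀ ξ₁ (σ ξ₀ ξ₁ τ)‖) (Icc 0 (L ξ₀ ξ₁)) τ) ∧
    ContDiffOn ℝ 1 (fun p : ℝ × ℝ => L p.1 p.2) {p | |p.1 - p.2| < δ} ∧
    ContDiffOn ℝ 1 (fun p : ℝ × ℝ × ℝ => σ p.2.1 p.2.2 p.1)
      {p | |p.2.1 - p.2.2| < δ ∧ p.1 ∈ Icc 0 (L p.2.1 p.2.2)} ∧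
    ContDiffOn ℝ 1 (fun p : ℝ × ℝ × ℝ => z p.2.1 p.2.2 (σ p.2.1 p.2.2 p.1))
      {p | |p.2.1 - p.2.2| < δ ∧ p.1 ∈ Icc 0 (L p.2.1 p.2.2)}

end RefractionBilliard

end

/-! Inner arcs: put `z = w²` and `ds = 2 ‖w‖² dt`. With `Ω² = 2 (E + h)` the Kepler equation at zero
energy becomes the linear equation `w'' = Ω² w`, regular at the collision `w = 0`, together with
`‖w'‖² - Ω² ‖w‖² = μ`. Hence an arc from `p²` to `q²` lifts to the hyperbolic curve joining `p`
to `q` or to `-q`, which depends smoothly on its ends. If `p` and `q` are close, the first choice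
has winding index `0`, while the second one has index `±1`, or meets `0` if `p` and `q` are on the
same ray. The lift is a combination of its ends with positive coefficients of sum less than `1`, so
it lies inside the preimage of `D_ε` under the squaring map, which is convex since it is
`C²`-close to a disc.

Outer arcs: the harmonic solution joining `p` to `q` in a time `T < π / ω` is explicit, and in
terms of `x = cos² (ω T / 2)` its energy law is
`‖(p + q) / 2‖² / x + ‖(p - q) / 2‖² / (1 - x) = 2 E / ω²`.
If `p ≠ q` are close, it has one root near `ω² / (2 E)` and one near `1`. The orbit stays outside
`D_ε` for the first root and not for the second: the squared gauge of `D_ε` satisfies the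
parallelogram law up to a small error, since it is `C²`-close to the squared Euclidean norm. -/

noncomputable section

namespace RefractionBilliard

open Filter Topology ComplexConjugate

section Preliminaries

lemma contDiffAt_of_implicit_eq {X : Type*} [NormedAddCommGroup X] [NormedSpace ℝ X]
    [CompleteSpace X] {n : WithTop ℕ∞} (hn : n ≠ 0) {F : X × ℝ → ℝ} {g : X → ℝ} {x : X} {t c : ℝ}
    (hF : ContDiffAt ℝ n F (x, t)) (hder : HasDerivAt (fun τ => F (x, τ)) c t) (hc : c ≠ 0)
    (hg : ∀ᶠ y in 𝓝 x, ∀ τ, F (y, τ) = F (x, t) → g y = τ) : ContDiffAt ℝ n g x := by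
  have hpartial : (fderiv ℝ F (x, t) ∘L .inr ℝ X ℝ) 1 = c := by
    have hpath : HasDerivAt (fun τ : ℝ => (x, τ)) ((0, 1) : X × ℝ) t :=
      (hasDerivAt_const t x).prodMk (hasDerivAt_id t)
    have hcomp := (hF.differentiableAt hn).hasFDerivAt.comp_hasDerivAt t hpath
    exact (by simp : _ = _).trans (hder.unique hcomp).symm
  have hinv : (fderiv ℝ F (x, t) ∘L .inr ℝ X ℝ).IsInvertible := by
    refine ⟨ContinuousLinearEquiv.unitsEquivAut ℝ (Units.mk0 c hc), ?_⟩
    ext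
    rw [hpartial]
    simp
  refine (hF.contDiffAt_implicitFunction hn hinv).congr_of_eventuallyEq ?_
  filter_upwards [hg, hF.eventually_apply_implicitFunction hn hinv] with y hy himp
  exact hy _ himp

end Preliminaries

section LiftCurve

variable {F : Type*} [NormedAddCommGroup F] [InnerProductSpace ℝ F] {Ω : ℝ} {A B : F}

/-- The solution of `w'' = Ω² w` with `w(0) = A` and `w'(0) = Ω B`. In the Levi-Civita plane these
are the arcs whose squares are the Kepler orbits of energy `Ω² / 2`. -/
def liftCurve (Ω : ℝ) (A B : F) (t : ℝ) : F := Real.cosh (Ω * t) • A + Real.sinh (Ω * t) • B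

/-- The physical time elapsed along `liftCurve Ω A B` at Levi-Civita time `t`: the primitive of
`2 ‖w‖²` vanishing at `0`. -/
def physicalTime (Ω : ℝ) (A B : F) (t : ℝ) : ℝ :=
  ((‖A‖ ^ 2 + ‖B‖ ^ 2) / 2 * Real.sinh (2 * (Ω * t))
    + inner ℝ A B * (Real.cosh (2 * (Ω * t)) - 1)) / Ω - (‖B‖ ^ 2 - ‖A‖ ^ 2) * t

/-- The Levi-Civita time as a function of the physical time: the inverse of `physicalTime Ω A B`,
and junk unless the latter is bijective. -/
def clock (Ω : ℝ) (A B : F) (s : ℝ) : ℝ := Function.invFun (physicalTime Ω A B) s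

@[simp]
lemma liftCurve_zero (Ω : ℝ) (A B : F) : liftCurve Ω A B 0 = A := by simp [liftCurve]

@[simp]
lemma physicalTime_zero (Ω : ℝ) (A B : F) : physicalTime Ω A B 0 = 0 := by simp [physicalTime]

lemma hasDerivAt_liftCurve (Ω : ℝ) (A B : F) (t : ℝ) :
    HasDerivAt (liftCurve Ω A B) (Ω • liftCurve Ω B A t) t := by
  have hlin : HasDerivAt (fun t : ℝ => Ω * t) Ω t := by
    simpa using (hasDerivAt_id t).const_mul Ω
  refine ((hlin.cosh.smul_const A).add (hlin.sinh.smul_const B)).congr_deriv ?_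
  rw [liftCurve]
  module

lemma contDiff_liftCurve {n : WithTop ℕ∞} (Ω : ℝ) :
    ContDiff ℝ n fun x : ℝ × F × F => liftCurve Ω x.2.1 x.2.2 x.1 := by
  unfold liftCurve
  have hlin : ContDiff ℝ n fun x : ℝ × F × F => Ω * x.1 := by fun_prop
  exact (hlin.cosh.smul (by fun_prop)).add (hlin.sinh.smul (by fun_prop))

lemma continuous_liftCurve (Ω : ℝ) (A B : F) : Continuous (liftCurve Ω A B) :=
  continuous_iff_continuousAt.2 fun t => (hasDerivAt_liftCurve Ω A B t).continuousAt

lemma norm_sq_liftCurve (Ω : ℝ) (A B : F) (t : ℝ) :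
    ‖liftCurve Ω A B t‖ ^ 2 = ‖A‖ ^ 2 * Real.cosh (Ω * t) ^ 2
      + 2 * inner ℝ A B * (Real.cosh (Ω * t) * Real.sinh (Ω * t))
      + ‖B‖ ^ 2 * Real.sinh (Ω * t) ^ 2 := by
  simp only [liftCurve, norm_add_sq_real, norm_smul, Real.norm_eq_abs, mul_pow, sq_abs,
    real_inner_smul_left, real_inner_smul_right]
  ring

lemma norm_sq_liftCurve_swap (Ω : ℝ) (A B : F) (t : ℝ) :
    ‖liftCurve Ω B A t‖ ^ 2 = ‖liftCurve Ω A B t‖ ^ 2 + (‖B‖ ^ 2 - ‖A‖ ^ 2) := by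
  rw [norm_sq_liftCurve, norm_sq_liftCurve, real_inner_comm, Real.cosh_sq]
  ring

lemma hasDerivAt_physicalTime (hΩ : Ω ≠ 0) (A B : F) (t : ℝ) :
    HasDerivAt (physicalTime Ω A B) (2 * ‖liftCurve Ω A B t‖ ^ 2) t := by
  have hlin : HasDerivAt (fun t : ℝ => 2 * (Ω * t)) (2 * Ω) t := by
    simpa using ((hasDerivAt_id t).const_mul Ω).const_mul 2
  refine ((((hlin.sinh.const_mul ((‖A‖ ^ 2 + ‖B‖ ^ 2) / 2)).add
    ((hlin.cosh.sub_const 1).const_mul (inner ℝ A B))).div_const Ω).sub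
    ((hasDerivAt_id t).const_mul (‖B‖ ^ 2 - ‖A‖ ^ 2))).congr_deriv ?_
  rw [norm_sq_liftCurve, Real.cosh_two_mul, Real.sinh_two_mul, Real.cosh_sq]
  field_simp
  ring

lemma continuous_physicalTime (hΩ : Ω ≠ 0) (A B : F) : Continuous (physicalTime Ω A B) :=
  continuous_iff_continuousAt.2 fun t => (hasDerivAt_physicalTime hΩ A B t).continuousAt

lemma contDiff_physicalTime {n : WithTop ℕ∞} (Ω : ℝ) :
    ContDiff ℝ n fun x : ℝ × F × F => physicalTime Ω x.2.1 x.2.2 x.1 := by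
  have hlin : ContDiff ℝ n fun x : ℝ × F × F => 2 * (Ω * x.1) := by fun_prop
  have hA : ContDiff ℝ n fun x : ℝ × F × F => ‖x.2.1‖ ^ 2 := contDiff_snd.fst.norm_sq ℝ
  have hB : ContDiff ℝ n fun x : ℝ × F × F => ‖x.2.2‖ ^ 2 := contDiff_snd.snd.norm_sq ℝ
  have hAB : ContDiff ℝ n fun x : ℝ × F × F => inner ℝ x.2.1 x.2.2 :=
    contDiff_snd.fst.inner ℝ contDiff_snd.snd
  exact (((((hA.add hB).div_const 2).mul hlin.sinh).add
    (hAB.mul (hlin.cosh.sub contDiff_const))).div_const Ω).sub ((hB.sub hA).mul contDiff_fst)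

lemma physicalTime_neg (Ω : ℝ) (A B : F) (t : ℝ) :
    physicalTime Ω A B (-t) = -physicalTime Ω A (-B) t := by
  simp only [physicalTime, mul_neg, Real.sinh_neg, Real.cosh_neg, norm_neg, inner_neg_right]
  ring

lemma abs_inner_lt_half_add_norm_sq (h : ‖A‖ < ‖B‖) :
    |inner ℝ A B| < (‖A‖ ^ 2 + ‖B‖ ^ 2) / 2 := by
  have hcs := abs_real_inner_le_norm A B
  nlinarith [sq_pos_of_pos (sub_pos.2 h)]

lemma liftCurve_zero_unique (hΩ : Ω ≠ 0) (h : ‖A‖ < ‖B‖) {t u : ℝ}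
    (ht : liftCurve Ω A B t = 0) (hu : liftCurve Ω A B u = 0) : t = u := by
  have hB : B ≠ 0 := norm_pos_iff.1 ((norm_nonneg A).trans_lt h)
  have hdet : Real.sinh (Ω * u - Ω * t) • B = 0 := by
    have helim : Real.sinh (Ω * u - Ω * t) • B =
        Real.cosh (Ω * t) • liftCurve Ω A B u - Real.cosh (Ω * u) • liftCurve Ω A B t := by
      rw [Real.sinh_sub, liftCurve, liftCurve]
      module
    rw [helim, ht, hu, smul_zero, smul_zero, sub_zero]
  have := Real.sinh_eq_zero.1 ((smul_eq_zero.1 hdet).resolve_right hB)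
  exact (mul_left_cancel₀ hΩ (sub_eq_zero.1 this)).symm

lemma strictMono_physicalTime (hΩ : Ω ≠ 0) (h : ‖A‖ < ‖B‖) :
    StrictMono (physicalTime Ω A B) := by
  intro a b hab
  have hc : Continuous fun t => 2 * ‖liftCurve Ω A B t‖ ^ 2 :=
    ((continuous_liftCurve Ω A B).norm.pow 2).const_mul 2
  have hint := intervalIntegral.integral_eq_sub_of_hasDerivAt (a := a) (b := b)
    (fun t _ => hasDerivAt_physicalTime hΩ A B t) (hc.intervalIntegrable a b)
  have hspeed {t : ℝ} (ht : liftCurve Ω A B t ≠ 0) : 0 < 2 * ‖liftCurve Ω A B t‖ ^ 2 := by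
    positivity
  have hpos : 0 < ∫ t in a..b, 2 * ‖liftCurve Ω A B t‖ ^ 2 := by
    refine intervalIntegral.integral_pos hab hc.continuousOn (fun t _ => by positivity) ?_
    by_cases ha : liftCurve Ω A B a = 0
    · exact ⟨b, right_mem_Icc.2 hab.le,
        hspeed fun hb => hab.ne (liftCurve_zero_unique hΩ h ha hb)⟩
    · exact ⟨a, left_mem_Icc.2 hab.le, hspeed ha⟩
  linarith

lemma tendsto_physicalTime_atTop (hΩ : 0 < Ω) (h : ‖A‖ < ‖B‖) :
    Tendsto (physicalTime Ω A B) atTop atTop := by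
  have hinner := abs_lt.1 (abs_inner_lt_half_add_norm_sq h)
  set a := (‖A‖ ^ 2 + ‖B‖ ^ 2) / 2 with ha
  set b := inner ℝ A B with hb
  set k := ‖B‖ ^ 2 - ‖A‖ ^ 2 with hk
  have hlower : ∀ t : ℝ, 0 ≤ t →
      t * ((a + b) * Ω * t + (-|b| * 2 - k)) ≤ physicalTime Ω A B t := by
    intro t ht
    have hx : 0 ≤ 2 * (Ω * t) := by positivity
    have hexp := Real.quadratic_le_exp_of_nonneg hx
    have hexp_neg : Real.exp (-(2 * (Ω * t))) ≤ 1 := by simpa using hx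
    have hb_le : b * (1 - Real.exp (-(2 * (Ω * t)))) ≤ |b| * (2 * (Ω * t)) := by
      have hle := Real.add_one_le_exp (-(2 * (Ω * t)))
      exact mul_le_mul (le_abs_self b) (by linarith) (by linarith) (abs_nonneg b)
    have hsinh : (Ω * t) ^ 2 ≤ Real.sinh (2 * (Ω * t)) := by
      rw [Real.sinh_eq]
      nlinarith
    have hcosh : Real.cosh (2 * (Ω * t)) - 1 =
        Real.sinh (2 * (Ω * t)) - (1 - Real.exp (-(2 * (Ω * t)))) := by
      rw [← Real.cosh_sub_sinh]
      ring
    have hsum : (a + b) * (Ω * t) ^ 2 ≤ (a + b) * Real.sinh (2 * (Ω * t)) :=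
      mul_le_mul_of_nonneg_left hsinh (by linarith)
    rw [physicalTime, hcosh, ← ha, ← hb, ← hk, le_sub_iff_add_le,
      le_div_iff₀ hΩ]
    linarith
  refine tendsto_atTop_mono' _ ((eventually_ge_atTop 0).mono hlower) ?_
  exact tendsto_id.atTop_mul_atTop₀ (tendsto_atTop_add_const_right _ _
    (tendsto_id.const_mul_atTop (mul_pos (by linarith) hΩ)))

lemma surjective_physicalTime (hΩ : 0 < Ω) (h : ‖A‖ < ‖B‖) :
    Function.Surjective (physicalTime Ω A B) := by
  have hneg : ‖A‖ < ‖-B‖ := by rwa [norm_neg]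
  refine (continuous_physicalTime hΩ.ne' A B).surjective (tendsto_physicalTime_atTop hΩ h) ?_
  have hodd : physicalTime Ω A B = fun t => -physicalTime Ω A (-B) (-t) := by
    ext t
    rw [physicalTime_neg, neg_neg, neg_neg]
  rw [hodd]
  exact tendsto_neg_atTop_atBot.comp
    ((tendsto_physicalTime_atTop hΩ hneg).comp tendsto_neg_atBot_atTop)

lemma physicalTime_clock (hΩ : 0 < Ω) (h : ‖A‖ < ‖B‖) (s : ℝ) :
    physicalTime Ω A B (clock Ω A B s) = s :=
  Function.rightInverse_invFun (surjective_physicalTime hΩ h) s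

lemma clock_physicalTime (hΩ : Ω ≠ 0) (h : ‖A‖ < ‖B‖) (t : ℝ) :
    clock Ω A B (physicalTime Ω A B t) = t :=
  Function.leftInverse_invFun (strictMono_physicalTime hΩ h).injective t

lemma clock_zero (hΩ : Ω ≠ 0) (h : ‖A‖ < ‖B‖) : clock Ω A B 0 = 0 := by
  simpa only [physicalTime_zero] using clock_physicalTime hΩ h 0

lemma strictMono_clock (hΩ : 0 < Ω) (h : ‖A‖ < ‖B‖) : StrictMono (clock Ω A B) := by
  intro s t hst
  rwa [← (strictMono_physicalTime hΩ.ne' h).lt_iff_lt, physicalTime_clock hΩ h,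
    physicalTime_clock hΩ h]

lemma continuous_clock (hΩ : 0 < Ω) (h : ‖A‖ < ‖B‖) : Continuous (clock Ω A B) :=
  (strictMono_clock hΩ h).monotone.continuous_of_surjective
    fun t => ⟨physicalTime Ω A B t, clock_physicalTime hΩ.ne' h t⟩

lemma hasDerivAt_clock (hΩ : 0 < Ω) (h : ‖A‖ < ‖B‖) {s : ℝ}
    (hs : liftCurve Ω A B (clock Ω A B s) ≠ 0) :
    HasDerivAt (clock Ω A B) (2 * ‖liftCurve Ω A B (clock Ω A B s)‖ ^ 2)⁻¹ s :=
  (hasDerivAt_physicalTime hΩ.ne' A B _).of_local_left_inverse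
    (continuous_clock hΩ h).continuousAt (by positivity)
    (Eventually.of_forall (physicalTime_clock hΩ h))

lemma contDiffAt_clock [CompleteSpace F] {n : WithTop ℕ∞} (hn : n ≠ 0) (hΩ : 0 < Ω)
    (h : ‖A‖ < ‖B‖) {s : ℝ} (hs : liftCurve Ω A B (clock Ω A B s) ≠ 0) :
    ContDiffAt ℝ n (fun x : ℝ × F × F => clock Ω x.2.1 x.2.2 x.1) (s, A, B) := by
  have hnear : ∀ᶠ x : ℝ × F × F in 𝓝 (s, A, B), ‖x.2.1‖ < ‖x.2.2‖ :=
    continuous_snd.fst.norm.continuousAt.eventually_lt continuous_snd.snd.norm.continuousAt h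
  refine contDiffAt_of_implicit_eq hn
    (F := fun x : (ℝ × F × F) × ℝ => physicalTime Ω x.1.2.1 x.1.2.2 x.2 - x.1.1)
    (((contDiff_physicalTime Ω).comp (contDiff_snd.prodMk contDiff_fst.snd)).sub
      contDiff_fst.fst).contDiffAt
    ((hasDerivAt_physicalTime hΩ.ne' A B (clock Ω A B s)).sub_const s) (by positivity) ?_
  filter_upwards [hnear] with x hx τ hτ
  have htime : physicalTime Ω x.2.1 x.2.2 τ = x.1 := by
    simpa [physicalTime_clock hΩ h, sub_eq_zero] using hτ
  rw [← htime, clock_physicalTime hΩ.ne' hx]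

end LiftCurve

section Join

variable {F : Type*} [NormedAddCommGroup F] [InnerProductSpace ℝ F]

/-- The hyperbolic cosine of the Levi-Civita phase `Ω t` at which a curve `liftCurve Ω p B` with
`‖B‖² - ‖p‖² = k` reaches `r`: the positive root of
`k c² + 2 ⟪p, r⟫ c = k + ‖p‖² + ‖r‖²`. -/
def joinCosh (k : ℝ) (p r : F) : ℝ :=
  (√(inner ℝ p r ^ 2 + k * (k + ‖p‖ ^ 2 + ‖r‖ ^ 2)) - inner ℝ p r) / k

/-- The hyperbolic sine of the Levi-Civita phase of the curve from `p` to `r`. -/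
def joinSinh (k : ℝ) (p r : F) : ℝ := √(joinCosh k p r ^ 2 - 1)

/-- The Levi-Civita duration of the curve from `p` to `r`. -/
def joinDuration (Ω k : ℝ) (p r : F) : ℝ := Real.arsinh (joinSinh k p r) / Ω

/-- The coefficient `B` for which `liftCurve Ω p B` goes from `p` to `r` with
`‖B‖² - ‖p‖² = k`. -/
def joinCoeff (k : ℝ) (p r : F) : F := (joinSinh k p r)⁻¹ • (r - joinCosh k p r • p)

variable {k : ℝ} {p r : F}

lemma joinCosh_comm (k : ℝ) (p r : F) : joinCosh k p r = joinCosh k r p := by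
  rw [joinCosh, joinCosh, real_inner_comm, add_right_comm]

lemma joinSinh_comm (k : ℝ) (p r : F) : joinSinh k p r = joinSinh k r p := by
  rw [joinSinh, joinSinh, joinCosh_comm]

lemma joinCosh_radicand_pos (hk : 0 < k) (p r : F) :
    0 < inner ℝ p r ^ 2 + k * (k + ‖p‖ ^ 2 + ‖r‖ ^ 2) := by
  positivity

lemma joinCosh_root (hk : 0 < k) (p r : F) :
    k * joinCosh k p r ^ 2 + 2 * inner ℝ p r * joinCosh k p r = k + ‖p‖ ^ 2 + ‖r‖ ^ 2 := by
  have hsqrt := Real.sq_sqrt (joinCosh_radicand_pos hk p r).le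
  rw [joinCosh]
  field_simp
  linear_combination hsqrt

lemma eq_joinCosh (hk : 0 < k) {c : ℝ} (hc : 0 < c)
    (hroot : k * c ^ 2 + 2 * inner ℝ p r * c = k + ‖p‖ ^ 2 + ‖r‖ ^ 2) : c = joinCosh k p r := by
  have hprod : 0 < c * (k * c + 2 * inner ℝ p r) := by nlinarith [sq_nonneg ‖p‖, sq_nonneg ‖r‖]
  have hfactor := pos_of_mul_pos_right hprod hc.le
  have hsqrt : √(inner ℝ p r ^ 2 + k * (k + ‖p‖ ^ 2 + ‖r‖ ^ 2)) = k * c + inner ℝ p r := by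
    rw [Real.sqrt_eq_iff_mul_self_eq_of_pos (by nlinarith)]
    linear_combination k * hroot
  rw [joinCosh, hsqrt]
  field_simp
  ring

lemma one_lt_joinCosh (hk : 0 < k) (hpr : p ≠ r) : 1 < joinCosh k p r := by
  have hdist : 0 < ‖p - r‖ ^ 2 := by have := sub_ne_zero.2 hpr; positivity
  rw [norm_sub_sq_real] at hdist
  rw [joinCosh, lt_div_iff₀ hk, lt_sub_iff_add_lt]
  apply Real.lt_sqrt_of_sq_lt
  nlinarith

lemma joinSinh_pos (hk : 0 < k) (hpr : p ≠ r) : 0 < joinSinh k p r :=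
  Real.sqrt_pos.2 (by nlinarith [one_lt_joinCosh hk hpr])

lemma joinSinh_sq (hk : 0 < k) (hpr : p ≠ r) : joinSinh k p r ^ 2 = joinCosh k p r ^ 2 - 1 :=
  Real.sq_sqrt (by nlinarith [one_lt_joinCosh hk hpr])

lemma norm_sq_joinCoeff (hk : 0 < k) (hpr : p ≠ r) :
    ‖joinCoeff k p r‖ ^ 2 - ‖p‖ ^ 2 = k := by
  have hS := (joinSinh_pos hk hpr).ne'
  rw [joinCoeff, norm_smul, mul_pow, Real.norm_eq_abs, sq_abs, norm_sub_sq_real, norm_smul,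
    mul_pow, Real.norm_eq_abs, sq_abs, real_inner_smul_right, real_inner_comm]
  field_simp
  linear_combination (-k - ‖p‖ ^ 2) * joinSinh_sq hk hpr - joinCosh_root hk p r

lemma norm_lt_norm_joinCoeff (hk : 0 < k) (hpr : p ≠ r) : ‖p‖ < ‖joinCoeff k p r‖ := by
  refine lt_of_pow_lt_pow_left₀ 2 (norm_nonneg _) ?_
  linarith [norm_sq_joinCoeff hk hpr]

section Duration

variable {Ω : ℝ}

lemma sinh_joinDuration (hΩ : Ω ≠ 0) :
    Real.sinh (Ω * joinDuration Ω k p r) = joinSinh k p r := by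
  rw [joinDuration, mul_div_cancel₀ _ hΩ, Real.sinh_arsinh]

lemma cosh_joinDuration (hΩ : Ω ≠ 0) (hk : 0 < k) (hpr : p ≠ r) :
    Real.cosh (Ω * joinDuration Ω k p r) = joinCosh k p r := by
  rw [joinDuration, mul_div_cancel₀ _ hΩ, Real.cosh_arsinh, joinSinh_sq hk hpr,
    add_sub_cancel, Real.sqrt_sq (by linarith [one_lt_joinCosh hk hpr])]

lemma joinDuration_pos (hΩ : 0 < Ω) (hk : 0 < k) (hpr : p ≠ r) : 0 < joinDuration Ω k p r :=
  div_pos (Real.arsinh_pos_iff.2 (joinSinh_pos hk hpr)) hΩ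

lemma liftCurve_joinDuration (hΩ : Ω ≠ 0) (hk : 0 < k) (hpr : p ≠ r) :
    liftCurve Ω p (joinCoeff k p r) (joinDuration Ω k p r) = r := by
  rw [liftCurve, sinh_joinDuration hΩ, cosh_joinDuration hΩ hk hpr, joinCoeff,
    smul_inv_smul₀ (joinSinh_pos hk hpr).ne', add_sub_cancel]

lemma liftCurve_swap_joinDuration (hΩ : Ω ≠ 0) (hk : 0 < k) (hpr : p ≠ r) :
    liftCurve Ω (joinCoeff k p r) p (joinDuration Ω k p r) = -joinCoeff k r p := by
  have hS := (joinSinh_pos hk hpr).ne'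
  rw [← sub_eq_zero, ← smul_eq_zero_iff_right hS, liftCurve, sinh_joinDuration hΩ,
    cosh_joinDuration hΩ hk hpr, joinCoeff, joinCoeff, joinSinh_comm k r p, joinCosh_comm k r p]
  have hcancel (x : F) : joinSinh k p r • (joinSinh k p r)⁻¹ • x = x := smul_inv_smul₀ hS x
  have hsq : (joinSinh k p r ^ 2) • p = (joinCosh k p r ^ 2 - 1) • p := by
    rw [joinSinh_sq hk hpr]
  rw [smul_sub, smul_neg, smul_add, smul_comm _ (joinCosh k p r), hcancel, hcancel, smul_smul,
    ← sq, hsq]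
  module

lemma liftCurve_joinCoeff_eq_add (hΩ : Ω ≠ 0) (hk : 0 < k) (hpr : p ≠ r) (t : ℝ) :
    liftCurve Ω p (joinCoeff k p r) t =
      (Real.sinh (Ω * (joinDuration Ω k p r - t)) / joinSinh k p r) • p
        + (Real.sinh (Ω * t) / joinSinh k p r) • r := by
  have hS := (joinSinh_pos hk hpr).ne'
  rw [mul_sub, Real.sinh_sub, sinh_joinDuration hΩ, cosh_joinDuration hΩ hk hpr, liftCurve,
    joinCoeff]
  match_scalars
  · field_simp
    ring
  · field_simp

lemma exists_weights_liftCurve_of_mem_Ioo (hΩ : 0 < Ω) (hk : 0 < k) (hpr : p ≠ r) {t : ℝ}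
    (ht : t ∈ Ioo 0 (joinDuration Ω k p r)) :
    ∃ a b : ℝ, 0 < a ∧ 0 < b ∧ a + b < 1 ∧
      liftCurve Ω p (joinCoeff k p r) t = a • p + b • r := by
  have hS := joinSinh_pos hk hpr
  have hu : 0 < Ω * (joinDuration Ω k p r - t) := mul_pos hΩ (sub_pos.2 ht.2)
  have hv : 0 < Ω * t := mul_pos hΩ ht.1
  have hsu := Real.sinh_pos_iff.2 hu
  have hsv := Real.sinh_pos_iff.2 hv
  refine ⟨_, _, div_pos hsu hS, div_pos hsv hS, ?_, liftCurve_joinCoeff_eq_add hΩ.ne' hk hpr t⟩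
  have hadd : joinSinh k p r = Real.sinh (Ω * (joinDuration Ω k p r - t) + Ω * t) := by
    rw [← mul_add, sub_add_cancel, sinh_joinDuration hΩ.ne']
  rw [← add_div, div_lt_one hS, hadd, Real.sinh_add]
  nlinarith [Real.one_lt_cosh.2 hu.ne', Real.one_lt_cosh.2 hv.ne']

lemma exists_weights_liftCurve_of_mem_Icc (hΩ : 0 < Ω) (hk : 0 < k) (hpr : p ≠ r) {t : ℝ}
    (ht : t ∈ Icc 0 (joinDuration Ω k p r)) :
    ∃ a b : ℝ, 0 ≤ a ∧ 0 ≤ b ∧ 0 < a + b ∧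
      liftCurve Ω p (joinCoeff k p r) t = a • p + b • r := by
  rcases ht.1.eq_or_lt with rfl | h0
  · exact ⟨1, 0, by simp⟩
  rcases ht.2.eq_or_lt with rfl | h1
  · exact ⟨0, 1, by simp [liftCurve_joinDuration hΩ.ne' hk hpr]⟩
  · obtain ⟨a, b, ha, hb, -, hab⟩ := exists_weights_liftCurve_of_mem_Ioo hΩ hk hpr ⟨h0, h1⟩
    exact ⟨a, b, ha.le, hb.le, add_pos ha hb, hab⟩

lemma cosh_eq_joinCosh_of_liftCurve_eq (hk : 0 < k) {B : F} (hB : ‖B‖ ^ 2 - ‖p‖ ^ 2 = k) {t : ℝ}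
    (hr : liftCurve Ω p B t = r) : Real.cosh (Ω * t) = joinCosh k p r := by
  refine eq_joinCosh hk (Real.cosh_pos _) ?_
  rw [← hr, norm_sq_liftCurve, liftCurve, inner_add_right, real_inner_smul_right,
    real_inner_smul_right, real_inner_self_eq_norm_sq, sub_eq_iff_eq_add.1 hB]
  linear_combination (k + ‖p‖ ^ 2) * Real.cosh_sq (Ω * t)

lemma ne_of_liftCurve_eq (hΩ : 0 < Ω) (hk : 0 < k) {B : F} (hB : ‖B‖ ^ 2 - ‖p‖ ^ 2 = k) {t : ℝ}
    (ht : 0 < t) (hr : liftCurve Ω p B t = r) : p ≠ r := by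
  rintro rfl
  have hroot := joinCosh_root hk p p
  rw [← cosh_eq_joinCosh_of_liftCurve_eq hk hB hr, real_inner_self_eq_norm_sq] at hroot
  have hcosh := Real.one_lt_cosh.2 (mul_pos hΩ ht).ne'
  have hfactor : (Real.cosh (Ω * t) - 1) * (k * (Real.cosh (Ω * t) + 1) + 2 * ‖p‖ ^ 2) = 0 := by
    linear_combination hroot
  have hpos : 0 < (Real.cosh (Ω * t) - 1) * (k * (Real.cosh (Ω * t) + 1) + 2 * ‖p‖ ^ 2) :=
    mul_pos (sub_pos.2 hcosh) (by positivity)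
  exact hpos.ne' hfactor

lemma eq_join_of_liftCurve_eq (hΩ : 0 < Ω) (hk : 0 < k) {B : F} (hB : ‖B‖ ^ 2 - ‖p‖ ^ 2 = k)
    {t : ℝ} (ht : 0 < t) (hr : liftCurve Ω p B t = r) :
    t = joinDuration Ω k p r ∧ B = joinCoeff k p r := by
  have hs : 0 < Real.sinh (Ω * t) := Real.sinh_pos_iff.2 (mul_pos hΩ ht)
  have hcosh := cosh_eq_joinCosh_of_liftCurve_eq hk hB hr
  have hsinh : joinSinh k p r = Real.sinh (Ω * t) := by
    rw [joinSinh, ← hcosh, Real.cosh_sq, add_sub_cancel_right, Real.sqrt_sq hs.le]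
  constructor
  · rw [joinDuration, hsinh, Real.arsinh_sinh, mul_div_cancel_left₀ _ hΩ.ne']
  · rw [joinCoeff, hsinh, ← hcosh, ← hr, liftCurve, add_sub_cancel_left, inv_smul_smul₀ hs.ne']

end Duration

lemma contDiff_joinCosh {n : WithTop ℕ∞} (hk : 0 < k) :
    ContDiff ℝ n fun x : F × F => joinCosh k x.1 x.2 := by
  have hinner : ContDiff ℝ n fun x : F × F => inner ℝ x.1 x.2 := contDiff_fst.inner ℝ contDiff_snd
  have hradicand : ContDiff ℝ n fun x : F × F =>
      inner ℝ x.1 x.2 ^ 2 + k * (k + ‖x.1‖ ^ 2 + ‖x.2‖ ^ 2) :=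
    (hinner.pow 2).add (contDiff_const.mul
      ((contDiff_const.add (contDiff_fst.norm_sq ℝ)).add (contDiff_snd.norm_sq ℝ)))
  exact ((hradicand.sqrt fun x => (joinCosh_radicand_pos hk x.1 x.2).ne').sub hinner).div_const k

lemma contDiffAt_joinSinh {n : WithTop ℕ∞} (hk : 0 < k) (hpr : p ≠ r) :
    ContDiffAt ℝ n (fun x : F × F => joinSinh k x.1 x.2) (p, r) := by
  have hradicand : joinCosh k p r ^ 2 - 1 ≠ 0 := by nlinarith [one_lt_joinCosh hk hpr]
  exact (((contDiff_joinCosh hk).contDiffAt.pow 2).sub contDiffAt_const).sqrt hradicand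

lemma contDiffAt_joinDuration {n : WithTop ℕ∞} (Ω : ℝ) (hk : 0 < k) (hpr : p ≠ r) :
    ContDiffAt ℝ n (fun x : F × F => joinDuration Ω k x.1 x.2) (p, r) :=
  (Real.contDiff_arsinh.contDiffAt.comp (p, r) (contDiffAt_joinSinh hk hpr)).div_const Ω

lemma contDiffAt_joinCoeff {n : WithTop ℕ∞} (hk : 0 < k) (hpr : p ≠ r) :
    ContDiffAt ℝ n (fun x : F × F => joinCoeff k x.1 x.2) (p, r) :=
  ((contDiffAt_joinSinh hk hpr).inv (joinSinh_pos hk hpr).ne').smul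
    (contDiffAt_snd.sub ((contDiff_joinCosh hk).contDiffAt.smul contDiffAt_fst))

end Join

section NewtonEquation

lemma eventually_nhdsGT_eq_of_ode {E : Type*} [NormedAddCommGroup E] [NormedSpace ℝ E]
    {F : E → E} {f g : ℝ → E} {a b : ℝ} (hab : a < b) (hF : ContDiffAt ℝ 1 F (f a))
    (hf : ∀ᶠ s in 𝓝[Icc a b] a, HasDerivWithinAt f (F (f s)) (Icc a b) s)
    (hg : ∀ᶠ s in 𝓝[Icc a b] a, HasDerivWithinAt g (F (g s)) (Icc a b) s) (hfg : f a = g a) :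
    ∀ᶠ s in 𝓝[>] a, f s = g s := by
  obtain ⟨K, U, hU, hK⟩ := hF.exists_lipschitzOnWith
  have ha : a ∈ Icc a b := left_mem_Icc.2 hab.le
  have hfU : ∀ᶠ s in 𝓝[Icc a b] a, f s ∈ U :=
    (hf.self_of_nhdsWithin ha).continuousWithinAt.eventually_mem hU
  have hgU : ∀ᶠ s in 𝓝[Icc a b] a, g s ∈ U :=
    (hg.self_of_nhdsWithin ha).continuousWithinAt.eventually_mem (hfg ▸ hU)
  have hall := hf.and (hg.and (hfU.and hgU))
  rw [nhdsWithin_Icc_eq_nhdsGE hab, eventually_iff, mem_nhdsGE_iff_exists_Icc_subset] at hall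
  obtain ⟨c, hac : a < c, hc⟩ := hall
  have hright {x : ℝ → E} {x' : E} {s : ℝ} (hs : s ∈ Ico a (min b c))
      (hx : HasDerivWithinAt x x' (Icc a b) s) : HasDerivWithinAt x x' (Ici s) s :=
    hx.mono_of_mem_nhdsWithin <| mem_of_superset (Icc_mem_nhdsGE (hs.2.trans_le (min_le_left b c)))
      (Icc_subset_Icc_left hs.1)
  have hmem {s : ℝ} (hs : s ∈ Icc a (min b c)) := hc ⟨hs.1, hs.2.trans (min_le_right b c)⟩
  have hsub : Icc a (min b c) ⊆ Icc a b := Icc_subset_Icc_right (min_le_left b c)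
  have heq : EqOn f g (Icc a (min b c)) :=
    ODE_solution_unique_of_mem_Icc_right (v := fun _ => F) (s := fun _ => U) (fun _ _ => hK)
      (fun s hs => (hmem hs).1.continuousWithinAt.mono hsub)
      (fun s hs => hright hs (hmem (Ico_subset_Icc_self hs)).1)
      (fun s hs => (hmem (Ico_subset_Icc_self hs)).2.2.1)
      (fun s hs => (hmem hs).2.1.continuousWithinAt.mono hsub)
      (fun s hs => hright hs (hmem (Ico_subset_Icc_self hs)).2.1)
      (fun s hs => (hmem (Ico_subset_Icc_self hs)).2.2.2) hfg
  filter_upwards [Icc_mem_nhdsGT (lt_min hab hac)] with s hs using heq hs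

/-- At time `s` the curve `z`, with velocity `v`, satisfies `z'' = ∇V(z)` and has zero energy; the
derivatives are taken within `S`. Unlike in `HSAt`, the velocity is given explicitly, which makes
restriction and time reversal immediate. -/
structure IsSolutionAt (V : ℂ → ℝ) (S : Set ℝ) (z v : ℝ → ℂ) (s : ℝ) : Prop where
  position : HasDerivWithinAt z (v s) S s
  velocity : HasDerivWithinAt v (gradient V (z s)) S s
  energy : 1 / 2 * ‖v s‖ ^ 2 = V (z s)

variable {V : ℂ → ℝ} {S S' : Set ℝ} {T s : ℝ} {z v y w : ℝ → ℂ}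

lemma HSAt.isSolutionAt (hz : HSAt V T z s) :
    IsSolutionAt V (Icc 0 T) z (derivWithin z (Icc 0 T)) s :=
  ⟨hz.differentiable.hasDerivWithinAt, hz.newton, sub_eq_zero.1 hz.energy⟩

namespace IsSolutionAt

lemma mono (hz : IsSolutionAt V S z v s) (hS : S' ⊆ S) : IsSolutionAt V S' z v s :=
  ⟨hz.position.mono hS, hz.velocity.mono hS, hz.energy⟩

lemma reverse (hz : IsSolutionAt V S z v (T - s)) (hS : MapsTo (fun t => T - t) S' S) :
    IsSolutionAt V S' (fun t => z (T - t)) (fun t => -v (T - t)) s := by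
  have hsub : HasDerivWithinAt (fun t => T - t) (-1) S' s := (hasDerivWithinAt_id s S').const_sub T
  refine ⟨?_, ?_, by rw [norm_neg]; exact hz.energy⟩
  · simpa only [neg_smul, one_smul] using! hz.position.scomp s hsub hS
  · simpa only [neg_smul, one_smul, neg_neg] using! (hz.velocity.scomp s hsub hS).neg

lemma hsAt (hT : 0 < T) (hs : s ∈ Icc 0 T) (hz : ∀ᶠ t in 𝓝 s, IsSolutionAt V univ z v t) :
    HSAt V T z s := by
  have hderiv : ∀ᶠ t in 𝓝[Icc 0 T] s, derivWithin z (Icc 0 T) t = v t := by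
    filter_upwards [hz.filter_mono nhdsWithin_le_nhds, self_mem_nhdsWithin] with t ht htT
    exact (ht.mono (subset_univ _)).position.derivWithin (uniqueDiffOn_Icc hT t htT)
  have hsol := hz.self_of_nhds.mono (subset_univ (Icc 0 T))
  have hs_deriv := hderiv.self_of_nhdsWithin hs
  refine ⟨hsol.position.differentiableWithinAt,
    hsol.velocity.congr_of_eventuallyEq hderiv hs_deriv, ?_⟩
  rw [hs_deriv, hsol.energy, sub_self]

/-- The set of times where two solutions have the same position and velocity is closed, since the
positions are continuous and the velocities are so wherever the positions agree; by local
uniqueness it also contains a right neighbourhood of each of its points. -/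
lemma eqOn_Icc {U : Set ℂ} (hU : IsOpen U) (hV : ∀ x ∈ U, ContDiffAt ℝ 1 (gradient V) x)
    (hz : ∀ s ∈ Icc 0 T, z s ∈ U ∧ IsSolutionAt V (Icc 0 T) z v s) (hy : Continuous y)
    (hw : ∀ s, y s ∈ U → IsSolutionAt V univ y w s) (hzy : z 0 = y 0) (hvw : v 0 = w 0) :
    EqOn z y (Icc 0 T) := by
  have hwI {s : ℝ} (hs : y s ∈ U) := (hw s hs).mono (subset_univ (Icc 0 T))
  suffices hsub : Icc 0 T ⊆ {s | (z s, v s) = (y s, w s)} from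
    fun s hs => (Prod.mk.inj (hsub hs)).1
  refine IsClosed.Icc_subset_of_forall_mem_nhdsWithin ?_ (by simp [hzy, hvw]) ?_
  · refine isClosed_of_closure_subset fun s hs => ?_
    have hsT : s ∈ Icc 0 T := isClosed_Icc.closure_subset_iff.2 inter_subset_right hs
    have hmono := nhdsWithin_mono s (inter_subset_right (s := {s | (z s, v s) = (y s, w s)})
      (t := Icc 0 T))
    have : (𝓝[{s | (z s, v s) = (y s, w s)} ∩ Icc 0 T] s).NeBot :=
      mem_closure_iff_nhdsWithin_neBot.1 hs
    have hpos : z s = y s := tendsto_nhds_unique_of_eventuallyEq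
      ((hz s hsT).2.position.continuousWithinAt.mono_left hmono)
      (hy.continuousAt.mono_left nhdsWithin_le_nhds)
      (eventually_mem_nhdsWithin.mono fun t ht => (Prod.mk.inj ht.1).1)
    have hvel : v s = w s := tendsto_nhds_unique_of_eventuallyEq
      ((hz s hsT).2.velocity.continuousWithinAt.mono_left hmono)
      ((hwI (hpos ▸ (hz s hsT).1)).velocity.continuousWithinAt.mono_left hmono)
      (eventually_mem_nhdsWithin.mono fun t ht => (Prod.mk.inj ht.1).2)
    exact ⟨Prod.ext hpos hvel, hsT⟩
  · rintro s ⟨hs, hsT⟩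
    have hsub : Icc s T ⊆ Icc 0 T := Icc_subset_Icc_left hsT.1
    have hyU : y s ∈ U := (Prod.mk.inj hs).1 ▸ (hz s (Ico_subset_Icc_self hsT)).1
    refine eventually_nhdsGT_eq_of_ode (F := fun x : ℂ × ℂ => (x.2, gradient V x.1))
      (f := fun s => (z s, v s)) (g := fun s => (y s, w s)) hsT.2 ?_ ?_ ?_ hs
    · exact contDiffAt_snd.prodMk (ContDiffAt.comp (g := gradient V) (z s, v s)
        (hV _ (hz s (Ico_subset_Icc_self hsT)).1) contDiffAt_fst)
    · filter_upwards [self_mem_nhdsWithin] with t ht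
      have hsol := (hz t (hsub ht)).2.mono hsub
      exact hsol.position.prodMk hsol.velocity
    · filter_upwards [(hy.continuousAt.eventually_mem (hU.mem_nhds hyU)).filter_mono
        nhdsWithin_le_nhds] with t ht
      have hsol := (hwI ht).mono hsub
      exact hsol.position.prodMk hsol.velocity

end IsSolutionAt

end NewtonEquation

section Kepler

lemma hasGradientAt_norm_sq (z : ℂ) : HasGradientAt (fun y : ℂ => ‖y‖ ^ 2) ((2 : ℝ) • z) z := by
  rw [hasGradientAt_iff_hasFDerivAt, map_smul]
  exact (hasStrictFDerivAt_norm_sq z).hasFDerivAt.congr_fderiv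
    (ofNat_smul_eq_nsmul ℝ 2 (innerSL ℝ z)).symm

lemma gradient_innerPotential (E h μ : ℝ) {z : ℂ} (hz : z ≠ 0) :
    gradient (innerPotential E h μ) z = (-(μ / ‖z‖ ^ 3)) • z := by
  have hn : ‖z‖ ≠ 0 := norm_ne_zero_iff.2 hz
  have hnorm : HasFDerivAt (fun y : ℂ => ‖y‖) (‖z‖⁻¹ • innerSL ℝ z) z := by
    have hsqrt := (hasStrictFDerivAt_norm_sq z).hasFDerivAt.sqrt (by positivity)
    simp only [Real.sqrt_sq (norm_nonneg _)] at hsqrt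
    refine hsqrt.congr_fderiv ?_
    rw [← ofNat_smul_eq_nsmul ℝ, smul_smul]
    congr 1
    field_simp
  refine HasGradientAt.gradient (hasGradientAt_iff_hasFDerivAt.2 ?_)
  refine (((hasDerivAt_inv hn).comp_hasFDerivAt z hnorm).const_mul μ).const_add (E + h)
    |>.congr_fderiv ?_
  rw [map_smul, smul_smul, smul_smul]
  exact congrArg (· • innerSL ℝ z) (by field_simp)

lemma contDiffAt_gradient_innerPotential (E h μ : ℝ) {n : WithTop ℕ∞} {z : ℂ} (hz : z ≠ 0) :
    ContDiffAt ℝ n (gradient (innerPotential E h μ)) z := by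
  have hn : ‖z‖ ^ 3 ≠ 0 := pow_ne_zero 3 (norm_ne_zero_iff.2 hz)
  refine ContDiffAt.congr_of_eventuallyEq ?_ ((eventually_ne_nhds hz).mono fun y hy =>
    gradient_innerPotential E h μ hy)
  exact ((contDiffAt_const.div ((contDiffAt_norm ℝ hz).pow 3) hn).neg).smul contDiffAt_id

/-- The Kepler orbit with Levi-Civita coordinate `liftCurve Ω A B`, in the physical time. -/
def keplerOrbit (Ω : ℝ) (A B : ℂ) (s : ℝ) : ℂ := liftCurve Ω A B (clock Ω A B s) ^ 2

/-- The velocity of `keplerOrbit Ω A B` in the physical time, away from collisions: since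
`dz / ds = 2 w (dw / dτ) / (2 |w|²)`, it is `(dw / dτ) / conj w`. -/
def keplerVelocity (Ω : ℝ) (A B : ℂ) (s : ℝ) : ℂ :=
  Ω • liftCurve Ω B A (clock Ω A B s) / conj (liftCurve Ω A B (clock Ω A B s))

variable {Ω : ℝ} {A B : ℂ} {s : ℝ}

lemma keplerOrbit_ne_zero_iff : keplerOrbit Ω A B s ≠ 0 ↔ liftCurve Ω A B (clock Ω A B s) ≠ 0 := by
  rw [keplerOrbit, pow_ne_zero_iff two_ne_zero]

lemma keplerOrbit_physicalTime (hΩ : Ω ≠ 0) (hAB : ‖A‖ < ‖B‖) (t : ℝ) :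
    keplerOrbit Ω A B (physicalTime Ω A B t) = liftCurve Ω A B t ^ 2 := by
  rw [keplerOrbit, clock_physicalTime hΩ hAB]

lemma keplerOrbit_zero (hΩ : Ω ≠ 0) (hAB : ‖A‖ < ‖B‖) : keplerOrbit Ω A B 0 = A ^ 2 := by
  rw [keplerOrbit, clock_zero hΩ hAB, liftCurve_zero]

lemma keplerVelocity_zero (hΩ : Ω ≠ 0) (hAB : ‖A‖ < ‖B‖) :
    keplerVelocity Ω A B 0 = Ω • B / conj A := by
  rw [keplerVelocity, clock_zero hΩ hAB, liftCurve_zero, liftCurve_zero]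

lemma continuous_keplerOrbit (hΩ : 0 < Ω) (hAB : ‖A‖ < ‖B‖) : Continuous (keplerOrbit Ω A B) :=
  ((continuous_liftCurve Ω A B).comp (continuous_clock hΩ hAB)).pow 2

lemma contDiffAt_liftCurve_clock {n : WithTop ℕ∞} (hn : n ≠ 0) (hΩ : 0 < Ω) (hAB : ‖A‖ < ‖B‖)
    (hs : liftCurve Ω A B (clock Ω A B s) ≠ 0) :
    ContDiffAt ℝ n (fun x : ℝ × ℂ × ℂ => liftCurve Ω x.2.1 x.2.2 (clock Ω x.2.1 x.2.2 x.1))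
      (s, A, B) :=
  ContDiffAt.comp (g := fun x : ℝ × ℂ × ℂ => liftCurve Ω x.2.1 x.2.2 x.1)
    (f := fun x : ℝ × ℂ × ℂ => (clock Ω x.2.1 x.2.2 x.1, x.2)) (s, A, B)
    (contDiff_liftCurve Ω).contDiffAt
    ((contDiffAt_clock hn hΩ hAB hs).prodMk contDiff_snd.contDiffAt)

lemma contDiffAt_keplerOrbit {n : WithTop ℕ∞} (hn : n ≠ 0) (hΩ : 0 < Ω) (hAB : ‖A‖ < ‖B‖)
    (hs : keplerOrbit Ω A B s ≠ 0) :
    ContDiffAt ℝ n (fun x : ℝ × ℂ × ℂ => keplerOrbit Ω x.2.1 x.2.2 x.1) (s, A, B) :=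
  (contDiffAt_liftCurve_clock hn hΩ hAB (keplerOrbit_ne_zero_iff.1 hs)).pow 2

lemma hasDerivAt_keplerOrbit (hΩ : 0 < Ω) (hAB : ‖A‖ < ‖B‖) (hs : keplerOrbit Ω A B s ≠ 0) :
    HasDerivAt (keplerOrbit Ω A B) (keplerVelocity Ω A B s) s := by
  rw [keplerOrbit_ne_zero_iff] at hs
  have hconj : conj (liftCurve Ω A B (clock Ω A B s)) ≠ 0 := (map_ne_zero _).2 hs
  refine (((hasDerivAt_liftCurve Ω A B _).scomp s (hasDerivAt_clock hΩ hAB hs)).pow 2)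
    |>.congr_deriv ?_
  rw [keplerVelocity, ← Complex.normSq_eq_norm_sq]
  simp only [Function.comp_apply, Complex.real_smul, Complex.ofReal_inv, Complex.ofReal_mul,
    ← Complex.mul_conj]
  push_cast
  field_simp

lemma hasDerivAt_keplerVelocity (hΩ : 0 < Ω) (hAB : ‖A‖ < ‖B‖) (hs : keplerOrbit Ω A B s ≠ 0) :
    HasDerivAt (keplerVelocity Ω A B)
      ((-(Ω ^ 2 * (‖B‖ ^ 2 - ‖A‖ ^ 2) / 2 / ‖keplerOrbit Ω A B s‖ ^ 3)) • keplerOrbit Ω A B s)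
      s := by
  rw [keplerOrbit_ne_zero_iff] at hs
  have hconj : conj (liftCurve Ω A B (clock Ω A B s)) ≠ 0 := (map_ne_zero _).2 hs
  have hquot : HasDerivAt (fun t => Ω • liftCurve Ω B A t / conj (liftCurve Ω A B t)) _ _ :=
    ((hasDerivAt_liftCurve Ω B A _).const_smul Ω).div (hasDerivAt_liftCurve Ω A B _).star hconj
  refine (hquot.scomp s (hasDerivAt_clock hΩ hAB hs)).congr_deriv ?_
  have hswap := norm_sq_liftCurve_swap Ω A B (clock Ω A B s)
  rw [keplerOrbit, norm_pow, Pi.smul_apply]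
  generalize liftCurve Ω A B (clock Ω A B s) = w at *
  generalize liftCurve Ω B A (clock Ω A B s) = w' at *
  have hswap' : w' * conj w' = w * conj w + ((‖B‖ ^ 2 - ‖A‖ ^ 2 : ℝ) : ℂ) := by
    rw [Complex.mul_conj', Complex.mul_conj']
    exact_mod_cast hswap
  have hpow : (‖w‖ : ℂ) ^ 2 = w * conj w := (Complex.mul_conj' w).symm
  simp only [Complex.real_smul, Complex.star_def, map_mul, Complex.conj_ofReal]
  push_cast at hswap' ⊢
  rw [hpow]
  field_simp
  linear_combination (-(Ω : ℂ) ^ 2) * hswap'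

lemma energy_keplerVelocity (hs : keplerOrbit Ω A B s ≠ 0) :
    1 / 2 * ‖keplerVelocity Ω A B s‖ ^ 2
      = Ω ^ 2 / 2 + Ω ^ 2 * (‖B‖ ^ 2 - ‖A‖ ^ 2) / 2 / ‖keplerOrbit Ω A B s‖ := by
  have hw := norm_ne_zero_iff.2 (keplerOrbit_ne_zero_iff.1 hs)
  rw [keplerVelocity, norm_div, norm_smul, RCLike.norm_conj, div_pow, mul_pow,
    norm_sq_liftCurve_swap, keplerOrbit, norm_pow, Real.norm_eq_abs, sq_abs]
  field_simp

variable {E h μ k T c : ℝ} {z v : ℝ → ℂ} {p : ℂ}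

lemma isSolutionAt_keplerOrbit (hΩ : 0 < Ω) (hE : Ω ^ 2 / 2 = E + h) (hAB : ‖A‖ < ‖B‖)
    (hμ : Ω ^ 2 * (‖B‖ ^ 2 - ‖A‖ ^ 2) / 2 = μ) (hs : keplerOrbit Ω A B s ≠ 0) :
    IsSolutionAt (innerPotential E h μ) univ (keplerOrbit Ω A B) (keplerVelocity Ω A B) s := by
  refine ⟨(hasDerivAt_keplerOrbit hΩ hAB hs).hasDerivWithinAt, ?_, ?_⟩
  · rw [gradient_innerPotential E h μ hs, ← hμ]
    exact (hasDerivAt_keplerVelocity hΩ hAB hs).hasDerivWithinAt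
  · rw [energy_keplerVelocity hs, innerPotential, hE, hμ]

lemma hsAt_keplerOrbit (hΩ : 0 < Ω) (hE : Ω ^ 2 / 2 = E + h) (hAB : ‖A‖ < ‖B‖)
    (hμ : Ω ^ 2 * (‖B‖ ^ 2 - ‖A‖ ^ 2) / 2 = μ) (hs : s ∈ Icc 0 T) (hT : 0 < T)
    (hne : keplerOrbit Ω A B s ≠ 0) : HSAt (innerPotential E h μ) T (keplerOrbit Ω A B) s :=
  IsSolutionAt.hsAt hT hs <|
    ((continuous_keplerOrbit hΩ hAB).continuousAt.eventually_ne hne).mono fun _ =>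
      isSolutionAt_keplerOrbit hΩ hE hAB hμ

lemma exists_eqOn_keplerOrbit (hΩ : 0 < Ω) (hE : Ω ^ 2 / 2 = E + h) (hk : 0 < k)
    (hμ : Ω ^ 2 * k / 2 = μ) (hT : 0 ≤ T)
    (hz : ∀ s ∈ Icc 0 T, z s ≠ 0 ∧ IsSolutionAt (innerPotential E h μ) (Icc 0 T) z v s)
    (hp : p ^ 2 = z 0) :
    ‖v 0 * conj p / Ω‖ ^ 2 - ‖p‖ ^ 2 = k ∧
      EqOn z (keplerOrbit Ω p (v 0 * conj p / Ω)) (Icc 0 T) := by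
  obtain ⟨hz0, hsol⟩ := hz 0 (left_mem_Icc.2 hT)
  have hp0 : p ≠ 0 := by rintro rfl; exact hz0 (by rw [← hp, zero_pow two_ne_zero])
  have hnorm_p := norm_ne_zero_iff.2 hp0
  have hΩ' : (Ω : ℂ) ≠ 0 := Complex.ofReal_ne_zero.2 hΩ.ne'
  have hk' : ‖v 0 * conj p / Ω‖ ^ 2 - ‖p‖ ^ 2 = k := by
    have henergy := hsol.energy
    rw [innerPotential, ← hE, ← hp, norm_pow, ← hμ] at henergy
    rw [norm_div, norm_mul, RCLike.norm_conj, Complex.norm_real, Real.norm_of_nonneg hΩ.le]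
    field_simp at henergy ⊢
    linarith
  have hlt : ‖p‖ < ‖v 0 * conj p / Ω‖ := lt_of_pow_lt_pow_left₀ 2 (norm_nonneg _) (by linarith)
  refine ⟨hk', IsSolutionAt.eqOn_Icc isOpen_compl_singleton
    (fun x hx => contDiffAt_gradient_innerPotential E h μ hx) hz (continuous_keplerOrbit hΩ hlt)
    (fun s hs => isSolutionAt_keplerOrbit hΩ hE hlt (by rw [hk', hμ]) hs) ?_ ?_⟩
  · rw [keplerOrbit_zero hΩ.ne' hlt, hp]
  · have hconj : conj p ≠ 0 := (map_ne_zero _).2 hp0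
    rw [keplerVelocity_zero hΩ.ne' hlt, Complex.real_smul]
    field_simp

lemma eqOn_keplerOrbit_of_collision (hΩ : 0 < Ω) (hE : Ω ^ 2 / 2 = E + h) (hk : 0 < k)
    (hμ : Ω ^ 2 * k / 2 = μ) (hc : 0 < c) (hcont : ContinuousOn z (Icc 0 c)) (hzc : z c = 0)
    (hz : ∀ s ∈ Ico 0 c, z s ≠ 0 ∧ IsSolutionAt (innerPotential E h μ) (Icc 0 c) z v s)
    (hp : p ^ 2 = z 0) :
    physicalTime Ω p (joinCoeff k p 0) (joinDuration Ω k p 0) = c ∧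
      EqOn z (keplerOrbit Ω p (joinCoeff k p 0)) (Icc 0 c) := by
  have hbefore : ∀ c' ∈ Ico 0 c, ‖v 0 * conj p / Ω‖ ^ 2 - ‖p‖ ^ 2 = k ∧
      EqOn z (keplerOrbit Ω p (v 0 * conj p / Ω)) (Icc 0 c') := fun c' hc' =>
    exists_eqOn_keplerOrbit hΩ hE hk hμ hc'.1 (fun s hs =>
      have hzs := hz s ⟨hs.1, hs.2.trans_lt hc'.2⟩
      ⟨hzs.1, hzs.2.mono (Icc_subset_Icc_right hc'.2.le)⟩) hp
  generalize v 0 * conj p / Ω = B at hbefore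
  have hB : ‖B‖ ^ 2 - ‖p‖ ^ 2 = k := (hbefore 0 ⟨le_rfl, hc⟩).1
  have hlt : ‖p‖ < ‖B‖ := lt_of_pow_lt_pow_left₀ 2 (norm_nonneg _) (by linarith)
  have heq : EqOn z (keplerOrbit Ω p B) (Icc 0 c) :=
    EqOn.of_subset_closure (fun s hs => (hbefore s hs).2 ⟨hs.1, le_rfl⟩) hcont
      (continuous_keplerOrbit hΩ hlt).continuousOn Ico_subset_Icc_self (closure_Ico hc.ne).ge
  have hcollision : liftCurve Ω p B (clock Ω p B c) = 0 := by
    rw [← sq_eq_zero_iff, ← hzc, heq (right_mem_Icc.2 hc.le), keplerOrbit]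
  have hpos : 0 < clock Ω p B c := by
    rw [← clock_zero hΩ.ne' hlt]
    exact strictMono_clock hΩ hlt hc
  obtain ⟨hduration, rfl⟩ := eq_join_of_liftCurve_eq hΩ hk hB hpos hcollision
  exact ⟨by rw [← hduration, physicalTime_clock hΩ hlt], heq⟩

lemma eqOn_keplerOrbit_of_isEjectionCollision (hΩ : 0 < Ω) (hE : Ω ^ 2 / 2 = E + h) (hk : 0 < k)
    (hμ : Ω ^ 2 * k / 2 = μ) (h0 : p ^ 2 = z 0) (hT : p ^ 2 = z T)
    (hz : IsEjectionCollision E h μ T z) :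
    T = 2 * physicalTime Ω p (joinCoeff k p 0) (joinDuration Ω k p 0) ∧
      EqOn z (fun s => keplerOrbit Ω p (joinCoeff k p 0) (min s (T - s))) (Icc 0 T) := by
  obtain ⟨hcont, c, hc, hzc, hsol⟩ := hz
  have hne {s : ℝ} (hs : s ∈ Icc 0 T) (hsc : s ≠ c) : z s ≠ 0 ∧
      IsSolutionAt (innerPotential E h μ) (Icc 0 T) z (derivWithin z (Icc 0 T)) s :=
    ⟨(hsol s hs hsc).1, (hsol s hs hsc).2.isSolutionAt⟩
  have hsub : Icc 0 c ⊆ Icc 0 T := Icc_subset_Icc_right hc.2.le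
  have hmaps : MapsTo (fun s => T - s) (Icc 0 (T - c)) (Icc 0 T) := fun s hs =>
    ⟨by linarith [hs.2, hc.1], by linarith [hs.1]⟩
  obtain ⟨hc_eq, hejection⟩ := eqOn_keplerOrbit_of_collision hΩ hE hk hμ hc.1 (hcont.mono hsub) hzc
    (fun s hs => have hs' := hne (hsub (Ico_subset_Icc_self hs)) hs.2.ne
      ⟨hs'.1, hs'.2.mono hsub⟩) h0
  obtain ⟨hc_eq', hcollision⟩ := eqOn_keplerOrbit_of_collision (z := fun s => z (T - s))
    (v := fun s => -derivWithin z (Icc 0 T) (T - s)) hΩ hE hk hμ (sub_pos.2 hc.2)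
    (hcont.comp (by fun_prop) hmaps) (by rw [sub_sub_cancel, hzc])
    (fun s hs => have hs' := hne (hmaps (Ico_subset_Icc_self hs)) (by linarith [hs.2])
      ⟨hs'.1, hs'.2.reverse hmaps⟩) (by rw [sub_zero, hT])
  have hhalf : T - c = c := hc_eq'.symm.trans hc_eq
  refine ⟨by linarith [hhalf], fun s hs => ?_⟩
  rcases le_total s (T - s) with hle | hle
  · simp only [min_eq_left hle]
    exact hejection ⟨hs.1, by linarith [hhalf]⟩
  · have hs' := hcollision (x := T - s) ⟨by linarith [hs.2], by linarith [hhalf]⟩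
    simpa only [min_eq_right hle, sub_sub_cancel] using hs'

end Kepler

section NearCircle

/-- `h` is the logarithm of the polar radius of a closed curve around `0`, and the curve is
`C²`-close to the unit circle. Logarithmic radii are adapted to the squaring map, which only doubles
them. -/
structure NearCircle (κ : ℝ) (h : ℝ → ℝ) : Prop where
  contDiff : ContDiff ℝ 2 h
  periodic : Function.Periodic h (2 * Real.pi)
  abs_apply_le : ∀ ξ, |h ξ| ≤ κ
  abs_deriv_le : ∀ ξ, |deriv h ξ| ≤ κ
  abs_deriv_deriv_le : ∀ ξ, |deriv (deriv h) ξ| ≤ κ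

variable {c κ : ℝ} {F : ℝ × ℝ → ℝ}

lemma eventually_forall_abs_le_of_periodic (hc : 0 < c)
    (hF : ContinuousOn F (univ ×ˢ Ioo (-c) c))
    (hper : ∀ ε ∈ Ioo (-c) c, Function.Periodic (fun ξ => F (ξ, ε)) (2 * Real.pi))
    (hzero : ∀ ξ, F (ξ, 0) = 0) (hκ : 0 < κ) : ∀ᶠ ε in 𝓝 0, ∀ ξ, |F (ξ, ε)| ≤ κ := by
  have hstrip : Ioo (-c) c ∈ 𝓝 (0 : ℝ) := Ioo_mem_nhds (by linarith) hc
  have hperiod : ∀ᶠ ε in 𝓝 0, ∀ ξ ∈ Icc 0 (2 * Real.pi), |F (ξ, ε)| ≤ κ := by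
    refine isCompact_Icc.eventually_forall_of_forall_eventually fun ξ _ => ?_
    have hcont : ContinuousAt (fun q : ℝ × ℝ => F (q.2, q.1)) (0, ξ) :=
      (hF.continuousAt (prod_mem_nhds univ_mem hstrip)).comp (f := Prod.swap)
        continuous_swap.continuousAt
    have hsmall := hcont.eventually (Metric.ball_mem_nhds _ hκ)
    filter_upwards [hsmall] with q hq
    rw [hzero, Real.dist_0_eq_abs] at hq
    exact hq.le
  filter_upwards [hperiod, hstrip] with ε hε hεc ξ
  obtain ⟨y, hy, hξy⟩ := (hper ε hεc).exists_mem_Ico₀ Real.two_pi_pos ξ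
  rw [hξy]
  exact hε y (Ico_subset_Icc_self hy)

lemma periodic_deriv {g : ℝ → ℝ} {T : ℝ} (hg : Function.Periodic g T) :
    Function.Periodic (deriv g) T := fun x => by
  rw [← deriv_comp_add_const, funext hg]

lemma hasDerivAt_prodMk_left {x ε : ℝ} (hF : DifferentiableAt ℝ F (x, ε)) :
    HasDerivAt (fun y => F (y, ε)) (fderiv ℝ F (x, ε) (1, 0)) x :=
  hF.hasFDerivAt.comp_hasDerivAt x ((hasDerivAt_id x).prodMk (hasDerivAt_const x ε))

lemma exists_deriv_slice {m n : WithTop ℕ∞} (hmn : m + 1 ≤ n) (hc : 0 < c)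
    (hF : ContDiffOn ℝ n F (univ ×ˢ Ioo (-c) c))
    (hper : ∀ ε ∈ Ioo (-c) c, Function.Periodic (fun ξ => F (ξ, ε)) (2 * Real.pi))
    (hzero : ∀ ξ, F (ξ, 0) = 0) :
    ∃ G : ℝ × ℝ → ℝ, ContDiffOn ℝ m G (univ ×ˢ Ioo (-c) c) ∧
      (∀ ε ∈ Ioo (-c) c, deriv (fun ξ => F (ξ, ε)) = fun ξ => G (ξ, ε)) ∧
      (∀ ε ∈ Ioo (-c) c, Function.Periodic (fun ξ => G (ξ, ε)) (2 * Real.pi)) ∧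
      ∀ ξ, G (ξ, 0) = 0 := by
  have hopen : IsOpen (univ ×ˢ Ioo (-c) c : Set (ℝ × ℝ)) := isOpen_univ.prod isOpen_Ioo
  have hn : n ≠ 0 := (zero_lt_one.trans_le (le_add_self.trans hmn)).ne'
  have hderiv : ∀ ε ∈ Ioo (-c) c,
      deriv (fun ξ => F (ξ, ε)) = fun ξ => fderiv ℝ F (ξ, ε) (1, 0) :=
    fun ε hε => funext fun ξ => (hasDerivAt_prodMk_left
      ((hF.contDiffAt (hopen.mem_nhds ⟨mem_univ _, hε⟩)).differentiableAt hn)).deriv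
  refine ⟨fun p => fderiv ℝ F p (1, 0), (hF.fderiv_of_isOpen hopen hmn).clm_apply contDiffOn_const,
    hderiv, fun ε hε => hderiv ε hε ▸ periodic_deriv (hper ε hε), fun ξ => ?_⟩
  simp only [← congrFun (hderiv 0 ⟨neg_lt_zero.2 hc, hc⟩) ξ, hzero, deriv_const]

lemma eventually_nearCircle_of_contDiffOn (hc : 0 < c)
    (hF : ContDiffOn ℝ 2 F (univ ×ˢ Ioo (-c) c))
    (hper : ∀ ε ∈ Ioo (-c) c, Function.Periodic (fun ξ => F (ξ, ε)) (2 * Real.pi))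
    (hzero : ∀ ξ, F (ξ, 0) = 0) (hκ : 0 < κ) :
    ∀ᶠ ε in 𝓝 0, NearCircle κ fun ξ => F (ξ, ε) := by
  obtain ⟨G, hG, hderivF, hperG, hzeroG⟩ :=
    exists_deriv_slice (m := 1) (by norm_num) hc hF hper hzero
  obtain ⟨H, hH, hderivG, hperH, hzeroH⟩ :=
    exists_deriv_slice (m := 0) (by norm_num) hc hG hperG hzeroG
  filter_upwards [Ioo_mem_nhds (neg_lt_zero.2 hc) hc,
    eventually_forall_abs_le_of_periodic hc hF.continuousOn hper hzero hκ,
    eventually_forall_abs_le_of_periodic hc hG.continuousOn hperG hzeroG hκ,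
    eventually_forall_abs_le_of_periodic hc hH.continuousOn hperH hzeroH hκ] with ε hε hF0 hF1 hF2
  refine ⟨?_, hper ε hε, hF0, by rwa [hderivF ε hε], by rwa [hderivF ε hε, hderivG ε hε]⟩
  exact contDiff_iff_contDiffAt.2 fun ξ => (hF.contDiffAt (prod_mem_nhds univ_mem
    (Ioo_mem_nhds hε.1 hε.2))).comp ξ (contDiffAt_id.prodMk contDiffAt_const)

/-- The logarithm of the polar radius `1 + ε f(ξ; ε)` of the curve `boundaryCurve f ε`, and junk
where this radius is not positive. -/
def logRadius (f : ℝ → ℝ → ℝ) (ε ξ : ℝ) : ℝ := Real.log (1 + ε * f ξ ε)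

lemma eventually_nearCircle_logRadius {f : ℝ → ℝ → ℝ} (hc : 0 < c)
    (hper : ∀ ε ∈ Icc (-c) c, Function.Periodic (fun ξ => f ξ ε) (2 * Real.pi))
    (hf : ContDiffOn ℝ 2 (fun p : ℝ × ℝ => f p.1 p.2) (univ ×ˢ Icc (-c) c)) (hκ : 0 < κ) :
    ∀ᶠ ε in 𝓝 0, NearCircle κ (logRadius f ε) ∧ ∀ ξ, 0 < 1 + ε * f ξ ε := by
  have hmul : ContDiffOn ℝ 2 (fun p : ℝ × ℝ => p.2 * f p.1 p.2) (univ ×ˢ Ioo (-c) c) :=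
    contDiff_snd.contDiffOn.mul (hf.mono (prod_mono le_rfl Ioo_subset_Icc_self))
  have hpos : ∀ᶠ ε in 𝓝 (0 : ℝ), ∀ ξ, 0 < 1 + ε * f ξ ε := by
    have hmulper : ∀ ε ∈ Ioo (-c) c, Function.Periodic (fun ξ => ε * f ξ ε) (2 * Real.pi) :=
      fun ε hε ξ => congrArg (ε * ·) (hper ε (Ioo_subset_Icc_self hε) ξ)
    filter_upwards [eventually_forall_abs_le_of_periodic hc hmul.continuousOn hmulper
      (fun ξ => zero_mul _) one_half_pos] with ε hε ξ
    linarith [(abs_le.1 (hε ξ)).1]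
  obtain ⟨d, hd, hball⟩ := Metric.eventually_nhds_iff.1 hpos
  have hsub : Ioo (-min c d) (min c d) ⊆ Ioo (-c) c :=
    Ioo_subset_Ioo (neg_le_neg (min_le_left _ _)) (min_le_left _ _)
  have hlog : ContDiffOn ℝ 2 (fun p : ℝ × ℝ => logRadius f p.2 p.1)
      (univ ×ˢ Ioo (-min c d) (min c d)) := by
    refine (contDiffOn_const.add (hmul.mono (prod_mono le_rfl hsub))).log fun p hp => ?_
    refine (hball ?_ p.1).ne'
    rw [Real.dist_0_eq_abs, abs_lt]
    exact ⟨by linarith [hp.2.1, min_le_right c d], hp.2.2.trans_le (min_le_right _ _)⟩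
  refine (eventually_nearCircle_of_contDiffOn (lt_min hc hd) hlog (fun ε hε ξ => ?_)
    (fun ξ => by simp [logRadius]) hκ).and hpos
  have hfper : f (ξ + 2 * Real.pi) ε = f ξ ε := hper ε (Ioo_subset_Icc_self (hsub hε)) ξ
  simp only [logRadius, hfper]

lemma exists_forall_nearCircle_logRadius {f : ℝ → ℝ → ℝ} (hc : 0 < c)
    (hper : ∀ ε ∈ Icc (-c) c, Function.Periodic (fun ξ => f ξ ε) (2 * Real.pi))
    (hf : ContDiffOn ℝ 2 (fun p : ℝ × ℝ => f p.1 p.2) (univ ×ˢ Icc (-c) c)) (hκ : 0 < κ) :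
    ∃ d, 0 < d ∧ d ≤ c ∧
      ∀ ε, |ε| < d → NearCircle κ (logRadius f ε) ∧ ∀ ξ, 0 < 1 + ε * f ξ ε := by
  obtain ⟨d, hd, hball⟩ :=
    Metric.eventually_nhds_iff.1 (eventually_nearCircle_logRadius hc hper hf hκ)
  refine ⟨min c d, lt_min hc hd, min_le_left _ _, fun ε hε => hball ?_⟩
  rw [Real.dist_0_eq_abs]
  exact hε.trans_le (min_le_right _ _)

end NearCircle

section RadialExtension

/-- The positively homogeneous function on the plane which is `φ` on the unit circle. -/
def radialExtension (φ : ℝ → ℝ) (z : ℂ) : ℝ := ‖z‖ * φ z.arg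

/-- The linear form tangent to `radialExtension φ` along the ray of angle `θ`. -/
def radialTangent (φ : ℝ → ℝ) (θ : ℝ) : ℂ →ₗ[ℝ] ℝ :=
  Complex.reLm ∘ₗ
    LinearMap.mulRight ℝ ((φ θ - deriv φ θ * Complex.I) * Complex.exp (-θ * Complex.I))

variable {φ : ℝ → ℝ}

lemma apply_arg_ofReal_mul_exp (hφ : Function.Periodic φ (2 * Real.pi)) {r : ℝ} (hr : 0 < r)
    (θ : ℝ) : φ (r * Complex.exp (θ * Complex.I)).arg = φ θ := by
  rw [Complex.arg_real_mul _ hr, Complex.arg_exp_mul_I, toIocMod, hφ.sub_zsmul_eq]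

lemma radialExtension_ofReal_mul_exp (hφ : Function.Periodic φ (2 * Real.pi)) {r : ℝ} (hr : 0 ≤ r)
    (θ : ℝ) : radialExtension φ (r * Complex.exp (θ * Complex.I)) = r * φ θ := by
  rw [radialExtension, norm_mul, Complex.norm_exp_ofReal_mul_I, Complex.norm_of_nonneg hr, mul_one]
  rcases hr.eq_or_lt with rfl | hr
  · simp only [zero_mul]
  · rw [apply_arg_ofReal_mul_exp hφ hr]

lemma radialExtension_smul (φ : ℝ → ℝ) {a : ℝ} (ha : 0 ≤ a) (z : ℂ) :
    radialExtension φ (a • z) = a * radialExtension φ z := by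
  rcases ha.eq_or_lt with rfl | ha
  · simp [radialExtension]
  · rw [radialExtension, radialExtension, Complex.real_smul, Complex.arg_real_mul _ ha, norm_mul,
      Complex.norm_of_nonneg ha.le, mul_assoc]

lemma radialTangent_arg_self (φ : ℝ → ℝ) (z : ℂ) :
    radialTangent φ z.arg z = radialExtension φ z := by
  have hz : z * ((φ z.arg - deriv φ z.arg * Complex.I) * Complex.exp (-z.arg * Complex.I)) =
      ‖z‖ * (φ z.arg - deriv φ z.arg * Complex.I) := by
    nth_rw 1 [← Complex.norm_mul_exp_arg_mul_I z]
    rw [neg_mul, Complex.exp_neg]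
    field_simp
  rw [radialTangent, LinearMap.comp_apply, LinearMap.mulRight_apply, hz, Complex.reLm_coe,
    Complex.re_ofReal_mul]
  simp [radialExtension]

/-- The derivative of `φ t cos (θ + x - t) + φ' t sin (θ + x - t)` is
`(φ t + φ'' t) sin (θ + x - t)`. -/
lemma mul_cos_add_deriv_mul_sin_le (hφ : ContDiff ℝ 2 φ) (hφ₀ : ∀ t, 0 ≤ φ t + deriv (deriv φ) t)
    (θ : ℝ) {x : ℝ} (hx : |x| ≤ Real.pi) :
    φ θ * Real.cos x + deriv φ θ * Real.sin x ≤ φ (θ + x) := by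
  set q : ℝ → ℝ := fun t => φ t * Real.cos (θ + x - t) + deriv φ t * Real.sin (θ + x - t) with hq
  have hderiv : ∀ t, HasDerivAt q ((φ t + deriv (deriv φ) t) * Real.sin (θ + x - t)) t := by
    intro t
    have hφ₁ := (hφ.differentiable (by norm_num) t).hasDerivAt
    have hφ₂ := ((hφ.deriv' (n := 1)).differentiable (by norm_num) t).hasDerivAt
    have hsub : HasDerivAt (fun t => θ + x - t) (-1) t := (hasDerivAt_id t).const_sub _
    exact ((hφ₁.mul hsub.cos).add (hφ₂.mul hsub.sin)).congr_deriv (by ring)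
  have hcont : Continuous q := continuous_iff_continuousAt.2 fun t => (hderiv t).continuousAt
  suffices q θ ≤ q (θ + x) by
    simp only [hq, add_sub_cancel_left, sub_self, Real.cos_zero, Real.sin_zero] at this
    linarith
  rcases le_total 0 x with hx0 | hx0
  · rw [abs_of_nonneg hx0] at hx
    refine monotoneOn_of_hasDerivWithinAt_nonneg (convex_Icc θ (θ + x)) hcont.continuousOn
      (fun t _ => (hderiv t).hasDerivWithinAt) (fun t ht => ?_) ?_ ?_ ?_
    · rw [interior_Icc] at ht
      exact mul_nonneg (hφ₀ t)
        (Real.sin_nonneg_of_nonneg_of_le_pi (by linarith [ht.2]) (by linarith [ht.1]))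
    all_goals simp [hx0]
  · rw [abs_of_nonpos hx0] at hx
    refine antitoneOn_of_hasDerivWithinAt_nonpos (convex_Icc (θ + x) θ) hcont.continuousOn
      (fun t _ => (hderiv t).hasDerivWithinAt) (fun t ht => ?_) ?_ ?_ ?_
    · rw [interior_Icc] at ht
      exact mul_nonpos_of_nonneg_of_nonpos (hφ₀ t)
        (Real.sin_nonpos_of_nonpos_of_neg_pi_le (by linarith [ht.1]) (by linarith [ht.2]))
    all_goals simp [hx0]

lemma radialTangent_le_radialExtension (hφ : ContDiff ℝ 2 φ)
    (hper : Function.Periodic φ (2 * Real.pi)) (hφ₀ : ∀ t, 0 ≤ φ t + deriv (deriv φ) t)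
    (θ : ℝ) (z : ℂ) : radialTangent φ θ z ≤ radialExtension φ z := by
  set w := z * Complex.exp (-θ * Complex.I) with hw
  have hwnorm : ‖w‖ = ‖z‖ := by
    rw [hw, norm_mul, ← Complex.ofReal_neg, Complex.norm_exp_ofReal_mul_I, mul_one]
  have hz : z = ‖z‖ * Complex.exp ((θ + w.arg : ℝ) * Complex.I) := by
    rw [Complex.ofReal_add, add_mul, Complex.exp_add, ← hwnorm, mul_left_comm,
      Complex.norm_mul_exp_arg_mul_I, hw, mul_left_comm, ← Complex.exp_add, neg_mul, add_neg_cancel,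
      Complex.exp_zero, mul_one]
  have htangent : radialTangent φ θ z = φ θ * w.re + deriv φ θ * w.im := by
    rw [radialTangent, LinearMap.comp_apply, LinearMap.mulRight_apply, mul_left_comm, ← hw,
      Complex.reLm_coe]
    simp
  have hextension : radialExtension φ z = ‖z‖ * φ (θ + w.arg) := by
    nth_rw 1 [hz]
    exact radialExtension_ofReal_mul_exp hper (norm_nonneg z) _
  have hre : w.re = ‖z‖ * Real.cos w.arg := by rw [← hwnorm, Complex.norm_mul_cos_arg]
  have him : w.im = ‖z‖ * Real.sin w.arg := by rw [← hwnorm, Complex.norm_mul_sin_arg]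
  rw [htangent, hextension, hre, him]
  linear_combination ‖z‖ * mul_cos_add_deriv_mul_sin_le hφ hφ₀ θ (Complex.abs_arg_le_pi w)

lemma radialExtension_add_le (hφ : ContDiff ℝ 2 φ) (hper : Function.Periodic φ (2 * Real.pi))
    (hφ₀ : ∀ t, 0 ≤ φ t + deriv (deriv φ) t) (z w : ℂ) :
    radialExtension φ (z + w) ≤ radialExtension φ z + radialExtension φ w := by
  rw [← radialTangent_arg_self φ (z + w), map_add]
  exact add_le_add (radialTangent_le_radialExtension hφ hper hφ₀ _ z)
    (radialTangent_le_radialExtension hφ hper hφ₀ _ w)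

lemma radialExtension_sqrt_add_le (hφ : ContDiff ℝ 2 φ) (hper : Function.Periodic φ (2 * Real.pi))
    (hpos : ∀ t, 0 < φ t)
    (hφ₀ : ∀ t, deriv φ t ^ 2 ≤ 2 * φ t * (2 * φ t + deriv (deriv φ) t)) (z w : ℂ) :
    radialExtension (fun t => √(φ t)) (z + w) ≤
      radialExtension (fun t => √(φ t)) z + radialExtension (fun t => √(φ t)) w := by
  refine radialExtension_add_le (hφ.sqrt fun t => (hpos t).ne') (hper.comp Real.sqrt) (fun t => ?_)
    z w
  have hφ₁ : ∀ t, HasDerivAt φ (deriv φ t) t := fun t =>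
    (hφ.differentiable (by norm_num) t).hasDerivAt
  have hφ₂ : HasDerivAt (deriv φ) (deriv (deriv φ) t) t :=
    ((hφ.deriv' (n := 1)).differentiable (by norm_num) t).hasDerivAt
  have hsqrt : ∀ t, HasDerivAt (fun t => √(φ t)) (deriv φ t / (2 * √(φ t))) t := fun t =>
    (hφ₁ t).sqrt (hpos t).ne'
  have hr : 0 < √(φ t) := Real.sqrt_pos.2 (hpos t)
  rw [funext fun t => (hsqrt t).deriv,
    (hφ₂.fun_div ((hsqrt t).const_mul 2) (mul_pos two_pos hr).ne').deriv]
  have hcurvature := hφ₀ t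
  rw [← Real.sq_sqrt (hpos t).le] at hcurvature
  have hsum : √(φ t) + (deriv (deriv φ) t * (2 * √(φ t)) -
      deriv φ t * (2 * (deriv φ t / (2 * √(φ t))))) / (2 * √(φ t)) ^ 2 =
      (2 * √(φ t) ^ 2 * (2 * √(φ t) ^ 2 + deriv (deriv φ) t) - deriv φ t ^ 2) /
        (4 * √(φ t) ^ 3) := by
    field_simp
    ring
  rw [hsum]
  exact div_nonneg (sub_nonneg.2 hcurvature) (by positivity)

lemma norm_sq_mul_smul_add_smul_le (hφ : ContDiff ℝ 2 φ)
    (hper : Function.Periodic φ (2 * Real.pi)) (hpos : ∀ t, 0 < φ t)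
    (hφ₀ : ∀ t, deriv φ t ^ 2 ≤ 2 * φ t * (2 * φ t + deriv (deriv φ) t)) {a b : ℝ} (ha : 0 ≤ a)
    (hb : 0 ≤ b) (z w : ℂ) :
    ‖a • z + b • w‖ ^ 2 * φ (a • z + b • w).arg ≤
      (a + b) * (a * (‖z‖ ^ 2 * φ z.arg) + b * (‖w‖ ^ 2 * φ w.arg)) := by
  set N := radialExtension fun t => √(φ t)
  have hsq : ∀ x, N x ^ 2 = ‖x‖ ^ 2 * φ x.arg := fun x => by
    rw [← Real.sq_sqrt (hpos x.arg).le, ← mul_pow]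
    rfl
  have hadd : N (a • z + b • w) ≤ a * N z + b * N w := by
    rw [← radialExtension_smul _ ha, ← radialExtension_smul _ hb]
    exact radialExtension_sqrt_add_le hφ hper hpos hφ₀ _ _
  have hN : 0 ≤ N (a • z + b • w) := mul_nonneg (norm_nonneg _) (Real.sqrt_nonneg _)
  rw [← hsq, ← hsq, ← hsq]
  calc N (a • z + b • w) ^ 2 ≤ (a * N z + b * N w) ^ 2 := pow_le_pow_left₀ hN hadd 2
    _ ≤ (a + b) * (a * N z ^ 2 + b * N w ^ 2) := by
      linarith [mul_nonneg (mul_nonneg ha hb) (sq_nonneg (N z - N w))]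

end RadialExtension

section PolarCurve

/-- The closed curve with logarithmic polar radius `h`. -/
def polarCurve (h : ℝ → ℝ) (ξ : ℝ) : ℂ := Complex.exp (h ξ + ξ * Complex.I)

/-- The square root of `polarCurve h ξ` with argument `ξ / 2`: a boundary point in the Levi-Civita
plane. -/
def polarSqrt (h : ℝ → ℝ) (ξ : ℝ) : ℂ := Complex.exp ((h ξ + ξ * Complex.I) / 2)

/-- The gauge (Minkowski functional) of the domain bounded by `polarCurve h`. -/
def radialGauge (h : ℝ → ℝ) : ℂ → ℝ := radialExtension fun θ => Real.exp (-h θ)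

variable {h : ℝ → ℝ} {κ ξ : ℝ}

lemma polarSqrt_sq (h : ℝ → ℝ) (ξ : ℝ) : polarSqrt h ξ ^ 2 = polarCurve h ξ := by
  rw [polarSqrt, ← Complex.exp_nat_mul, Nat.cast_two, mul_div_cancel₀ _ two_ne_zero, polarCurve]

lemma norm_polarCurve (h : ℝ → ℝ) (ξ : ℝ) : ‖polarCurve h ξ‖ = Real.exp (h ξ) := by
  simp [polarCurve, Complex.norm_exp]

lemma hasDerivAt_polarCurve (hh : Differentiable ℝ h) (ξ : ℝ) :
    HasDerivAt (polarCurve h) ((deriv h ξ + Complex.I) * polarCurve h ξ) ξ := by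
  have hexponent : HasDerivAt (fun t : ℝ => (h t + t * Complex.I : ℂ))
      (deriv h ξ + (1 : ℝ) * Complex.I) ξ :=
    (hh ξ).hasDerivAt.ofReal_comp.add ((hasDerivAt_id ξ).ofReal_comp.mul_const _)
  exact hexponent.cexp.congr_deriv (by rw [polarCurve, Complex.ofReal_one, one_mul, mul_comm])

lemma contDiff_polarSqrt {n : WithTop ℕ∞} (hh : ContDiff ℝ n h) : ContDiff ℝ n (polarSqrt h) :=
  (((Complex.ofRealCLM.contDiff.comp hh).add
    (Complex.ofRealCLM.contDiff.mul contDiff_const)).div_const 2).cexp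

lemma periodic_exp_neg (hh : Function.Periodic h (2 * Real.pi)) :
    Function.Periodic (fun θ => Real.exp (-h θ)) (2 * Real.pi) :=
  hh.comp fun x => Real.exp (-x)

lemma radialGauge_nonneg (h : ℝ → ℝ) (z : ℂ) : 0 ≤ radialGauge h z :=
  mul_nonneg (norm_nonneg _) (Real.exp_pos _).le

lemma radialGauge_smul (h : ℝ → ℝ) {a : ℝ} (ha : 0 ≤ a) (z : ℂ) :
    radialGauge h (a • z) = a * radialGauge h z :=
  radialExtension_smul _ ha z

lemma radialGauge_polarCurve (hh : Function.Periodic h (2 * Real.pi)) (ξ : ℝ) :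
    radialGauge h (polarCurve h ξ) = 1 := by
  rw [polarCurve, Complex.exp_add, ← Complex.ofReal_exp, radialGauge,
    radialExtension_ofReal_mul_exp (periodic_exp_neg hh) (Real.exp_pos _).le, ← Real.exp_add,
    add_neg_cancel, Real.exp_zero]

lemma radialGauge_sq (hh : Function.Periodic h (2 * Real.pi)) (w : ℂ) :
    radialGauge h (w ^ 2) = radialGauge (fun θ => h (2 * θ) / 2) w ^ 2 := by
  have hpolar : w ^ 2 = (‖w‖ ^ 2 : ℝ) * Complex.exp ((2 * w.arg : ℝ) * Complex.I) := by
    nth_rw 1 [← Complex.norm_mul_exp_arg_mul_I w]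
    rw [mul_pow, ← Complex.exp_nat_mul]
    push_cast
    ring_nf
  rw [hpolar, radialGauge, radialExtension_ofReal_mul_exp (periodic_exp_neg hh) (sq_nonneg _),
    radialGauge, radialExtension, mul_pow, ← Real.exp_nat_mul]
  congr 2
  push_cast
  ring

lemma deriv_deriv_exp_neg (hh : ContDiff ℝ 2 h) (t : ℝ) :
    deriv (deriv fun θ => Real.exp (-h θ)) t =
      Real.exp (-h t) * (deriv h t ^ 2 - deriv (deriv h) t) := by
  have hh₁ : ∀ t, HasDerivAt h (deriv h t) t := fun t =>
    (hh.differentiable (by norm_num) t).hasDerivAt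
  have hh₂ : HasDerivAt (deriv h) (deriv (deriv h) t) t :=
    ((hh.deriv' (n := 1)).differentiable (by norm_num) t).hasDerivAt
  rw [funext fun t => (hh₁ t).fun_neg.exp.deriv]
  exact ((hh₁ t).fun_neg.exp.mul hh₂.neg).deriv.trans (by simp only [Pi.neg_apply]; ring)

namespace NearCircle

lemma nonneg_exp_neg_add_deriv_deriv (hh : NearCircle κ h) (hκ : κ ≤ 1) (t : ℝ) :
    0 ≤ Real.exp (-h t) + deriv (deriv fun θ => Real.exp (-h θ)) t := by
  rw [deriv_deriv_exp_neg hh.contDiff, ← mul_one_add]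
  refine mul_nonneg (Real.exp_pos _).le ?_
  linarith [(abs_le.1 (hh.abs_deriv_deriv_le t)).2, sq_nonneg (deriv h t)]

lemma comp_two_mul_div_two (hh : NearCircle κ h) : NearCircle (2 * κ) fun θ => h (2 * θ) / 2 := by
  have hκ : 0 ≤ κ := (abs_nonneg _).trans (hh.abs_apply_le 0)
  have hdouble : ∀ (g : ℝ → ℝ) (t : ℝ), deriv (fun θ => g (2 * θ)) t = 2 * deriv g (2 * t) :=
    fun g t => deriv_comp_mul_left 2 g t
  have hderiv : deriv (fun θ => h (2 * θ) / 2) = fun θ => deriv h (2 * θ) := funext fun t => by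
    rw [deriv_div_const, hdouble, mul_div_cancel_left₀ _ two_ne_zero]
  refine ⟨(hh.contDiff.comp (contDiff_const.mul contDiff_id)).div_const 2, fun θ => ?_, fun θ => ?_,
    fun θ => ?_, fun θ => ?_⟩
  · rw [mul_add, show h (2 * θ + 2 * (2 * Real.pi)) = h (2 * θ) from hh.periodic.nat_mul 2 _]
  · rw [abs_div, abs_two]
    linarith [hh.abs_apply_le (2 * θ)]
  · rw [hderiv]
    linarith [hh.abs_deriv_le (2 * θ)]
  · rw [hderiv, hdouble, abs_mul, abs_two]
    linarith [hh.abs_deriv_deriv_le (2 * θ)]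

lemma radialGauge_add_le (hh : NearCircle κ h) (hκ : κ ≤ 1) (z w : ℂ) :
    radialGauge h (z + w) ≤ radialGauge h z + radialGauge h w :=
  radialExtension_add_le hh.contDiff.neg.exp (periodic_exp_neg hh.periodic)
    (hh.nonneg_exp_neg_add_deriv_deriv hκ) z w

lemma radialGauge_smul_sub_smul_polarSqrt_lt_one (hh : NearCircle κ h) (hκ : κ ≤ 1 / 2) {a b : ℝ}
    (ha : 0 ≤ a) (hb : 0 ≤ b) (hab : a + b < 1) (ξ₀ ξ₁ : ℝ) :
    radialGauge h ((a • polarSqrt h ξ₀ + b • -polarSqrt h ξ₁) ^ 2) < 1 := by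
  set g : ℝ → ℝ := fun θ => h (2 * θ) / 2
  have hboundary : ∀ w ξ, w ^ 2 = polarCurve h ξ → radialGauge g w = 1 := fun w ξ hw => by
    rw [← sq_eq_sq₀ (radialGauge_nonneg g w) zero_le_one, ← radialGauge_sq hh.periodic, hw,
      radialGauge_polarCurve hh.periodic, one_pow]
  have hconvex := hh.comp_two_mul_div_two.radialGauge_add_le (by linarith) (a • polarSqrt h ξ₀)
    (b • -polarSqrt h ξ₁)
  rw [radialGauge_smul g ha, radialGauge_smul g hb, hboundary _ ξ₀ (polarSqrt_sq h ξ₀),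
    hboundary _ ξ₁ ((neg_sq _).trans (polarSqrt_sq h ξ₁))] at hconvex
  rw [radialGauge_sq hh.periodic]
  exact pow_lt_one₀ (radialGauge_nonneg _ _) (by linarith) two_ne_zero

end NearCircle

variable {f : ℝ → ℝ → ℝ} {ε : ℝ}

lemma boundaryCurve_eq_polarCurve (hf : ∀ ξ, 0 < 1 + ε * f ξ ε) :
    boundaryCurve f ε = polarCurve (logRadius f ε) := by
  ext ξ
  rw [boundaryCurve, polarCurve, Complex.exp_add, ← Complex.ofReal_exp, logRadius,
    Real.exp_log (hf ξ)]

lemma mem_domain_iff_radialGauge_lt_one (hf : ∀ ξ, 0 < 1 + ε * f ξ ε) {z : ℂ} :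
    z ∈ domain f ε ↔ radialGauge (logRadius f ε) z < 1 := by
  rw [radialGauge, radialExtension, logRadius, Real.exp_neg, Real.exp_log (hf _), ← div_eq_mul_inv,
    div_lt_one (hf _)]
  rfl

end PolarCurve

section WindingIndex

lemma logIntegral_eq_sub_of_eqOn_exp {α g : ℝ → ℂ} {a b : ℝ} (hab : a ≤ b)
    (hg : ∀ t ∈ Icc a b, ContDiffAt ℝ 1 g t)
    (hα : EqOn α (fun t => Complex.exp (g t)) (Icc a b)) :
    logIntegral α a b = g b - g a := by
  have hderiv : ∀ t ∈ Icc a b, HasDerivAt g (deriv g t) t := fun t ht =>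
    ((hg t ht).differentiableAt one_ne_zero).hasDerivAt
  have hcont : ContinuousOn (deriv g) (Icc a b) := fun t ht =>
    (((hg t ht).continuousAt_fderiv one_ne_zero).clm_apply
      continuousAt_const).continuousWithinAt
  calc logIntegral α a b = ∫ t in a..b, deriv g t := by
        refine intervalIntegral.integral_congr_Ioo_of_le hab fun t ht => ?_
        have hnear : α =ᶠ[𝓝 t] fun t => Complex.exp (g t) :=
          hα.eventuallyEq_of_mem (Icc_mem_nhds ht.1 ht.2)
        rw [hnear.deriv_eq, hnear.eq_of_nhds, (hderiv t (Ioo_subset_Icc_self ht)).cexp.deriv,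
          mul_div_cancel_left₀ _ (Complex.exp_ne_zero _)]
    _ = g b - g a := intervalIntegral.integral_eq_sub_of_hasDerivAt
        (fun t ht => hderiv t (by rwa [uIcc_of_le hab] at ht))
        (hcont.intervalIntegrable_of_Icc hab)

lemma logIntegral_arc (c : ℂ) (d : ℝ) :
    logIntegral (fun t : ℝ => Complex.exp c * Complex.exp ((t * d : ℝ) * Complex.I)) 0 1
      = d * Complex.I := by
  rw [logIntegral_eq_sub_of_eqOn_exp (g := fun t : ℝ => c + (t * d : ℝ) * Complex.I) zero_le_one
    (fun t _ => ?_) fun t _ => (Complex.exp_add _ _).symm]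
  · simp
  · have hcoe : ContDiffAt ℝ 1 (fun t : ℝ => ((t * d : ℝ) : ℂ)) t :=
      Complex.ofRealCLM.contDiff.contDiffAt.comp t (contDiffAt_id.mul contDiffAt_const)
    fun_prop

lemma logIntegral_segment (c : ℂ) (x : ℝ) :
    logIntegral (fun t : ℝ => ((1 - t : ℝ) : ℂ) * Complex.exp (c + x) + (t : ℂ) * Complex.exp c)
      0 1 = -x := by
  have hpos : ∀ t ∈ Icc (0 : ℝ) 1, 0 < (1 - t) * Real.exp x + t := fun t ht => by
    rcases ht.1.eq_or_lt with rfl | h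
    · simp [Real.exp_pos]
    · have := mul_nonneg (sub_nonneg.2 ht.2) (Real.exp_pos x).le
      linarith
  rw [logIntegral_eq_sub_of_eqOn_exp
    (g := fun t : ℝ => c + (Real.log ((1 - t) * Real.exp x + t) : ℝ)) zero_le_one]
  · simp
  · intro t ht
    have hlog : ContDiffAt ℝ 1 (fun t : ℝ => Real.log ((1 - t) * Real.exp x + t)) t :=
      ContDiffAt.log (by fun_prop) (hpos t ht).ne'
    exact contDiffAt_const.add (Complex.ofRealCLM.contDiff.contDiffAt.comp t hlog)
  · intro t ht
    simp only [Complex.exp_add, ← Complex.ofReal_exp, Real.exp_log (hpos t ht)]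
    push_cast
    ring

lemma windingIndex_of_exp {T : ℝ} {z : ℝ → ℂ} {u₀ u₁ : ℂ} (h0 : z 0 = Complex.exp u₀)
    (h1 : z T = Complex.exp u₁) (hu : |(u₀ - u₁).im| < Real.pi) :
    windingIndex T z = (2 * Real.pi * Complex.I)⁻¹ * (logIntegral z 0 T - (u₁ - u₀)) := by
  have harg : (z 0 / z T).arg = (u₀ - u₁).im := by
    rw [h0, h1, ← Complex.exp_sub, ← Complex.log_im,
      Complex.log_exp (abs_lt.1 hu).1 (abs_lt.1 hu).2.le]
  have hcorner : Complex.exp u₁ * Complex.exp ((u₀ - u₁).im * Complex.I)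
      = Complex.exp (u₀ + ((u₁ - u₀).re : ℝ)) := by
    rw [← Complex.exp_add]
    congr 1
    apply Complex.ext <;> simp
  simp only [windingIndex]
  rw [harg, h0, h1, logIntegral_arc, hcorner, logIntegral_segment]
  congr 1
  apply Complex.ext <;>
    simp only [Complex.sub_re, Complex.sub_im, Complex.add_re, Complex.add_im, Complex.neg_re,
      Complex.neg_im, Complex.mul_re, Complex.mul_im, Complex.ofReal_sub, Complex.ofReal_re,
      Complex.ofReal_im, Complex.I_re, Complex.I_im] <;>
    ring

lemma add_mul_exp_mem_slitPlane {a b : ℝ} (ha : 0 ≤ a) (hb : 0 ≤ b) (hab : 0 < a + b) {v : ℂ}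
    (hv : |v.im| < Real.pi) : (a + b * Complex.exp v : ℂ) ∈ Complex.slitPlane := by
  have hsin : Real.sin v.im = 0 ↔ v.im = 0 :=
    Real.sin_eq_zero_iff_of_lt_of_lt (abs_lt.1 hv).1 (abs_lt.1 hv).2
  rw [Complex.mem_slitPlane_iff, or_iff_not_imp_right]
  simp only [Complex.add_re, Complex.add_im, Complex.ofReal_re, Complex.ofReal_im,
    Complex.re_ofReal_mul, Complex.im_ofReal_mul, Complex.exp_re, Complex.exp_im, zero_add,
    not_not, mul_eq_zero, (Real.exp_pos _).ne', false_or, hsin]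
  rintro (rfl | him)
  · simpa using hab
  · rw [him, Real.cos_zero, mul_one]
    rcases hb.eq_or_lt with rfl | hb
    · simpa using hab
    · have := Real.exp_pos v.re
      positivity

lemma logIntegral_sq_of_weights {T : ℝ} (hT : 0 ≤ T) {z w : ℝ → ℂ} {v₀ v₁ : ℂ}
    (hz : EqOn z (fun s => w s ^ 2) (Icc 0 T)) (hw : ∀ s ∈ Icc 0 T, w s ≠ 0 → ContDiffAt ℝ 1 w s)
    (hmem : ∀ s ∈ Icc 0 T, ∃ a b : ℝ, 0 ≤ a ∧ 0 ≤ b ∧ 0 < a + b ∧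
      w s = a • Complex.exp v₀ + b • Complex.exp v₁)
    (h0 : w 0 = Complex.exp v₀) (h1 : w T = Complex.exp v₁) (hv : |(v₁ - v₀).im| < Real.pi) :
    logIntegral z 0 T = 2 * (v₁ - v₀) := by
  have hslit : ∀ s ∈ Icc 0 T, w s * Complex.exp (-v₀) ∈ Complex.slitPlane := fun s hs => by
    obtain ⟨a, b, ha, hb, hab, hs⟩ := hmem s hs
    convert add_mul_exp_mem_slitPlane ha hb hab hv using 1
    rw [hs, sub_eq_add_neg, add_mul, Complex.real_smul, Complex.real_smul, mul_assoc, mul_assoc,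
      ← Complex.exp_add, ← Complex.exp_add, add_neg_cancel, Complex.exp_zero, mul_one]
  have hne : ∀ s ∈ Icc 0 T, w s ≠ 0 := fun s hs =>
    left_ne_zero_of_mul (Complex.slitPlane_ne_zero (hslit s hs))
  rw [logIntegral_eq_sub_of_eqOn_exp
    (g := fun s => 2 * (v₀ + Complex.log (w s * Complex.exp (-v₀)))) hT]
  · simp only [h0, h1, ← Complex.exp_add, add_neg_cancel, Complex.exp_zero, Complex.log_one]
    rw [← sub_eq_add_neg, Complex.log_exp (abs_lt.1 hv).1 (abs_lt.1 hv).2.le]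
    ring
  · intro s hs
    have hlog := ((Complex.contDiffAt_log (n := 1) (hslit s hs)).restrict_scalars ℝ).comp s
      ((hw s hs (hne s hs)).mul contDiffAt_const)
    exact contDiffAt_const.mul (contDiffAt_const.add hlog)
  · intro s hs
    have hexp : Complex.exp (v₀ + Complex.log (w s * Complex.exp (-v₀))) = w s := by
      rw [Complex.exp_add, Complex.exp_log (Complex.slitPlane_ne_zero (hslit s hs)), mul_left_comm,
        ← Complex.exp_add, add_neg_cancel, Complex.exp_zero, mul_one]
    calc z s = w s * w s := (hz hs).trans (sq _)
      _ = _ := by simp only [two_mul, Complex.exp_add _ (_ + _), hexp]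

end WindingIndex

section JoinOrbit

/-- The duration, in the physical time, of the Kepler orbit `joinOrbit Ω k p r` from `p ^ 2`
to `r ^ 2`. -/
def joinTime (Ω k : ℝ) (p r : ℂ) : ℝ :=
  physicalTime Ω p (joinCoeff k p r) (joinDuration Ω k p r)

/-- The Kepler orbit from `p ^ 2` to `r ^ 2` whose Levi-Civita lift runs from `p` to `r`; the energy
is `Ω ^ 2 / 2` and the mass `Ω ^ 2 * k / 2`. -/
def joinOrbit (Ω k : ℝ) (p r : ℂ) : ℝ → ℂ := keplerOrbit Ω p (joinCoeff k p r)

variable {Ω k E h μ s T : ℝ} {p r v₀ v₁ : ℂ} {z : ℝ → ℂ}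

lemma joinTime_pos (hΩ : 0 < Ω) (hk : 0 < k) (hpr : p ≠ r) : 0 < joinTime Ω k p r := by
  rw [← physicalTime_zero Ω p (joinCoeff k p r)]
  exact strictMono_physicalTime hΩ.ne' (norm_lt_norm_joinCoeff hk hpr) (joinDuration_pos hΩ hk hpr)

lemma joinOrbit_zero (hΩ : Ω ≠ 0) (hk : 0 < k) (hpr : p ≠ r) : joinOrbit Ω k p r 0 = p ^ 2 :=
  keplerOrbit_zero hΩ (norm_lt_norm_joinCoeff hk hpr)

lemma joinOrbit_joinTime (hΩ : Ω ≠ 0) (hk : 0 < k) (hpr : p ≠ r) :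
    joinOrbit Ω k p r (joinTime Ω k p r) = r ^ 2 := by
  rw [joinOrbit, joinTime, keplerOrbit_physicalTime hΩ (norm_lt_norm_joinCoeff hk hpr),
    liftCurve_joinDuration hΩ hk hpr]

lemma clock_joinTime (hΩ : Ω ≠ 0) (hk : 0 < k) (hpr : p ≠ r) :
    clock Ω p (joinCoeff k p r) (joinTime Ω k p r) = joinDuration Ω k p r :=
  clock_physicalTime hΩ (norm_lt_norm_joinCoeff hk hpr) _

lemma clock_mem_Icc (hΩ : 0 < Ω) (hk : 0 < k) (hpr : p ≠ r) (hs : s ∈ Icc 0 (joinTime Ω k p r)) :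
    clock Ω p (joinCoeff k p r) s ∈ Icc 0 (joinDuration Ω k p r) := by
  have hlt := norm_lt_norm_joinCoeff hk hpr
  rw [← clock_zero hΩ.ne' hlt, ← clock_joinTime hΩ.ne' hk hpr]
  exact (strictMono_clock hΩ hlt).monotone.mapsTo_Icc hs

lemma clock_mem_Ioo (hΩ : 0 < Ω) (hk : 0 < k) (hpr : p ≠ r) (hs : s ∈ Ioo 0 (joinTime Ω k p r)) :
    clock Ω p (joinCoeff k p r) s ∈ Ioo 0 (joinDuration Ω k p r) := by
  have hlt := norm_lt_norm_joinCoeff hk hpr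
  rw [← clock_zero hΩ.ne' hlt, ← clock_joinTime hΩ.ne' hk hpr]
  exact (strictMono_clock hΩ hlt).mapsTo_Ioo hs

lemma exists_weights_joinOrbit (hΩ : 0 < Ω) (hk : 0 < k) (hpr : p ≠ r)
    (hs : s ∈ Ioo 0 (joinTime Ω k p r)) :
    ∃ a b : ℝ, 0 < a ∧ 0 < b ∧ a + b < 1 ∧ joinOrbit Ω k p r s = (a • p + b • r) ^ 2 := by
  obtain ⟨a, b, ha, hb, hab, hlift⟩ :=
    exists_weights_liftCurve_of_mem_Ioo hΩ hk hpr (clock_mem_Ioo hΩ hk hpr hs)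
  exact ⟨a, b, ha, hb, hab, by rw [joinOrbit, keplerOrbit, hlift]⟩

lemma hsAt_joinOrbit (hΩ : 0 < Ω) (hE : Ω ^ 2 / 2 = E + h) (hk : 0 < k) (hμ : Ω ^ 2 * k / 2 = μ)
    (hpr : p ≠ r) (hs : s ∈ Icc 0 (joinTime Ω k p r)) (hne : joinOrbit Ω k p r s ≠ 0) :
    HSAt (innerPotential E h μ) (joinTime Ω k p r) (joinOrbit Ω k p r) s :=
  hsAt_keplerOrbit hΩ hE (norm_lt_norm_joinCoeff hk hpr) (by rw [norm_sq_joinCoeff hk hpr, hμ]) hs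
    (joinTime_pos hΩ hk hpr) hne

lemma smul_exp_add_smul_exp_ne_zero {a b : ℝ} (ha : 0 ≤ a) (hb : 0 ≤ b) (hab : 0 < a + b)
    (hv : |(v₁ - v₀).im| < Real.pi) : a • Complex.exp v₀ + b • Complex.exp v₁ ≠ 0 := by
  have hfactor : a • Complex.exp v₀ + b • Complex.exp v₁
      = Complex.exp v₀ * (a + b * Complex.exp (v₁ - v₀)) := by
    rw [Complex.exp_sub, Complex.real_smul, Complex.real_smul]
    field_simp
  rw [hfactor]
  exact mul_ne_zero (Complex.exp_ne_zero _)
    (Complex.slitPlane_ne_zero (add_mul_exp_mem_slitPlane ha hb hab hv))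

lemma joinOrbit_exp_ne_zero (hΩ : 0 < Ω) (hk : 0 < k) (hpr : Complex.exp v₀ ≠ Complex.exp v₁)
    (hv : |(v₁ - v₀).im| < Real.pi)
    (hs : s ∈ Icc 0 (joinTime Ω k (Complex.exp v₀) (Complex.exp v₁))) :
    joinOrbit Ω k (Complex.exp v₀) (Complex.exp v₁) s ≠ 0 := by
  obtain ⟨a, b, ha, hb, hab, hlift⟩ :=
    exists_weights_liftCurve_of_mem_Icc hΩ hk hpr (clock_mem_Icc hΩ hk hpr hs)
  rw [joinOrbit, keplerOrbit_ne_zero_iff, hlift]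
  exact smul_exp_add_smul_exp_ne_zero ha hb hab hv

lemma logIntegral_joinOrbit_exp (hΩ : 0 < Ω) (hk : 0 < k)
    (hpr : Complex.exp v₀ ≠ Complex.exp v₁) (hv : |(v₁ - v₀).im| < Real.pi)
    (hz : EqOn z (joinOrbit Ω k (Complex.exp v₀) (Complex.exp v₁))
      (Icc 0 (joinTime Ω k (Complex.exp v₀) (Complex.exp v₁)))) :
    logIntegral z 0 (joinTime Ω k (Complex.exp v₀) (Complex.exp v₁)) = 2 * (v₁ - v₀) := by
  have hlt := norm_lt_norm_joinCoeff hk hpr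
  have hw (s : ℝ) (hs : liftCurve Ω (Complex.exp v₀) (joinCoeff k (Complex.exp v₀) (Complex.exp v₁))
      (clock Ω (Complex.exp v₀) (joinCoeff k (Complex.exp v₀) (Complex.exp v₁)) s) ≠ 0) :=
    (contDiffAt_liftCurve_clock one_ne_zero hΩ hlt hs).comp s
      (contDiffAt_id.prodMk contDiffAt_const)
  exact logIntegral_sq_of_weights (joinTime_pos hΩ hk hpr).le hz (fun s _ => hw s)
    (fun s hs => exists_weights_liftCurve_of_mem_Icc hΩ hk hpr (clock_mem_Icc hΩ hk hpr hs))
    (by rw [clock_zero hΩ.ne' hlt, liftCurve_zero])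
    (by rw [clock_joinTime hΩ.ne' hk hpr, liftCurve_joinDuration hΩ.ne' hk hpr]) hv

lemma isEjectionCollision_joinOrbit_neg (hΩ : 0 < Ω) (hE : Ω ^ 2 / 2 = E + h) (hk : 0 < k)
    (hμ : Ω ^ 2 * k / 2 = μ) (hp : p ≠ -p) :
    IsEjectionCollision E h μ (joinTime Ω k p (-p)) (joinOrbit Ω k p (-p)) := by
  have hlt := norm_lt_norm_joinCoeff hk hp
  have hL := joinDuration_pos hΩ hk hp
  have hmid : liftCurve Ω p (joinCoeff k p (-p)) (joinDuration Ω k p (-p) / 2) = 0 := by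
    rw [liftCurve_joinCoeff_eq_add hΩ.ne' hk hp, sub_half, smul_neg, add_neg_cancel]
  refine ⟨(continuous_keplerOrbit hΩ hlt).continuousOn,
    physicalTime Ω p (joinCoeff k p (-p)) (joinDuration Ω k p (-p) / 2), ⟨?_, ?_⟩, ?_,
    fun s hs hne => ?_⟩
  · rw [← physicalTime_zero Ω p (joinCoeff k p (-p))]
    exact strictMono_physicalTime hΩ.ne' hlt (half_pos hL)
  · exact strictMono_physicalTime hΩ.ne' hlt (half_lt_self hL)
  · rw [joinOrbit, keplerOrbit_physicalTime hΩ.ne' hlt, hmid, zero_pow two_ne_zero]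
  · have hs0 : joinOrbit Ω k p (-p) s ≠ 0 := by
      rw [joinOrbit, keplerOrbit_ne_zero_iff]
      intro hzero
      exact hne (by rw [← liftCurve_zero_unique hΩ.ne' hlt hzero hmid, physicalTime_clock hΩ hlt])
    exact ⟨hs0, hsAt_joinOrbit hΩ hE hk hμ hp hs hs0⟩

lemma eqOn_joinOrbit_of_isInnerClassical (hΩ : 0 < Ω) (hE : Ω ^ 2 / 2 = E + h) (hk : 0 < k)
    (hμ : Ω ^ 2 * k / 2 = μ) (hT : 0 < T) (hz : IsInnerClassical E h μ T z) (h0 : p ^ 2 = z 0)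
    (h1 : r ^ 2 = z T) :
    ∃ r', (r' = r ∨ r' = -r) ∧ p ≠ r' ∧ T = joinTime Ω k p r' ∧
      EqOn z (joinOrbit Ω k p r') (Icc 0 T) := by
  obtain ⟨hB, heq⟩ := exists_eqOn_keplerOrbit hΩ hE hk hμ hT.le
    (fun s hs => ⟨(hz s hs).1, (hz s hs).2.isSolutionAt⟩) h0
  generalize derivWithin z (Icc 0 T) 0 * conj p / Ω = B at hB heq
  have hlt : ‖p‖ < ‖B‖ := lt_of_pow_lt_pow_left₀ 2 (norm_nonneg _) (by linarith)
  have hpos : 0 < clock Ω p B T := by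
    rw [← clock_zero hΩ.ne' hlt]
    exact strictMono_clock hΩ hlt hT
  obtain ⟨hduration, hcoeff⟩ := eq_join_of_liftCurve_eq hΩ hk hB hpos rfl
  refine ⟨liftCurve Ω p B (clock Ω p B T), ?_, ne_of_liftCurve_eq hΩ hk hB hpos rfl, ?_, ?_⟩
  · rw [← sq_eq_sq_iff_eq_or_eq_neg, h1, heq (right_mem_Icc.2 hT.le), keplerOrbit]
  · rw [joinTime, ← hduration, ← hcoeff, physicalTime_clock hΩ hlt]
  · rwa [joinOrbit, ← hcoeff]

end JoinOrbit

section Family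

variable {Ω k s δ : ℝ} {p r : ℂ} {P R : ℝ → ℂ} {n : WithTop ℕ∞}

lemma contDiffAt_prodMk_joinCoeff (hk : 0 < k) (hpr : p ≠ r) (t : ℝ) :
    ContDiffAt ℝ n (fun x : ℝ × ℂ × ℂ => (x.1, x.2.1, joinCoeff k x.2.1 x.2.2)) (t, p, r) :=
  contDiffAt_fst.prodMk (contDiffAt_snd.fst.prodMk
    (ContDiffAt.comp (g := fun x : ℂ × ℂ => joinCoeff k x.1 x.2) (t, p, r)
      (contDiffAt_joinCoeff hk hpr) contDiffAt_snd))

lemma contDiffAt_physicalTime_joinCoeff (Ω : ℝ) (hk : 0 < k) (hpr : p ≠ r) (t : ℝ) :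
    ContDiffAt ℝ n (fun x : ℝ × ℂ × ℂ => physicalTime Ω x.2.1 (joinCoeff k x.2.1 x.2.2) x.1)
      (t, p, r) :=
  ContDiffAt.comp (g := fun x : ℝ × ℂ × ℂ => physicalTime Ω x.2.1 x.2.2 x.1)
    (f := fun x : ℝ × ℂ × ℂ => (x.1, x.2.1, joinCoeff k x.2.1 x.2.2)) (t, p, r)
    (contDiff_physicalTime Ω).contDiffAt (contDiffAt_prodMk_joinCoeff hk hpr t)

lemma contDiffAt_joinTime (Ω : ℝ) (hk : 0 < k) (hpr : p ≠ r) :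
    ContDiffAt ℝ n (fun x : ℂ × ℂ => joinTime Ω k x.1 x.2) (p, r) :=
  ContDiffAt.comp
    (g := fun x : ℝ × ℂ × ℂ => physicalTime Ω x.2.1 (joinCoeff k x.2.1 x.2.2) x.1)
    (f := fun x : ℂ × ℂ => (joinDuration Ω k x.1 x.2, x)) (p, r)
    (contDiffAt_physicalTime_joinCoeff Ω hk hpr _)
    ((contDiffAt_joinDuration Ω hk hpr).prodMk contDiffAt_id)

lemma contDiffAt_joinOrbit (hn : n ≠ 0) (hΩ : 0 < Ω) (hk : 0 < k) (hpr : p ≠ r)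
    (hs : joinOrbit Ω k p r s ≠ 0) :
    ContDiffAt ℝ n (fun x : ℝ × ℂ × ℂ => joinOrbit Ω k x.2.1 x.2.2 x.1) (s, p, r) :=
  ContDiffAt.comp (g := fun x : ℝ × ℂ × ℂ => keplerOrbit Ω x.2.1 x.2.2 x.1)
    (f := fun x : ℝ × ℂ × ℂ => (x.1, x.2.1, joinCoeff k x.2.1 x.2.2)) (s, p, r)
    (contDiffAt_keplerOrbit hn hΩ (norm_lt_norm_joinCoeff hk hpr) hs)
    (contDiffAt_prodMk_joinCoeff hk hpr s)

lemma joinOrbit_physicalTime (hΩ : Ω ≠ 0) (hk : 0 < k) (hpr : p ≠ r) (t : ℝ) :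
    joinOrbit Ω k p r (physicalTime Ω p (joinCoeff k p r) t) =
      liftCurve Ω p (joinCoeff k p r) t ^ 2 :=
  keplerOrbit_physicalTime hΩ (norm_lt_norm_joinCoeff hk hpr) t

lemma contDiffAt_liftCurve_joinCoeff (Ω : ℝ) (hk : 0 < k) (hpr : p ≠ r) (t : ℝ) :
    ContDiffAt ℝ n (fun x : ℝ × ℂ × ℂ => liftCurve Ω x.2.1 (joinCoeff k x.2.1 x.2.2) x.1)
      (t, p, r) :=
  ContDiffAt.comp (g := fun x : ℝ × ℂ × ℂ => liftCurve Ω x.2.1 x.2.2 x.1)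
    (f := fun x : ℝ × ℂ × ℂ => (x.1, x.2.1, joinCoeff k x.2.1 x.2.2)) (t, p, r)
    (contDiff_liftCurve Ω).contDiffAt (contDiffAt_prodMk_joinCoeff hk hpr t)

lemma isC1InEndpoints_joinOrbit (hΩ : 0 < Ω) (hk : 0 < k) (hP : ContDiff ℝ 1 P)
    (hR : ContDiff ℝ 1 R) (hPR : ∀ ξ₀ ξ₁, |ξ₀ - ξ₁| < δ → P ξ₀ ≠ R ξ₁) :
    IsC1InEndpoints δ (fun ξ₀ ξ₁ => joinTime Ω k (P ξ₀) (R ξ₁))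
      (fun ξ₀ ξ₁ => joinOrbit Ω k (P ξ₀) (R ξ₁)) := by
  have hends : ContDiff ℝ 1 (Prod.map P R) := hP.prodMap hR
  have htimed : ContDiff ℝ 1 (Prod.map (id : ℝ → ℝ) (Prod.map P R)) := contDiff_id.prodMap hends
  refine ⟨fun x hx => ?_, fun x hx => ?_, fun ξ₀ ξ₁ => joinDuration Ω k (P ξ₀) (R ξ₁),
    fun ξ₀ ξ₁ => physicalTime Ω (P ξ₀) (joinCoeff k (P ξ₀) (R ξ₁)), fun ξ₀ ξ₁ hξ => ?_,
    fun x hx => ?_, fun x hx => ?_, ?_⟩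
  · exact (ContDiffAt.comp (f := Prod.map P R) x (contDiffAt_joinTime Ω hk (hPR _ _ hx))
      hends.contDiffAt).contDiffWithinAt
  · exact (ContDiffAt.comp (f := Prod.map id (Prod.map P R)) x
      (contDiffAt_joinOrbit one_ne_zero hΩ hk (hPR _ _ hx.1) hx.2.2)
      htimed.contDiffAt).contDiffWithinAt
  · have hpr := hPR ξ₀ ξ₁ hξ
    refine ⟨joinDuration_pos hΩ hk hpr, physicalTime_zero .., rfl,
      (strictMono_physicalTime hΩ.ne' (norm_lt_norm_joinCoeff hk hpr)).strictMonoOn _,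
      fun τ _ => ?_⟩
    simp only [joinOrbit_physicalTime hΩ.ne' hk hpr, norm_pow]
    exact (hasDerivAt_physicalTime hΩ.ne' ..).hasDerivWithinAt
  · exact (ContDiffAt.comp (f := Prod.map P R) x (contDiffAt_joinDuration Ω hk (hPR _ _ hx))
      hends.contDiffAt).contDiffWithinAt
  · exact (ContDiffAt.comp (f := Prod.map id (Prod.map P R)) x
      (contDiffAt_physicalTime_joinCoeff Ω hk (hPR _ _ hx.1) _)
      htimed.contDiffAt).contDiffWithinAt
  · exact ContDiffOn.congr (fun x hx => (ContDiffAt.comp (f := Prod.map id (Prod.map P R)) x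
      ((contDiffAt_liftCurve_joinCoeff Ω hk (hPR _ _ hx.1) _).pow 2)
      htimed.contDiffAt).contDiffWithinAt)
      fun x hx => joinOrbit_physicalTime hΩ.ne' hk (hPR _ _ hx.1) _

end Family

section Angles

lemma angle_mem_Ioo_of_abs_inner_lt {V : Type*} [NormedAddCommGroup V] [InnerProductSpace ℝ V]
    {x y : V} {C : ℝ} (hC : C ∈ Icc 0 Real.pi) (h : |inner ℝ x y| < Real.cos C * (‖x‖ * ‖y‖)) :
    InnerProductGeometry.angle x y ∈ Ioo C (Real.pi - C) := by
  have hangle : InnerProductGeometry.angle x y ∈ Icc 0 Real.pi :=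
    ⟨InnerProductGeometry.angle_nonneg x y, InnerProductGeometry.angle_le_pi x y⟩
  have hC' : Real.pi - C ∈ Icc 0 Real.pi := ⟨sub_nonneg.2 hC.2, sub_le_self _ hC.1⟩
  rw [← InnerProductGeometry.cos_angle_mul_norm_mul_norm, abs_mul,
    abs_of_nonneg (mul_nonneg (norm_nonneg x) (norm_nonneg y))] at h
  have hcos := abs_lt.1 (lt_of_mul_lt_mul_right h (mul_nonneg (norm_nonneg x) (norm_nonneg y)))
  refine ⟨(Real.strictAntiOn_cos.lt_iff_gt hangle hC).1 hcos.2,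
    (Real.strictAntiOn_cos.lt_iff_gt hC' hangle).1 ?_⟩
  rw [Real.cos_pi_sub]
  exact hcos.1

lemma angle_add_I_smul_mem_Ioo {η c : ℝ} {w : ℂ} (hη : |η| ≤ 1 / 10) (hc : c ≠ 0) (hw : 0 < w.re)
    (him : |w.im| ≤ w.re / 3) :
    InnerProductGeometry.angle (η + Complex.I) (c • w) ∈
      Ioo (Real.pi / 3) (Real.pi - Real.pi / 3) := by
  refine angle_mem_Ioo_of_abs_inner_lt ⟨by positivity, by linarith [Real.pi_pos]⟩ ?_
  have hnorm : w.re ≤ ‖(η + Complex.I : ℂ)‖ * ‖w‖ := by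
    have hI : (1 : ℝ) ≤ ‖(η + Complex.I : ℂ)‖ := by
      simpa using Complex.abs_im_le_norm (η + Complex.I : ℂ)
    nlinarith [Complex.re_le_norm w]
  have hinner : |η * w.re + w.im| < 1 / 2 * w.re :=
    calc |η * w.re + w.im| ≤ |η * w.re| + |w.im| := abs_add_le _ _
      _ ≤ 1 / 10 * w.re + w.re / 3 := by
        rw [abs_mul, abs_of_pos hw]
        gcongr
      _ < 1 / 2 * w.re := by linarith
  rw [real_inner_smul_right, norm_smul, Real.cos_pi_div_three, Complex.inner, Real.norm_eq_abs,
    abs_mul]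
  have hre : (conj (η + Complex.I : ℂ) * w).re = η * w.re + w.im := by simp
  calc |c| * |(w * conj (η + Complex.I : ℂ)).re| < |c| * (1 / 2 * w.re) := by
        rw [mul_comm w, hre]
        exact mul_lt_mul_of_pos_left hinner (abs_pos.2 hc)
    _ ≤ |c| * (1 / 2 * (‖(η + Complex.I : ℂ)‖ * ‖w‖)) := by gcongr
    _ = 1 / 2 * (‖(η + Complex.I : ℂ)‖ * (|c| * ‖w‖)) := by ring

variable {Ω k : ℝ} {p r : ℂ}

lemma joinCoeff_div_conj (hp : p ≠ 0) : joinCoeff k p r / conj p =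
    (-((joinSinh k p r)⁻¹ / ‖p‖ ^ 2)) • (joinCosh k p r + -r / p) * p ^ 2 := by
  have hconj : conj p ≠ 0 := (map_ne_zero _).2 hp
  rw [joinCoeff, ← Complex.normSq_eq_norm_sq]
  simp only [Complex.real_smul, Complex.ofReal_neg, Complex.ofReal_div, Complex.ofReal_inv,
    ← Complex.mul_conj]
  field_simp
  ring

/-- A `1 / 3` bound on the slope of `-r / p` means that `p` and `r` are almost opposite, so that the
orbit leaves `p ^ 2` almost radially. -/
lemma angle_smul_joinCoeff_div_conj_mem_Ioo {η c : ℝ} (hη : |η| ≤ 1 / 10) (hc : c ≠ 0)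
    (hk : 0 < k) (hre : 0 < (-r / p).re) (him : |(-r / p).im| ≤ (-r / p).re / 3) :
    InnerProductGeometry.angle ((η + Complex.I) * p ^ 2) (c • (joinCoeff k p r / conj p)) ∈
      Ioo (Real.pi / 3) (Real.pi - Real.pi / 3) := by
  have hp : p ≠ 0 := by
    rintro rfl
    simp at hre
  have hpr : p ≠ r := by
    rintro rfl
    rw [neg_div, div_self hp, Complex.neg_re, Complex.one_re] at hre
    linarith
  have hcosh := one_lt_joinCosh hk hpr
  have hscale : -((joinSinh k p r)⁻¹ / ‖p‖ ^ 2) ≠ 0 := neg_ne_zero.2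
    (div_pos (inv_pos.2 (joinSinh_pos hk hpr)) (by positivity)).ne'
  rw [joinCoeff_div_conj hp, ← smul_mul_assoc, smul_smul,
    Complex.angle_mul_right (pow_ne_zero 2 hp)]
  refine angle_add_I_smul_mem_Ioo hη (mul_ne_zero hc hscale) ?_ ?_
  · rw [Complex.add_re, Complex.ofReal_re]
    linarith
  · rw [Complex.add_im, Complex.ofReal_im, zero_add, Complex.add_re, Complex.ofReal_re]
    linarith

lemma derivWithin_joinOrbit_zero (hΩ : 0 < Ω) (hk : 0 < k) (hpr : p ≠ r) (hp : p ≠ 0) :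
    derivWithin (joinOrbit Ω k p r) (Icc 0 (joinTime Ω k p r)) 0 =
      Ω • (joinCoeff k p r / conj p) := by
  have hT := joinTime_pos hΩ hk hpr
  have hlt := norm_lt_norm_joinCoeff hk hpr
  rw [← smul_div_assoc, ← keplerVelocity_zero hΩ.ne' hlt]
  refine (hasDerivAt_keplerOrbit hΩ hlt ?_).hasDerivWithinAt.derivWithin
    (uniqueDiffOn_Icc hT 0 (left_mem_Icc.2 hT.le))
  rw [keplerOrbit_zero hΩ.ne' hlt]
  exact pow_ne_zero 2 hp

lemma derivWithin_joinOrbit_joinTime (hΩ : 0 < Ω) (hk : 0 < k) (hpr : p ≠ r) (hr : r ≠ 0) :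
    derivWithin (joinOrbit Ω k p r) (Icc 0 (joinTime Ω k p r)) (joinTime Ω k p r) =
      (-Ω) • (joinCoeff k r p / conj r) := by
  have hT := joinTime_pos hΩ hk hpr
  have hlt := norm_lt_norm_joinCoeff hk hpr
  have hvelocity : keplerVelocity Ω p (joinCoeff k p r) (joinTime Ω k p r) =
      (-Ω) • (joinCoeff k r p / conj r) := by
    rw [keplerVelocity, clock_joinTime hΩ.ne' hk hpr, liftCurve_joinDuration hΩ.ne' hk hpr,
      liftCurve_swap_joinDuration hΩ.ne' hk hpr, smul_neg, neg_smul, neg_div, smul_div_assoc]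
  rw [← hvelocity]
  refine (hasDerivAt_keplerOrbit hΩ hlt ?_).hasDerivWithinAt.derivWithin
    (uniqueDiffOn_Icc hT _ (right_mem_Icc.2 hT.le))
  exact (joinOrbit_joinTime hΩ.ne' hk hpr).trans_ne (pow_ne_zero 2 hr)

end Angles

section PolarSqrt

variable {g : ℝ → ℝ} {ξ₀ ξ₁ : ℝ}

lemma polarSqrt_ne_zero (g : ℝ → ℝ) (ξ : ℝ) : polarSqrt g ξ ≠ 0 := Complex.exp_ne_zero _

lemma polarSqrt_div_polarSqrt (g : ℝ → ℝ) (ξ₀ ξ₁ : ℝ) : polarSqrt g ξ₀ / polarSqrt g ξ₁ =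
    Complex.exp (((g ξ₀ - g ξ₁) / 2 : ℝ) + ((ξ₀ - ξ₁) / 2 : ℝ) * Complex.I) := by
  rw [polarSqrt, polarSqrt, ← Complex.exp_sub]
  congr 1
  push_cast
  ring

lemma re_polarSqrt_div_polarSqrt_pos (g : ℝ → ℝ) (hξ : |ξ₀ - ξ₁| < Real.pi) :
    0 < (polarSqrt g ξ₀ / polarSqrt g ξ₁).re := by
  rw [polarSqrt_div_polarSqrt, Complex.exp_re]
  refine mul_pos (Real.exp_pos _) (Real.cos_pos_of_mem_Ioo ?_)
  rw [abs_lt] at hξ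
  simp only [Complex.add_im, Complex.ofReal_im, Complex.im_ofReal_mul, Complex.I_im]
  constructor <;> linarith

lemma abs_im_polarSqrt_div_polarSqrt_le (g : ℝ → ℝ) (hξ : |ξ₀ - ξ₁| < 1 / 2) :
    |(polarSqrt g ξ₀ / polarSqrt g ξ₁).im| ≤ (polarSqrt g ξ₀ / polarSqrt g ξ₁).re / 3 := by
  set x := (ξ₀ - ξ₁) / 2
  have hx : |x| ≤ 1 / 4 := by
    rw [abs_div, abs_two]
    linarith
  have hslope : |Real.sin x| ≤ Real.cos x / 3 := by
    have hsq := sq_le_sq' (neg_le_of_abs_le hx) (le_of_abs_le hx)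
    linarith [Real.abs_sin_le_abs (x := x), Real.one_sub_sq_div_two_le_cos (x := x)]
  have him : ((((g ξ₀ - g ξ₁) / 2 : ℝ) : ℂ) + (x : ℂ) * Complex.I).im = x := by simp
  rw [polarSqrt_div_polarSqrt, Complex.exp_re, Complex.exp_im, him, abs_mul, Real.abs_exp,
    mul_div_assoc]
  gcongr

lemma polarSqrt_ne_neg_polarSqrt (g : ℝ → ℝ) (hξ : |ξ₀ - ξ₁| < Real.pi) :
    polarSqrt g ξ₀ ≠ -polarSqrt g ξ₁ := by
  intro h
  have hre := re_polarSqrt_div_polarSqrt_pos g hξ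
  rw [h, neg_div, div_self (polarSqrt_ne_zero g ξ₁), Complex.neg_re, Complex.one_re] at hre
  linarith

/-- The integer `n` is the winding index of an orbit that lifts to a curve from `polarSqrt g ξ₀` to
`-polarSqrt g ξ₁`. -/
lemma exists_exp_eq_neg_polarSqrt (g : ℝ → ℝ) (hne : ξ₀ ≠ ξ₁) (hξ : |ξ₀ - ξ₁| < Real.pi) :
    ∃ (v₁ : ℂ) (n : ℤ), |n| = 1 ∧ -polarSqrt g ξ₁ = Complex.exp v₁ ∧
      |(v₁ - (g ξ₀ + ξ₀ * Complex.I) / 2).im| < Real.pi ∧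
      |2 * (v₁ - (g ξ₀ + ξ₀ * Complex.I) / 2).im - n * (2 * Real.pi)| < Real.pi := by
  have him (σ : ℝ) : ((g ξ₁ + ξ₁ * Complex.I) / 2 + (σ * Real.pi : ℝ) * Complex.I
      - (g ξ₀ + ξ₀ * Complex.I) / 2).im = (ξ₁ - ξ₀) / 2 + σ * Real.pi := by
    simp only [Complex.sub_im, Complex.add_im, Complex.div_ofNat_im, Complex.mul_im,
      Complex.ofReal_re, Complex.ofReal_im, Complex.I_re, Complex.I_im]
    ring
  have hpi := abs_lt.1 hξ
  rcases hne.lt_or_gt with hlt | hlt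
  · refine ⟨(g ξ₁ + ξ₁ * Complex.I) / 2 + ((-1 : ℝ) * Real.pi : ℝ) * Complex.I, -1, rfl, ?_, ?_, ?_⟩
    · rw [Complex.exp_add]
      simp [polarSqrt, Complex.exp_neg]
    all_goals
      rw [him, abs_lt]
      push_cast
      constructor <;> linarith
  · refine ⟨(g ξ₁ + ξ₁ * Complex.I) / 2 + ((1 : ℝ) * Real.pi : ℝ) * Complex.I, 1, rfl, ?_, ?_, ?_⟩
    · rw [Complex.exp_add]
      simp [polarSqrt]
    all_goals
      rw [him, abs_lt]
      push_cast
      constructor <;> linarith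

lemma windingIndex_joinOrbit_exp {Ω k T : ℝ} {v₀ v₁ : ℂ} {z : ℝ → ℂ} (hΩ : 0 < Ω) (hk : 0 < k)
    (hpr : Complex.exp v₀ ≠ Complex.exp v₁) (hv : |(v₁ - v₀).im| < Real.pi) (n : ℤ)
    (hn : |2 * (v₁ - v₀).im - n * (2 * Real.pi)| < Real.pi)
    (hT : T = joinTime Ω k (Complex.exp v₀) (Complex.exp v₁))
    (hz : EqOn z (joinOrbit Ω k (Complex.exp v₀) (Complex.exp v₁)) (Icc 0 T)) :
    windingIndex T z = n := by
  subst hT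
  have hpos := joinTime_pos hΩ hk hpr
  rw [windingIndex_of_exp (u₀ := 2 * v₀) (u₁ := 2 * v₁ - n * (2 * Real.pi * Complex.I)),
    logIntegral_joinOrbit_exp hΩ hk hpr hv hz]
  · field_simp
    ring
  · rw [hz (left_mem_Icc.2 hpos.le), joinOrbit_zero hΩ.ne' hk hpr, ← Complex.exp_nat_mul,
      Nat.cast_two]
  · rw [hz (right_mem_Icc.2 hpos.le), joinOrbit_joinTime hΩ.ne' hk hpr, ← Complex.exp_nat_mul,
      Complex.exp_sub, Complex.exp_int_mul_two_pi_mul_I, div_one, Nat.cast_two]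
  · rw [← abs_neg]
    convert hn using 2
    simp only [Complex.sub_im, Complex.mul_im, Complex.mul_re, Complex.re_ofNat,
      Complex.im_ofNat, Complex.intCast_re, Complex.intCast_im, Complex.ofReal_re,
      Complex.ofReal_im, Complex.I_re, Complex.I_im]
    ring

end PolarSqrt

section InnerArcs

variable {E h μ Ω k κ ε ξ₀ ξ₁ T : ℝ} {g : ℝ → ℝ} {f : ℝ → ℝ → ℝ} {z : ℝ → ℂ}

lemma isInnerClassical_joinOrbit_polarSqrt (hΩ : 0 < Ω) (hE : Ω ^ 2 / 2 = E + h) (hk : 0 < k)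
    (hμ : Ω ^ 2 * k / 2 = μ) (hne : ξ₀ ≠ ξ₁) (hξ : |ξ₀ - ξ₁| < Real.pi) :
    IsInnerClassical E h μ (joinTime Ω k (polarSqrt g ξ₀) (-polarSqrt g ξ₁))
        (joinOrbit Ω k (polarSqrt g ξ₀) (-polarSqrt g ξ₁)) ∧
      ‖windingIndex (joinTime Ω k (polarSqrt g ξ₀) (-polarSqrt g ξ₁))
        (joinOrbit Ω k (polarSqrt g ξ₀) (-polarSqrt g ξ₁))‖ = 1 := by
  obtain ⟨v₁, n, hn, hexp, hv, hindex⟩ := exists_exp_eq_neg_polarSqrt g hne hξ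
  have hpr := polarSqrt_ne_neg_polarSqrt g hξ
  rw [hexp] at hpr ⊢
  refine ⟨fun s hs => ?_, ?_⟩
  · have hs0 := joinOrbit_exp_ne_zero hΩ hk hpr hv hs
    exact ⟨hs0, hsAt_joinOrbit hΩ hE hk hμ hpr hs hs0⟩
  · rw [polarSqrt, windingIndex_joinOrbit_exp hΩ hk hpr hv n hindex rfl fun _ _ => rfl,
      Complex.norm_intCast]
    exact_mod_cast hn

lemma isInnerArc_joinOrbit (hΩ : 0 < Ω) (hE : Ω ^ 2 / 2 = E + h) (hk : 0 < k)
    (hμ : Ω ^ 2 * k / 2 = μ) (hf : ∀ ξ, 0 < 1 + ε * f ξ ε) (hg : NearCircle κ (logRadius f ε))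
    (hκ : κ ≤ 1 / 2) (hξ : |ξ₀ - ξ₁| < Real.pi) :
    IsInnerArc E h μ f ε ξ₀ ξ₁
      (joinTime Ω k (polarSqrt (logRadius f ε) ξ₀) (-polarSqrt (logRadius f ε) ξ₁))
      (joinOrbit Ω k (polarSqrt (logRadius f ε) ξ₀) (-polarSqrt (logRadius f ε) ξ₁)) := by
  have hpr := polarSqrt_ne_neg_polarSqrt (logRadius f ε) hξ
  refine ⟨joinTime_pos hΩ hk hpr, ?_, ?_, fun s hs => ?_,
    fun hne => isInnerClassical_joinOrbit_polarSqrt hΩ hE hk hμ hne hξ, ?_⟩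
  · rw [joinOrbit_zero hΩ.ne' hk hpr, boundaryCurve_eq_polarCurve hf, polarSqrt_sq]
  · rw [joinOrbit_joinTime hΩ.ne' hk hpr, boundaryCurve_eq_polarCurve hf, neg_sq, polarSqrt_sq]
  · obtain ⟨a, b, ha, hb, hab, heq⟩ := exists_weights_joinOrbit hΩ hk hpr hs
    rw [mem_domain_iff_radialGauge_lt_one hf, heq]
    exact hg.radialGauge_smul_sub_smul_polarSqrt_lt_one hκ ha.le hb.le hab ξ₀ ξ₁
  · rintro rfl
    exact isEjectionCollision_joinOrbit_neg hΩ hE hk hμ hpr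

lemma eqOn_joinOrbit_of_isEjectionCollision {p : ℂ} (hΩ : 0 < Ω) (hE : Ω ^ 2 / 2 = E + h)
    (hk : 0 < k) (hμ : Ω ^ 2 * k / 2 = μ) (hp : p ≠ -p) (h0 : p ^ 2 = z 0) (hT : p ^ 2 = z T)
    (hz : IsEjectionCollision E h μ T z) :
    T = joinTime Ω k p (-p) ∧ EqOn z (joinOrbit Ω k p (-p)) (Icc 0 T) := by
  obtain ⟨hTz, hzeq⟩ := eqOn_keplerOrbit_of_isEjectionCollision hΩ hE hk hμ h0 hT hz
  obtain ⟨hTj, hjeq⟩ := eqOn_keplerOrbit_of_isEjectionCollision hΩ hE hk hμ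
    (joinOrbit_zero hΩ.ne' hk hp).symm
    ((neg_sq p).symm.trans (joinOrbit_joinTime hΩ.ne' hk hp).symm)
    (isEjectionCollision_joinOrbit_neg hΩ hE hk hμ hp)
  have hTT := hTz.trans hTj.symm
  subst hTT
  exact ⟨rfl, hzeq.trans hjeq.symm⟩

lemma eqOn_joinOrbit_of_windingIndex_ne_zero (hΩ : 0 < Ω) (hE : Ω ^ 2 / 2 = E + h) (hk : 0 < k)
    (hμ : Ω ^ 2 * k / 2 = μ) (hξ : |ξ₀ - ξ₁| < Real.pi) (hT : 0 < T)
    (hz : IsInnerClassical E h μ T z) (h0 : z 0 = polarCurve g ξ₀) (h1 : z T = polarCurve g ξ₁)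
    (hindex : windingIndex T z ≠ 0) :
    T = joinTime Ω k (polarSqrt g ξ₀) (-polarSqrt g ξ₁) ∧
      EqOn z (joinOrbit Ω k (polarSqrt g ξ₀) (-polarSqrt g ξ₁)) (Icc 0 T) := by
  obtain ⟨r, hr | hr, hpr, hduration, heq⟩ := eqOn_joinOrbit_of_isInnerClassical hΩ hE hk hμ hT hz
    ((polarSqrt_sq g ξ₀).trans h0.symm) ((polarSqrt_sq g ξ₁).trans h1.symm)
  · subst hr
    have him : ((g ξ₁ + ξ₁ * Complex.I) / 2 - (g ξ₀ + ξ₀ * Complex.I) / 2).im = (ξ₁ - ξ₀) / 2 := by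
      simp only [Complex.sub_im, Complex.add_im, Complex.div_ofNat_im, Complex.mul_im,
        Complex.ofReal_re, Complex.ofReal_im, Complex.I_re, Complex.I_im]
      ring
    rw [abs_sub_comm] at hξ
    refine absurd (windingIndex_joinOrbit_exp hΩ hk hpr ?_ 0 ?_ hduration heq) ?_
    · rw [him, abs_div, abs_two]
      linarith [abs_nonneg (ξ₁ - ξ₀)]
    · rwa [him, Int.cast_zero, zero_mul, sub_zero, mul_div_cancel₀ _ two_ne_zero]
    · rwa [Int.cast_zero]
  · subst hr
    exact ⟨hduration, heq⟩

lemma eqOn_joinOrbit_of_isInnerArc (hΩ : 0 < Ω) (hE : Ω ^ 2 / 2 = E + h) (hk : 0 < k)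
    (hμ : Ω ^ 2 * k / 2 = μ) (hf : ∀ ξ, 0 < 1 + ε * f ξ ε) (hξ : |ξ₀ - ξ₁| < Real.pi)
    (hz : IsInnerArc E h μ f ε ξ₀ ξ₁ T z) :
    T = joinTime Ω k (polarSqrt (logRadius f ε) ξ₀) (-polarSqrt (logRadius f ε) ξ₁) ∧
      EqOn z (joinOrbit Ω k (polarSqrt (logRadius f ε) ξ₀) (-polarSqrt (logRadius f ε) ξ₁))
        (Icc 0 T) := by
  have hstart := hz.start
  have hfinish := hz.finish
  rw [boundaryCurve_eq_polarCurve hf] at hstart hfinish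
  by_cases hne : ξ₀ = ξ₁
  · subst hne
    exact eqOn_joinOrbit_of_isEjectionCollision hΩ hE hk hμ (polarSqrt_ne_neg_polarSqrt _ hξ)
      ((polarSqrt_sq _ _).trans hstart.symm) ((polarSqrt_sq _ _).trans hfinish.symm)
      (hz.ejectionCollision rfl)
  · obtain ⟨hclassical, hindex⟩ := hz.classical hne
    exact eqOn_joinOrbit_of_windingIndex_ne_zero hΩ hE hk hμ hξ hz.pos hclassical hstart hfinish
      (norm_ne_zero_iff.1 (hindex.trans_ne one_ne_zero))

lemma angle_derivWithin_joinOrbit_zero_mem_Ioo (hΩ : 0 < Ω) (hk : 0 < k)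
    (hg : NearCircle (1 / 10) g) (hξ : |ξ₀ - ξ₁| < 1 / 2) :
    InnerProductGeometry.angle (deriv (polarCurve g) ξ₀)
      (derivWithin (joinOrbit Ω k (polarSqrt g ξ₀) (-polarSqrt g ξ₁))
        (Icc 0 (joinTime Ω k (polarSqrt g ξ₀) (-polarSqrt g ξ₁))) 0) ∈
      Ioo (Real.pi / 3) (Real.pi - Real.pi / 3) := by
  have hpi : |ξ₀ - ξ₁| < Real.pi := hξ.trans (by linarith [Real.pi_gt_three])
  rw [abs_sub_comm] at hξ
  rw [(hasDerivAt_polarCurve (hg.contDiff.differentiable two_ne_zero) ξ₀).deriv,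
    derivWithin_joinOrbit_zero hΩ hk (polarSqrt_ne_neg_polarSqrt g hpi) (polarSqrt_ne_zero g ξ₀),
    ← polarSqrt_sq]
  refine angle_smul_joinCoeff_div_conj_mem_Ioo (hg.abs_deriv_le ξ₀) hΩ.ne' hk ?_ ?_ <;>
    rw [neg_neg]
  · exact re_polarSqrt_div_polarSqrt_pos g (by rwa [abs_sub_comm])
  · exact abs_im_polarSqrt_div_polarSqrt_le g hξ

lemma angle_derivWithin_joinOrbit_joinTime_mem_Ioo (hΩ : 0 < Ω) (hk : 0 < k)
    (hg : NearCircle (1 / 10) g) (hξ : |ξ₀ - ξ₁| < 1 / 2) :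
    InnerProductGeometry.angle (deriv (polarCurve g) ξ₁)
      (derivWithin (joinOrbit Ω k (polarSqrt g ξ₀) (-polarSqrt g ξ₁))
        (Icc 0 (joinTime Ω k (polarSqrt g ξ₀) (-polarSqrt g ξ₁)))
        (joinTime Ω k (polarSqrt g ξ₀) (-polarSqrt g ξ₁))) ∈
      Ioo (Real.pi / 3) (Real.pi - Real.pi / 3) := by
  have hpi : |ξ₀ - ξ₁| < Real.pi := hξ.trans (by linarith [Real.pi_gt_three])
  rw [(hasDerivAt_polarCurve (hg.contDiff.differentiable two_ne_zero) ξ₁).deriv,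
    derivWithin_joinOrbit_joinTime hΩ hk (polarSqrt_ne_neg_polarSqrt g hpi)
      (neg_ne_zero.2 (polarSqrt_ne_zero g ξ₁)), ← polarSqrt_sq, ← neg_sq (polarSqrt g ξ₁)]
  refine angle_smul_joinCoeff_div_conj_mem_Ioo (hg.abs_deriv_le ξ₁) (neg_ne_zero.2 hΩ.ne') hk ?_ ?_
    <;> rw [neg_div_neg_eq]
  · exact re_polarSqrt_div_polarSqrt_pos g hpi
  · exact abs_im_polarSqrt_div_polarSqrt_le g hξ

end InnerArcs

theorem exists_isInnerArc_isC1InEndpoints {E h μ c : ℝ} (hEh : 0 < E + h) (hμ : 0 < μ)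
    (hc : 0 < c) {f : ℝ → ℝ → ℝ}
    (hper : ∀ ε ∈ Icc (-c) c, Function.Periodic (fun ξ => f ξ ε) (2 * Real.pi))
    (hf : ContDiffOn ℝ 2 (fun p : ℝ × ℝ => f p.1 p.2) (univ ×ˢ Icc (-c) c)) :
    ∃ εI δI C : ℝ, 0 < εI ∧ εI ≤ c ∧ 0 < δI ∧ δI ≤ Real.pi ∧ 0 < C ∧
      ∀ ε : ℝ, |ε| < εI →
        ∃ (T : ℝ → ℝ → ℝ) (z : ℝ → ℝ → ℝ → ℂ),
          (∀ ξ₀ ξ₁ : ℝ, |ξ₀ - ξ₁| < δI →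
            IsInnerArc E h μ f ε ξ₀ ξ₁ (T ξ₀ ξ₁) (z ξ₀ ξ₁) ∧
            (∀ (T' : ℝ) (z' : ℝ → ℂ), IsInnerArc E h μ f ε ξ₀ ξ₁ T' z' →
              T' = T ξ₀ ξ₁ ∧ EqOn z' (z ξ₀ ξ₁) (Icc 0 (T ξ₀ ξ₁))) ∧
            InnerProductGeometry.angle (deriv (boundaryCurve f ε) ξ₀)
              (derivWithin (z ξ₀ ξ₁) (Icc 0 (T ξ₀ ξ₁)) 0) ∈ Ioo C (Real.pi - C) ∧
            InnerProductGeometry.angle (deriv (boundaryCurve f ε) ξ₁)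
              (derivWithin (z ξ₀ ξ₁) (Icc 0 (T ξ₀ ξ₁)) (T ξ₀ ξ₁)) ∈ Ioo C (Real.pi - C)) ∧
          IsC1InEndpoints δI T z := by
  obtain ⟨d, hd, hdc, hnear⟩ :=
    exists_forall_nearCircle_logRadius hc hper hf (κ := 1 / 10) (by norm_num)
  have hΩ : 0 < √(2 * (E + h)) := Real.sqrt_pos.2 (by linarith)
  have hsq : √(2 * (E + h)) ^ 2 = 2 * (E + h) := Real.sq_sqrt (by linarith)
  have hk : 0 < μ / (E + h) := div_pos hμ hEh
  have hE : √(2 * (E + h)) ^ 2 / 2 = E + h := by rw [hsq, mul_div_cancel_left₀ _ two_ne_zero]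
  have hμk : √(2 * (E + h)) ^ 2 * (μ / (E + h)) / 2 = μ := by
    rw [hsq]
    field_simp
  have hδπ : 1 / 2 ≤ Real.pi := by linarith [Real.pi_gt_three]
  refine ⟨d, 1 / 2, Real.pi / 3, hd, hdc, one_half_pos, hδπ, by positivity, fun ε hε => ?_⟩
  obtain ⟨hg, hpos⟩ := hnear ε hε
  have hsqrt : ContDiff ℝ 1 (polarSqrt (logRadius f ε)) :=
    contDiff_polarSqrt (hg.contDiff.of_le one_le_two)
  refine ⟨_, _, fun ξ₀ ξ₁ hξ => ⟨isInnerArc_joinOrbit hΩ hE hk hμk hpos hg (by norm_num)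
    (hξ.trans_le hδπ), fun T' z' hz' => ?_, ?_, ?_⟩,
    isC1InEndpoints_joinOrbit hΩ hk hsqrt hsqrt.neg fun ξ₀ ξ₁ hξ =>
      polarSqrt_ne_neg_polarSqrt _ (hξ.trans_le hδπ)⟩
  · obtain ⟨rfl, heq⟩ := eqOn_joinOrbit_of_isInnerArc hΩ hE hk hμk hpos (hξ.trans_le hδπ) hz'
    exact ⟨rfl, heq⟩
  · rw [boundaryCurve_eq_polarCurve hpos]
    exact angle_derivWithin_joinOrbit_zero_mem_Ioo hΩ hk hg hξ
  · rw [boundaryCurve_eq_polarCurve hpos]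
    exact angle_derivWithin_joinOrbit_joinTime_mem_Ioo hΩ hk hg hξ

section Oscillation

/-- The solution of `z'' = -ω² z` with position `A` and velocity `ω B` at time `0`. -/
def oscillation (ω : ℝ) (A B : ℂ) (s : ℝ) : ℂ := Real.cos (ω * s) • A + Real.sin (ω * s) • B

/-- The solution of `z'' = -ω² z` which is at `p` at time `0` and at `q` at time `T`, provided
`sin (ω T) ≠ 0`. -/
def harmonicJoin (ω T : ℝ) (p q : ℂ) : ℝ → ℂ :=
  oscillation ω p ((Real.sin (ω * T))⁻¹ • (q - Real.cos (ω * T) • p))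

variable {E ω T θ : ℝ} {A B p q : ℂ} {z : ℝ → ℂ}

lemma gradient_outerPotential (E ω : ℝ) (z : ℂ) :
    gradient (outerPotential E ω) z = -(ω ^ 2) • z := by
  have hgrad : HasGradientAt (outerPotential E ω) (-((ω ^ 2 / 2) • (2 : ℝ) • z)) z := by
    rw [hasGradientAt_iff_hasFDerivAt, map_neg, map_smul]
    exact ((hasGradientAt_norm_sq z).hasFDerivAt.const_mul (ω ^ 2 / 2)).const_sub E
  rw [hgrad.gradient, smul_smul, div_mul_cancel₀ _ two_ne_zero, neg_smul]

lemma oscillation_zero (ω : ℝ) (A B : ℂ) : oscillation ω A B 0 = A := by simp [oscillation]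

lemma hasDerivAt_oscillation (ω : ℝ) (A B : ℂ) (s : ℝ) :
    HasDerivAt (oscillation ω A B) (ω • oscillation ω B (-A) s) s := by
  have hphase : HasDerivAt (fun t => ω * t) ω s := by simpa using (hasDerivAt_id s).const_mul ω
  refine ((hphase.cos.smul_const A).add (hphase.sin.smul_const B)).congr_deriv ?_
  simp only [oscillation, Complex.real_smul]
  push_cast
  ring

lemma norm_sq_oscillation_add (ω : ℝ) (A B : ℂ) (s : ℝ) :
    ‖oscillation ω B (-A) s‖ ^ 2 + ‖oscillation ω A B s‖ ^ 2 = ‖A‖ ^ 2 + ‖B‖ ^ 2 := by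
  simp only [oscillation, Complex.sq_norm, Complex.normSq_apply, Complex.add_re, Complex.add_im,
    Complex.smul_re, Complex.smul_im, Complex.neg_re, Complex.neg_im, smul_eq_mul]
  linear_combination (A.re ^ 2 + A.im ^ 2 + B.re ^ 2 + B.im ^ 2) * Real.sin_sq_add_cos_sq (ω * s)

lemma isSolutionAt_oscillation (hE : ω ^ 2 * (‖A‖ ^ 2 + ‖B‖ ^ 2) = 2 * E) (s : ℝ) :
    IsSolutionAt (outerPotential E ω) univ (oscillation ω A B)
      (fun s => ω • oscillation ω B (-A) s) s := by
  refine ⟨(hasDerivAt_oscillation ω A B s).hasDerivWithinAt, ?_, ?_⟩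
  · refine (((hasDerivAt_oscillation ω B (-A) s).const_smul ω).congr_deriv ?_).hasDerivWithinAt
    rw [gradient_outerPotential]
    simp only [oscillation, Complex.real_smul]
    push_cast
    ring
  · rw [norm_smul, Real.norm_eq_abs, mul_pow, sq_abs, outerPotential]
    linear_combination hE / 2 + ω ^ 2 / 2 * norm_sq_oscillation_add ω A B s

lemma eqOn_harmonicJoin_of_isOuterClassical (hω : 0 < ω) (hT : 0 < T)
    (hsin : Real.sin (ω * T) ≠ 0) (hz : IsOuterClassical E ω T z) :
    EqOn z (harmonicJoin ω T (z 0) (z T)) (Icc 0 T) ∧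
      ω ^ 2 * (‖z 0‖ ^ 2 +
        ‖(Real.sin (ω * T))⁻¹ • (z T - Real.cos (ω * T) • z 0)‖ ^ 2) = 2 * E := by
  set v := derivWithin z (Icc 0 T)
  set B := ω⁻¹ • v 0 with hB
  have hsol : ∀ s ∈ Icc 0 T, IsSolutionAt (outerPotential E ω) (Icc 0 T) z v s :=
    fun s hs => (hz s hs).isSolutionAt
  have henergy : ω ^ 2 * (‖z 0‖ ^ 2 + ‖B‖ ^ 2) = 2 * E := by
    have h0 := (hsol 0 (left_mem_Icc.2 hT.le)).energy
    rw [outerPotential] at h0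
    rw [hB, norm_smul, norm_inv, Real.norm_eq_abs, mul_pow, inv_pow, sq_abs]
    field_simp
    linear_combination 2 * h0
  have hcont : ∀ x, ContDiffAt ℝ 1 (gradient (outerPotential E ω)) x := fun x => by
    rw [funext (gradient_outerPotential E ω)]
    exact contDiffAt_id.const_smul (-(ω ^ 2))
  have heq : EqOn z (oscillation ω (z 0) B) (Icc 0 T) :=
    IsSolutionAt.eqOn_Icc isOpen_univ (fun x _ => hcont x) (fun s hs => ⟨mem_univ _, hsol s hs⟩)
      (continuous_iff_continuousAt.2 fun s => (hasDerivAt_oscillation ω _ _ s).continuousAt)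
      (fun s _ => isSolutionAt_oscillation henergy s) (oscillation_zero _ _ _).symm
      (by rw [oscillation_zero, hB, smul_inv_smul₀ hω.ne'])
  have hBT : (Real.sin (ω * T))⁻¹ • (z T - Real.cos (ω * T) • z 0) = B := by
    rw [heq (right_mem_Icc.2 hT.le), oscillation, add_sub_cancel_left, inv_smul_smul₀ hsin]
  rw [harmonicJoin, hBT]
  exact ⟨heq, henergy⟩

lemma harmonicJoin_zero (ω T : ℝ) (p q : ℂ) : harmonicJoin ω T p q 0 = p := oscillation_zero _ _ _

lemma harmonicJoin_apply (hsin : Real.sin (ω * T) ≠ 0) (p q : ℂ) (s : ℝ) :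
    harmonicJoin ω T p q s =
      (Real.sin (ω * T - ω * s) / Real.sin (ω * T)) • p +
        (Real.sin (ω * s) / Real.sin (ω * T)) • q := by
  have hsin' : (Real.sin (ω * T) : ℂ) ≠ 0 := Complex.ofReal_ne_zero.2 hsin
  rw [Real.sin_sub]
  simp only [harmonicJoin, oscillation, Complex.real_smul, Complex.ofReal_div, Complex.ofReal_sub,
    Complex.ofReal_mul, Complex.ofReal_inv]
  field_simp
  ring

lemma harmonicJoin_self (hsin : Real.sin (ω * T) ≠ 0) (p q : ℂ) : harmonicJoin ω T p q T = q := by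
  rw [harmonicJoin_apply hsin, sub_self, Real.sin_zero, zero_div, zero_smul, zero_add,
    div_self hsin, one_smul]

lemma norm_sq_add_norm_sq_eq_of_two_mul (hcos : Real.cos θ ≠ 0) (hsin : Real.sin θ ≠ 0) (p q : ℂ) :
    ‖p‖ ^ 2 + ‖(Real.sin (2 * θ))⁻¹ • (q - Real.cos (2 * θ) • p)‖ ^ 2 =
      (‖p + q‖ / 2) ^ 2 / Real.cos θ ^ 2 + (‖p - q‖ / 2) ^ 2 / (1 - Real.cos θ ^ 2) := by
  have hunit := Real.sin_sq θ
  rw [← hunit, norm_smul, norm_inv, Real.norm_eq_abs, mul_pow, inv_pow, sq_abs, Real.sin_two_mul,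
    Real.cos_two_mul, div_pow, div_pow]
  simp only [Complex.sq_norm, Complex.normSq_apply, Complex.add_re, Complex.add_im, Complex.sub_re,
    Complex.sub_im, Complex.smul_re, Complex.smul_im, smul_eq_mul]
  field_simp
  rw [hunit]
  ring

lemma sin_mul_pos (hω : 0 < ω) (hT : 0 < T) (hTω : T < Real.pi / ω) : 0 < Real.sin (ω * T) :=
  Real.sin_pos_of_pos_of_lt_pi (mul_pos hω hT) (by rwa [mul_comm, ← lt_div_iff₀ hω])

lemma half_mul_mem_Ioo (hω : 0 < ω) (hT : 0 < T) (hTω : T < Real.pi / ω) :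
    ω * T / 2 ∈ Ioo 0 (Real.pi / 2) :=
  ⟨by positivity, by rw [lt_div_iff₀ hω] at hTω; linarith⟩

lemma energy_harmonicJoin_iff (hω : 0 < ω) (hT : 0 < T) (hTω : T < Real.pi / ω) (p q : ℂ) :
    ω ^ 2 * (‖p‖ ^ 2 + ‖(Real.sin (ω * T))⁻¹ • (q - Real.cos (ω * T) • p)‖ ^ 2) = 2 * E ↔
      (‖p + q‖ / 2) ^ 2 / Real.cos (ω * T / 2) ^ 2 +
        (‖p - q‖ / 2) ^ 2 / (1 - Real.cos (ω * T / 2) ^ 2) = 2 * E / ω ^ 2 := by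
  obtain ⟨h0, h1⟩ := half_mul_mem_Ioo hω hT hTω
  have hcos := Real.cos_pos_of_mem_Ioo ⟨by linarith, h1⟩
  have hsin := Real.sin_pos_of_pos_of_lt_pi h0 (by linarith)
  rw [← norm_sq_add_norm_sq_eq_of_two_mul hcos.ne' hsin.ne', mul_div_cancel₀ _ two_ne_zero,
    eq_div_iff (pow_pos hω 2).ne', mul_comm]

lemma isOuterClassical_harmonicJoin (hω : 0 < ω) (hT : 0 < T) (hTω : T < Real.pi / ω)
    (hE : (‖p + q‖ / 2) ^ 2 / Real.cos (ω * T / 2) ^ 2 +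
      (‖p - q‖ / 2) ^ 2 / (1 - Real.cos (ω * T / 2) ^ 2) = 2 * E / ω ^ 2) :
    IsOuterClassical E ω T (harmonicJoin ω T p q) := fun _ hs =>
  IsSolutionAt.hsAt hT hs <| .of_forall <| isSolutionAt_oscillation <|
    (energy_harmonicJoin_iff hω hT hTω p q).2 hE

end Oscillation

section TravelTime

variable {m d M x y ω T T' : ℝ}

lemma div_add_div_one_sub_eq_iff (hx0 : 0 < x) (hx1 : x < 1) :
    m / x + d / (1 - x) = M ↔ (1 - x) * (M * x - m) - d * x = 0 := by
  have h1x : 1 - x ≠ 0 := by linarith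
  field_simp
  constructor <;> intro h <;> linear_combination -h

lemma exists_div_add_div_one_sub_eq (hm : 0 < m) (hM : 2 < M)
    (hd : 2 * d < (M - 2) * (2 - m)) :
    ∃ x, 0 < x ∧ x < 2 / M ∧ m / x + d / (1 - x) = M := by
  have hM1 : 2 / M < 1 := (div_lt_one (by linarith)).2 hM
  have hcont : Continuous fun x => (1 - x) * (M * x - m) - d * x := by fun_prop
  have hright : 0 < (1 - 2 / M) * (M * (2 / M) - m) - d * (2 / M) := by
    have : (1 - 2 / M) * (M * (2 / M) - m) - d * (2 / M) = ((M - 2) * (2 - m) - 2 * d) / M := by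
      field_simp
    rw [this]
    exact div_pos (by linarith) (by linarith)
  obtain ⟨x, hx, hx0⟩ := intermediate_value_Ioo (by positivity) hcont.continuousOn
    (show (0 : ℝ) ∈ Ioo _ _ from ⟨by simpa using hm, hright⟩)
  exact ⟨x, hx.1, hx.2, (div_add_div_one_sub_eq_iff hx.1 (hx.2.trans hM1)).2 hx0⟩

/-- A concave quadratic polynomial which is positive at `2 / M` cannot have two zeros to the left of
`2 / M`. -/
lemma eq_of_div_add_div_one_sub_eq (hM : 2 < M) (hd : 2 * d < (M - 2) * (2 - m)) (hx0 : 0 < x)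
    (hxM : x < 2 / M) (hx : m / x + d / (1 - x) = M) (hy0 : 0 < y) (hyM : y < 2 / M)
    (hy : m / y + d / (1 - y) = M) : x = y := by
  have hM1 : 2 / M < 1 := (div_lt_one (by linarith)).2 hM
  rw [div_add_div_one_sub_eq_iff hx0 (hxM.trans hM1)] at hx
  rw [div_add_div_one_sub_eq_iff hy0 (hyM.trans hM1)] at hy
  by_contra hxy
  have hsum : M * (x + y) = M + m - d :=
    mul_right_cancel₀ (sub_ne_zero.2 hxy) (by linear_combination hy - hx)
  have hprod : M * (x * y) = m := by linear_combination x * hsum + hx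
  rw [lt_div_iff₀ (by linarith)] at hxM hyM
  have hneg : (2 - x * M) * (2 - y * M) = 2 * d - (M - 2) * (2 - m) := by
    linear_combination M * hprod - 2 * hsum
  linarith [mul_pos (sub_pos.2 hxM) (sub_pos.2 hyM)]

lemma one_add_mul_lt_one_sub (hM : 2 < M) (hd0 : 0 ≤ d) (hd : d < 2 * (M - 2) / (3 * M))
    (hx : x < 2 / M) : (1 + (M - 2) / (2 * M)) * d < 1 - x := by
  have hM0 : 0 < M := by linarith
  rw [lt_div_iff₀ (by positivity)] at hd hx
  have : (1 + (M - 2) / (2 * M)) * d = (3 * M - 2) * d / (2 * M) := by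
    field_simp
    ring
  rw [this, div_lt_iff₀ (by positivity)]
  linarith

lemma two_mul_lt_mul (hM : 2 < M) (hm : m < 2 * M / (M + 2)) (hd : d < 2 * (M - 2) / (3 * M)) :
    2 * d < (M - 2) * (2 - m) := by
  have hM0 : 0 < M - 2 := by linarith
  calc 2 * d < 2 * (2 * (M - 2) / (3 * M)) := by gcongr
    _ = 4 * (M - 2) / (3 * M) := by ring
    _ ≤ 4 * (M - 2) / (M + 2) := by gcongr; linarith
    _ = (M - 2) * (2 - 2 * M / (M + 2)) := by
      field_simp
      ring
    _ < (M - 2) * (2 - m) := by gcongr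

lemma lt_two_div_of_one_sub_mul_le (hM : 2 < M) (hx0 : 0 < x) (hx1 : x < 1)
    (hm : m < 2 * M / (M + 2)) (hx : m / x + d / (1 - x) = M)
    (hd : (1 - (M - 2) / (2 * M)) * d ≤ 1 - x) : x < 2 / M := by
  have hM0 : 0 < M := by linarith
  have hdx : d / (1 - x) ≤ 2 * M / (M + 2) := by
    rw [div_le_div_iff₀ (by linarith) (by linarith)]
    have : (1 - (M - 2) / (2 * M)) * d = d * (M + 2) / (2 * M) := by
      field_simp
      ring
    rw [this, div_le_iff₀ (by positivity)] at hd
    linarith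
  have hmx : m / x < 2 * M / (M + 2) / x := by gcongr
  have : M < 2 * M / (M + 2) * (1 / x + 1) := by
    rw [mul_add, mul_one, mul_one_div]
    linarith
  field_simp at this ⊢
  linarith

lemma exists_cos_sq_eq (hω : 0 < ω) (hx0 : 0 < x) (hx1 : x < 1) :
    ∃ T, 0 < T ∧ T < Real.pi / ω ∧ Real.cos (ω * T / 2) ^ 2 = x := by
  have hsqrt : 0 < √x := Real.sqrt_pos.2 hx0
  have hsqrt1 : √x < 1 := (Real.sqrt_lt' one_pos).2 (by rwa [one_pow])
  refine ⟨2 * Real.arccos (√x) / ω, ?_, ?_, ?_⟩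
  · exact div_pos (mul_pos two_pos (Real.arccos_pos.2 hsqrt1)) hω
  · gcongr
    linarith [Real.arccos_lt_pi_div_two.2 hsqrt]
  · rw [mul_div_cancel₀ _ hω.ne', mul_div_cancel_left₀ _ two_ne_zero,
      Real.cos_arccos (by linarith) hsqrt1.le, Real.sq_sqrt hx0.le]

lemma eq_of_cos_sq_eq (hω : 0 < ω) (hT : 0 < T) (hTω : T < Real.pi / ω) (hT' : 0 < T')
    (hTω' : T' < Real.pi / ω) (h : Real.cos (ω * T / 2) ^ 2 = Real.cos (ω * T' / 2) ^ 2) :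
    T = T' := by
  obtain ⟨h0, h1⟩ := half_mul_mem_Ioo hω hT hTω
  obtain ⟨h0', h1'⟩ := half_mul_mem_Ioo hω hT' hTω'
  have hangle : ω * T / 2 = ω * T' / 2 :=
    Real.injOn_cos ⟨h0.le, by linarith⟩ ⟨h0'.le, by linarith⟩ <|
      (sq_eq_sq₀ (Real.cos_pos_of_mem_Ioo ⟨by linarith, h1⟩).le
        (Real.cos_pos_of_mem_Ioo ⟨by linarith, h1'⟩).le).1 h
  exact mul_left_cancel₀ hω.ne' (by linarith)

end TravelTime

section GaugeParallelogram

variable {h : ℝ → ℝ} {κ τ σ : ℝ}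

lemma norm_sq_smul_add_smul (a b : ℝ) (z w : ℂ) :
    ‖a • z + b • w‖ ^ 2 = (a + b) * (a * ‖z‖ ^ 2 + b * ‖w‖ ^ 2) - a * b * ‖z - w‖ ^ 2 := by
  simp only [Complex.sq_norm, Complex.normSq_apply, Complex.add_re, Complex.add_im, Complex.sub_re,
    Complex.sub_im, Complex.smul_re, Complex.smul_im, smul_eq_mul]
  ring

namespace NearCircle

lemma abs_exp_neg_two_mul_sub_one_le (hh : NearCircle κ h) (hκ : 8 * κ ≤ 1) (t : ℝ) :
    |Real.exp (-(2 * h t)) - 1| ≤ 4 * κ := by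
  have habs : |-(2 * h t)| ≤ 2 * κ := by
    rw [abs_neg, abs_mul, abs_two]
    linarith [hh.abs_apply_le t]
  calc |Real.exp (-(2 * h t)) - 1| ≤ 2 * |-(2 * h t)| := Real.abs_exp_sub_one_le (by linarith)
    _ ≤ 4 * κ := by linarith

lemma exp_neg_two_mul_le (hh : NearCircle κ h) (hκ : 8 * κ ≤ 1) (t : ℝ) :
    Real.exp (-(2 * h t)) ≤ 3 / 2 := by
  linarith [(abs_le.1 (hh.abs_exp_neg_two_mul_sub_one_le hκ t)).2]

lemma abs_deriv_exp_neg_two_mul_le (hh : NearCircle κ h) (hκ : 8 * κ ≤ 1) (t : ℝ) :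
    |deriv (fun θ => Real.exp (-(2 * h θ))) t| ≤ 3 * κ := by
  have hh₁ := (hh.contDiff.differentiable (by norm_num) t).hasDerivAt
  rw [(hh₁.const_mul 2).fun_neg.exp.deriv, abs_mul, abs_neg, abs_mul, abs_two, Real.abs_exp]
  calc Real.exp (-(2 * h t)) * (2 * |deriv h t|) ≤ 3 / 2 * (2 * κ) := by
        gcongr
        exacts [hh.exp_neg_two_mul_le hκ t, hh.abs_deriv_le t]
    _ = 3 * κ := by ring

lemma abs_deriv_deriv_exp_neg_two_mul_le (hh : NearCircle κ h) (hκ : 8 * κ ≤ 1) (t : ℝ) :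
    |deriv (deriv fun θ => Real.exp (-(2 * h θ))) t| ≤ 15 / 4 * κ := by
  have hderiv : ∀ g : ℝ → ℝ, (deriv fun θ => 2 * g θ) = fun θ => 2 * deriv g θ := fun g =>
    deriv_const_mul_field' 2
  rw [deriv_deriv_exp_neg (contDiff_const.mul hh.contDiff), hderiv, hderiv, abs_mul, Real.abs_exp]
  have hsq : (2 * deriv h t) ^ 2 ≤ κ / 2 := by
    have := sq_le_sq.2 ((hh.abs_deriv_le t).trans (le_abs_self κ))
    have hκ0 : 0 ≤ κ := (abs_nonneg _).trans (hh.abs_apply_le 0)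
    nlinarith
  have hκ₂ := abs_le.1 (hh.abs_deriv_deriv_le t)
  have habs : |(2 * deriv h t) ^ 2 - 2 * deriv (deriv h) t| ≤ 5 / 2 * κ :=
    abs_le.2 ⟨by linarith [sq_nonneg (2 * deriv h t)], by linarith⟩
  calc _ ≤ 3 / 2 * (5 / 2 * κ) := by
        gcongr
        exact hh.exp_neg_two_mul_le hκ t
    _ = 15 / 4 * κ := by ring

lemma deriv_sq_le_of_abs_le_one (hh : NearCircle κ h) (hτ0 : 0 < τ) (hτ1 : τ ≤ 1)
    (hκ : 8 * κ ≤ τ) (hσ : |σ| ≤ 1) (t : ℝ) :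
    let φ := fun t => σ * Real.exp (-(2 * h t)) + (τ - σ)
    0 < φ t ∧ deriv φ t ^ 2 ≤ 2 * φ t * (2 * φ t + deriv (deriv φ) t) := by
  intro φ
  have hκ0 : 0 ≤ κ := (abs_nonneg _).trans (hh.abs_apply_le 0)
  have hκ1 := hκ.trans hτ1
  have hscale : ∀ {x C : ℝ}, |x| ≤ C → |σ * x| ≤ C := fun hx => by
    rw [abs_mul]
    exact (mul_le_of_le_one_left (abs_nonneg _) hσ).trans hx
  have hderiv : deriv φ = fun t => σ * deriv (fun θ => Real.exp (-(2 * h θ))) t := by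
    rw [deriv_add_const', deriv_const_mul_field']
  have hφ₀ : 4 * κ ≤ φ t := by
    linarith [(abs_le.1 (hscale (hh.abs_exp_neg_two_mul_sub_one_le hκ1 t))).1]
  have hφ₁ : deriv φ t ^ 2 ≤ (3 * κ) ^ 2 := by
    rw [hderiv]
    exact sq_le_sq.2 ((hscale (hh.abs_deriv_exp_neg_two_mul_le hκ1 t)).trans (le_abs_self _))
  have hφ₂ : -(15 / 4 * κ) ≤ deriv (deriv φ) t := by
    rw [hderiv, deriv_const_mul_field']
    exact (abs_le.1 (hscale (hh.abs_deriv_deriv_exp_neg_two_mul_le hκ1 t))).1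
  refine ⟨by linarith [(abs_le.1 (hscale (hh.abs_exp_neg_two_mul_sub_one_le hκ1 t))).1], ?_⟩
  calc deriv φ t ^ 2 ≤ 8 * κ * (17 / 4 * κ) := hφ₁.trans (by nlinarith)
    _ ≤ 2 * φ t * (2 * φ t + deriv (deriv φ) t) :=
      mul_le_mul (by linarith) (by linarith) (by linarith) (by linarith)

/-- The gauge is close to the Euclidean norm in `C²`, so up to the small multiple `τ` of the latter
its square is both convex and concave. -/
lemma mul_radialGauge_sq_smul_add_smul_le (hh : NearCircle κ h) (hτ0 : 0 < τ) (hτ1 : τ ≤ 1)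
    (hκ : 8 * κ ≤ τ) (hσ : |σ| ≤ 1) {a b : ℝ} (ha : 0 ≤ a) (hb : 0 ≤ b) (z w : ℂ) :
    σ * radialGauge h (a • z + b • w) ^ 2 ≤
      σ * ((a + b) * (a * radialGauge h z ^ 2 + b * radialGauge h w ^ 2)) -
        (σ - τ) * (a * b * ‖z - w‖ ^ 2) := by
  set φ : ℝ → ℝ := fun t => σ * Real.exp (-(2 * h t)) + (τ - σ)
  have hsq : ∀ x, ‖x‖ ^ 2 * φ x.arg = σ * radialGauge h x ^ 2 + (τ - σ) * ‖x‖ ^ 2 := fun x => by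
    rw [radialGauge, radialExtension, mul_pow, ← Real.exp_nat_mul]
    simp only [φ, Nat.cast_two, mul_neg]
    ring
  have hφ : ContDiff ℝ 2 φ :=
    (contDiff_const.mul (contDiff_const.mul hh.contDiff).neg.exp).add contDiff_const
  have hper : Function.Periodic φ (2 * Real.pi) :=
    hh.periodic.comp fun x => σ * Real.exp (-(2 * x)) + (τ - σ)
  have hbound := hh.deriv_sq_le_of_abs_le_one hτ0 hτ1 hκ hσ
  have hmain := norm_sq_mul_smul_add_smul_le hφ hper (fun t => (hbound t).1)
    (fun t => (hbound t).2) ha hb z w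
  rw [hsq, hsq, hsq] at hmain
  linear_combination hmain + (σ - τ) * norm_sq_smul_add_smul a b z w

lemma one_sub_mul_le_radialGauge_sq (hh : NearCircle κ h) (hτ0 : 0 < τ) (hτ1 : τ ≤ 1)
    (hκ : 8 * κ ≤ τ) {a b : ℝ} (ha : 0 ≤ a) (hb : 0 ≤ b) (ξ₀ ξ₁ : ℝ) :
    (a + b) ^ 2 - (1 + τ) * (a * b * ‖polarCurve h ξ₀ - polarCurve h ξ₁‖ ^ 2) ≤
      radialGauge h (a • polarCurve h ξ₀ + b • polarCurve h ξ₁) ^ 2 := by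
  have hconcave := hh.mul_radialGauge_sq_smul_add_smul_le hτ0 hτ1 hκ (σ := -1) (by simp) ha hb
    (polarCurve h ξ₀) (polarCurve h ξ₁)
  rw [radialGauge_polarCurve hh.periodic, radialGauge_polarCurve hh.periodic] at hconcave
  linear_combination hconcave

lemma radialGauge_sq_le_sub_mul (hh : NearCircle κ h) (hτ0 : 0 < τ) (hτ1 : τ ≤ 1)
    (hκ : 8 * κ ≤ τ) {a b : ℝ} (ha : 0 ≤ a) (hb : 0 ≤ b) (ξ₀ ξ₁ : ℝ) :
    radialGauge h (a • polarCurve h ξ₀ + b • polarCurve h ξ₁) ^ 2 ≤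
      (a + b) ^ 2 - (1 - τ) * (a * b * ‖polarCurve h ξ₀ - polarCurve h ξ₁‖ ^ 2) := by
  have hconvex := hh.mul_radialGauge_sq_smul_add_smul_le hτ0 hτ1 hκ (σ := 1) (by simp) ha hb
    (polarCurve h ξ₀) (polarCurve h ξ₁)
  rw [radialGauge_polarCurve hh.periodic, radialGauge_polarCurve hh.periodic] at hconvex
  linear_combination hconvex

end NearCircle

variable {ω T s ξ₀ ξ₁ : ℝ}

lemma sin_sub_add_sin_sq (θ x : ℝ) :
    (Real.sin (2 * θ - x) + Real.sin x) ^ 2 =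
      Real.sin (2 * θ) ^ 2 + 4 * (Real.sin (2 * θ - x) * Real.sin x) * (1 - Real.cos θ ^ 2) := by
  have hcos : Real.cos (2 * θ) = 1 - 2 * Real.sin θ ^ 2 := by
    rw [Real.cos_two_mul, Real.cos_sq']
    ring
  rw [Real.sin_sub, hcos, Real.sin_two_mul, ← Real.sin_sq]
  linear_combination 4 * Real.sin θ ^ 2 * Real.cos θ ^ 2 * Real.sin_sq_add_cos_sq x -
    4 * Real.sin θ ^ 2 * Real.sin x ^ 2 * Real.sin_sq_add_cos_sq θ

lemma exists_weights_harmonicJoin (hω : 0 < ω) (hTω : T < Real.pi / ω) (hs : s ∈ Ioo 0 T)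
    (p q : ℂ) :
    ∃ a b, 0 < a ∧ 0 < b ∧ harmonicJoin ω T p q s = a • p + b • q ∧
      (a + b) ^ 2 = 1 + 4 * (a * b) * (1 - Real.cos (ω * T / 2) ^ 2) := by
  have hsinT := sin_mul_pos hω (hs.1.trans hs.2) hTω
  have hsin : 0 < Real.sin (ω * s) := sin_mul_pos hω hs.1 (hs.2.trans hTω)
  have hsinsub : 0 < Real.sin (ω * T - ω * s) := by
    rw [← mul_sub]
    exact sin_mul_pos hω (sub_pos.2 hs.2) (by linarith [hs.1])
  refine ⟨_, _, div_pos hsinsub hsinT, div_pos hsin hsinT, harmonicJoin_apply hsinT.ne' p q s, ?_⟩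
  have htrig := sin_sub_add_sin_sq (ω * T / 2) (ω * s)
  rw [mul_div_cancel₀ _ two_ne_zero] at htrig
  rw [← add_div, div_pow, htrig]
  field_simp

/-- The chord of the boundary curve, pushed outwards by the curvature of the orbit, leaves the
domain. -/
lemma one_lt_radialGauge_harmonicJoin (hh : NearCircle κ h) (hτ0 : 0 < τ) (hτ1 : τ ≤ 1)
    (hκ : 8 * κ ≤ τ) (hω : 0 < ω) (hTω : T < Real.pi / ω) (hs : s ∈ Ioo 0 T)
    (hT : (1 + τ) * (‖polarCurve h ξ₀ - polarCurve h ξ₁‖ / 2) ^ 2 < 1 - Real.cos (ω * T / 2) ^ 2) :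
    1 < radialGauge h (harmonicJoin ω T (polarCurve h ξ₀) (polarCurve h ξ₁) s) := by
  obtain ⟨a, b, ha, hb, heq, hab⟩ :=
    exists_weights_harmonicJoin hω hTω hs (polarCurve h ξ₀) (polarCurve h ξ₁)
  have hsq := hh.one_sub_mul_le_radialGauge_sq hτ0 hτ1 hκ ha.le hb.le ξ₀ ξ₁
  rw [← heq, hab] at hsq
  rw [← one_lt_sq_iff₀ (radialGauge_nonneg _ _)]
  linarith [mul_lt_mul_of_pos_left hT (mul_pos ha hb)]

lemma mul_norm_sq_le_of_one_le_radialGauge_harmonicJoin (hh : NearCircle κ h) (hτ0 : 0 < τ)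
    (hτ1 : τ ≤ 1) (hκ : 8 * κ ≤ τ) (hω : 0 < ω) (hTω : T < Real.pi / ω) (hs : s ∈ Ioo 0 T)
    (hgauge : 1 ≤ radialGauge h (harmonicJoin ω T (polarCurve h ξ₀) (polarCurve h ξ₁) s)) :
    (1 - τ) * (‖polarCurve h ξ₀ - polarCurve h ξ₁‖ / 2) ^ 2 ≤ 1 - Real.cos (ω * T / 2) ^ 2 := by
  obtain ⟨a, b, ha, hb, heq, hab⟩ :=
    exists_weights_harmonicJoin hω hTω hs (polarCurve h ξ₀) (polarCurve h ξ₁)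
  have hsq := hh.radialGauge_sq_le_sub_mul hτ0 hτ1 hκ ha.le hb.le ξ₀ ξ₁
  rw [← heq, hab] at hsq
  refine le_of_mul_le_mul_left ?_ (mul_pos ha hb)
  linarith [one_le_pow₀ hgauge (n := 2)]

end GaugeParallelogram

section OuterArcs

variable {E M ω T ε κ τ ξ₀ ξ₁ : ℝ} {h : ℝ → ℝ} {f : ℝ → ℝ → ℝ} {z : ℝ → ℂ}

namespace NearCircle

lemma radialGauge_le (hh : NearCircle κ h) (z : ℂ) : radialGauge h z ≤ Real.exp κ * ‖z‖ := by
  rw [mul_comm]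
  exact mul_le_mul_of_nonneg_left
    (Real.exp_le_exp.2 (neg_le.1 (abs_le.1 (hh.abs_apply_le z.arg)).1)) (norm_nonneg z)

lemma continuous_radialGauge (hh : NearCircle κ h) (hκ : κ ≤ 1) : Continuous (radialGauge h) :=
  (LipschitzWith.of_le_add_mul ⟨Real.exp κ, (Real.exp_pos κ).le⟩ fun z w => by
    calc radialGauge h z = radialGauge h (w + (z - w)) := by rw [add_sub_cancel]
      _ ≤ radialGauge h w + radialGauge h (z - w) := hh.radialGauge_add_le hκ _ _
      _ ≤ radialGauge h w + Real.exp κ * dist z w := by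
        rw [dist_eq_norm]
        gcongr
        exact hh.radialGauge_le _).continuous

lemma norm_polarCurve_le (hh : NearCircle κ h) (ξ : ℝ) : ‖polarCurve h ξ‖ ≤ Real.exp κ := by
  rw [norm_polarCurve]
  exact Real.exp_le_exp.2 (abs_le.1 (hh.abs_apply_le ξ)).2

lemma norm_polarCurve_sub_le (hh : NearCircle κ h) (ξ₀ ξ₁ : ℝ) :
    ‖polarCurve h ξ₀ - polarCurve h ξ₁‖ ≤ (κ + 1) * Real.exp κ * |ξ₀ - ξ₁| := by
  refine convex_univ.norm_image_sub_le_of_norm_hasDerivWithin_le (fun ξ _ =>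
    (hasDerivAt_polarCurve (hh.contDiff.differentiable (by norm_num)) ξ).hasDerivWithinAt)
    (fun ξ _ => ?_) (mem_univ ξ₁) (mem_univ ξ₀)
  rw [norm_mul]
  have hderiv : ‖(deriv h ξ + Complex.I : ℂ)‖ ≤ κ + 1 := by
    refine (norm_add_le _ _).trans ?_
    rw [Complex.norm_real, Complex.norm_I]
    exact add_le_add_left (hh.abs_deriv_le ξ) 1
  exact mul_le_mul hderiv (hh.norm_polarCurve_le ξ) (norm_nonneg _) ((norm_nonneg _).trans hderiv)

lemma polarCurve_add_ne_zero (hh : NearCircle κ h) (hτ0 : 0 < τ) (hτ1 : τ ≤ 1)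
    (hκ : 8 * κ ≤ τ) (hd : (1 + τ) * (‖polarCurve h ξ₀ - polarCurve h ξ₁‖ / 2) ^ 2 < 1) :
    polarCurve h ξ₀ + polarCurve h ξ₁ ≠ 0 := fun hzero => by
  have hgauge := hh.one_sub_mul_le_radialGauge_sq hτ0 hτ1 hκ (a := 1) (b := 1) zero_le_one
    zero_le_one ξ₀ ξ₁
  rw [one_smul, one_smul, hzero, show radialGauge h 0 = 0 by simp [radialGauge, radialExtension]]
    at hgauge
  linarith

end NearCircle

lemma closure_domain_subset (hh : NearCircle κ (logRadius f ε)) (hκ : κ ≤ 1)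
    (hf : ∀ ξ, 0 < 1 + ε * f ξ ε) :
    closure (domain f ε) ⊆ {z | radialGauge (logRadius f ε) z ≤ 1} :=
  closure_minimal (fun _ hz => ((mem_domain_iff_radialGauge_lt_one hf).1 hz).le)
    (isClosed_le (hh.continuous_radialGauge hκ) continuous_const)

lemma IsOuterFixedEnds.eqOn_harmonicJoin (hω : 0 < ω) (hTω : T < Real.pi / ω)
    (hz : IsOuterFixedEnds E ω f ε ξ₀ ξ₁ T z) :
    EqOn z (harmonicJoin ω T (boundaryCurve f ε ξ₀) (boundaryCurve f ε ξ₁)) (Icc 0 T) ∧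
      (‖boundaryCurve f ε ξ₀ + boundaryCurve f ε ξ₁‖ / 2) ^ 2 / Real.cos (ω * T / 2) ^ 2 +
        (‖boundaryCurve f ε ξ₀ - boundaryCurve f ε ξ₁‖ / 2) ^ 2 /
          (1 - Real.cos (ω * T / 2) ^ 2) = 2 * E / ω ^ 2 := by
  rw [← hz.start, ← hz.finish, ← energy_harmonicJoin_iff hω hz.pos hTω]
  exact eqOn_harmonicJoin_of_isOuterClassical hω hz.pos (sin_mul_pos hω hz.pos hTω).ne' hz.classical

lemma isOuterFixedEnds_harmonicJoin (hω : 0 < ω) (hT : 0 < T) (hTω : T < Real.pi / ω)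
    (hE : (‖boundaryCurve f ε ξ₀ + boundaryCurve f ε ξ₁‖ / 2) ^ 2 / Real.cos (ω * T / 2) ^ 2 +
      (‖boundaryCurve f ε ξ₀ - boundaryCurve f ε ξ₁‖ / 2) ^ 2 / (1 - Real.cos (ω * T / 2) ^ 2) =
        2 * E / ω ^ 2) :
    IsOuterFixedEnds E ω f ε ξ₀ ξ₁ T
      (harmonicJoin ω T (boundaryCurve f ε ξ₀) (boundaryCurve f ε ξ₁)) :=
  ⟨hT, harmonicJoin_zero _ _ _ _, harmonicJoin_self (sin_mul_pos hω hT hTω).ne' _ _,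
    isOuterClassical_harmonicJoin hω hT hTω hE⟩

lemma isOuterArc_harmonicJoin (hh : NearCircle κ (logRadius f ε)) (hf : ∀ ξ, 0 < 1 + ε * f ξ ε)
    (hτ0 : 0 < τ) (hτ1 : τ ≤ 1) (hκ : 8 * κ ≤ τ) (hω : 0 < ω) (hT : 0 < T) (hTω : T < Real.pi / ω)
    (hE : (‖boundaryCurve f ε ξ₀ + boundaryCurve f ε ξ₁‖ / 2) ^ 2 / Real.cos (ω * T / 2) ^ 2 +
      (‖boundaryCurve f ε ξ₀ - boundaryCurve f ε ξ₁‖ / 2) ^ 2 / (1 - Real.cos (ω * T / 2) ^ 2) =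
        2 * E / ω ^ 2)
    (hd : (1 + τ) * (‖boundaryCurve f ε ξ₀ - boundaryCurve f ε ξ₁‖ / 2) ^ 2 <
      1 - Real.cos (ω * T / 2) ^ 2) :
    IsOuterArc E ω f ε ξ₀ ξ₁ T
      (harmonicJoin ω T (boundaryCurve f ε ξ₀) (boundaryCurve f ε ξ₁)) := by
  refine ⟨isOuterFixedEnds_harmonicJoin hω hT hTω hE, fun s hs hclosure => ?_⟩
  have hgauge := closure_domain_subset hh (by linarith) hf hclosure
  rw [boundaryCurve_eq_polarCurve hf] at hd hgauge
  exact hgauge.not_gt (one_lt_radialGauge_harmonicJoin hh hτ0 hτ1 hκ hω hTω hs hd)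

lemma IsOuterArc.mul_norm_sq_le (hh : NearCircle κ (logRadius f ε)) (hf : ∀ ξ, 0 < 1 + ε * f ξ ε)
    (hτ0 : 0 < τ) (hτ1 : τ ≤ 1) (hκ : 8 * κ ≤ τ) (hω : 0 < ω) (hTω : T < Real.pi / ω)
    (hz : IsOuterArc E ω f ε ξ₀ ξ₁ T z) :
    (1 - τ) * (‖boundaryCurve f ε ξ₀ - boundaryCurve f ε ξ₁‖ / 2) ^ 2 ≤
      1 - Real.cos (ω * T / 2) ^ 2 := by
  have hmid : T / 2 ∈ Ioo 0 T := ⟨half_pos hz.1.pos, half_lt_self hz.1.pos⟩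
  have hgauge : 1 ≤ radialGauge (logRadius f ε) (z (T / 2)) := not_lt.1 fun hlt =>
    hz.2 _ hmid (subset_closure ((mem_domain_iff_radialGauge_lt_one hf).2 hlt))
  rw [(hz.1.eqOn_harmonicJoin hω hTω).1 (Ioo_subset_Icc_self hmid),
    boundaryCurve_eq_polarCurve hf] at hgauge
  rw [boundaryCurve_eq_polarCurve hf]
  exact mul_norm_sq_le_of_one_le_radialGauge_harmonicJoin hh hτ0 hτ1 hκ hω hTω hmid hgauge

lemma exists_unique_isOuterArc (hh : NearCircle κ (logRadius f ε)) (hf : ∀ ξ, 0 < 1 + ε * f ξ ε)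
    (hω : 0 < ω) (hE : 2 * E / ω ^ 2 = M) (hM : 2 < M) (hκ : 8 * κ ≤ (M - 2) / (2 * M))
    (hm : (‖boundaryCurve f ε ξ₀ + boundaryCurve f ε ξ₁‖ / 2) ^ 2 < 2 * M / (M + 2))
    (hd : (‖boundaryCurve f ε ξ₀ - boundaryCurve f ε ξ₁‖ / 2) ^ 2 < 2 * (M - 2) / (3 * M)) :
    ∃ T z, T < Real.pi / ω ∧ IsOuterArc E ω f ε ξ₀ ξ₁ T z ∧
      (∀ z', IsOuterFixedEnds E ω f ε ξ₀ ξ₁ T z' → EqOn z' z (Icc 0 T)) ∧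
      ∀ T' z', T' < Real.pi / ω → IsOuterArc E ω f ε ξ₀ ξ₁ T' z' →
        T' = T ∧ EqOn z' z (Icc 0 T) := by
  have hM0 : 0 < M := by linarith
  have hM1 : 2 / M < 1 := (div_lt_one hM0).2 hM
  have hτ0 : 0 < (M - 2) / (2 * M) := div_pos (by linarith) (by linarith)
  have hτ1 : (M - 2) / (2 * M) ≤ 1 := (div_le_one (by linarith)).2 (by linarith)
  have hm0 : 0 < (‖boundaryCurve f ε ξ₀ + boundaryCurve f ε ξ₁‖ / 2) ^ 2 := by
    refine pow_pos (half_pos (norm_pos_iff.2 ?_)) 2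
    have hchord := one_add_mul_lt_one_sub hM (sq_nonneg _) hd (x := 0) (by positivity)
    rw [boundaryCurve_eq_polarCurve hf, sub_zero] at *
    exact hh.polarCurve_add_ne_zero hτ0 hτ1 hκ hchord
  have hmd := two_mul_lt_mul hM hm hd
  obtain ⟨x, hx0, hxM, hx⟩ := exists_div_add_div_one_sub_eq hm0 hM hmd
  obtain ⟨T, hT, hTω, rfl⟩ := exists_cos_sq_eq hω hx0 (hxM.trans hM1)
  refine ⟨T, _, hTω, isOuterArc_harmonicJoin hh hf hτ0 hτ1 hκ hω hT hTω (hx.trans hE.symm)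
    (one_add_mul_lt_one_sub hM (sq_nonneg _) hd hxM),
    fun z' hz' => (hz'.eqOn_harmonicJoin hω hTω).1, fun T' z' hTω' hz' => ?_⟩
  obtain ⟨hjoin, hx'⟩ := hz'.1.eqOn_harmonicJoin hω hTω'
  obtain ⟨hθ0, hθ1⟩ := half_mul_mem_Ioo hω hz'.1.pos hTω'
  have hcos : 0 < Real.cos (ω * T' / 2) := Real.cos_pos_of_mem_Ioo ⟨by linarith, hθ1⟩
  have hsin : 0 < Real.sin (ω * T' / 2) := Real.sin_pos_of_pos_of_lt_pi hθ0 (by linarith)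
  have hxM' := lt_two_div_of_one_sub_mul_le hM (pow_pos hcos 2)
    (by linarith [Real.sin_sq (ω * T' / 2), pow_pos hsin 2]) hm (hx'.trans hE)
    (hz'.mul_norm_sq_le hh hf hτ0 hτ1 hκ hω hTω')
  obtain rfl : T' = T := eq_of_cos_sq_eq hω hz'.1.pos hTω' hT hTω
    (eq_of_div_add_div_one_sub_eq hM hmd (pow_pos hcos 2) hxM' (hx'.trans hE) hx0 hxM hx)
  exact ⟨rfl, hjoin⟩

lemma exists_pos_le_and_apply_lt {g : ℝ → ℝ} {b C : ℝ} (hg : Continuous g) (h0 : g 0 < C)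
    (hb : 0 < b) : ∃ x, 0 < x ∧ x ≤ b ∧ g x < C := by
  have hlt : ∀ᶠ x in 𝓝[>] 0, g x < C :=
    (hg.continuousAt.eventually_lt_const h0).filter_mono nhdsWithin_le_nhds
  obtain ⟨x, hgx, hx⟩ := (hlt.and (Ioc_mem_nhdsGT hb)).exists
  exact ⟨x, hx.1, hx.2, hgx⟩

theorem exists_forall_exists_unique_isOuterArc {c : ℝ} (hω : 0 < ω) (hc : 0 < c)
    (hper : ∀ ε ∈ Icc (-c) c, Function.Periodic (fun ξ => f ξ ε) (2 * Real.pi))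
    (hf : ContDiffOn ℝ 2 (fun p : ℝ × ℝ => f p.1 p.2) (univ ×ˢ Icc (-c) c)) (hE : ω ^ 2 < E) :
    ∃ εE δE, 0 < εE ∧ εE ≤ c ∧ 0 < δE ∧ δE ≤ Real.pi ∧
      ∀ ε ξ₀ ξ₁, |ε| < εE → |ξ₀ - ξ₁| < δE → ∃ T z, T < Real.pi / ω ∧
        IsOuterArc E ω f ε ξ₀ ξ₁ T z ∧
        (∀ z', IsOuterFixedEnds E ω f ε ξ₀ ξ₁ T z' → EqOn z' z (Icc 0 T)) ∧
        ∀ T' z', T' < Real.pi / ω → IsOuterArc E ω f ε ξ₀ ξ₁ T' z' →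
          T' = T ∧ EqOn z' z (Icc 0 T) := by
  obtain ⟨M, hM⟩ : ∃ M, 2 * E / ω ^ 2 = M := ⟨_, rfl⟩
  have hM2 : 2 < M := by
    rw [← hM, lt_div_iff₀ (pow_pos hω 2)]
    linarith
  have : 0 < M - 2 := by linarith
  obtain ⟨κ, hκ0, hκ, hκm⟩ := exists_pos_le_and_apply_lt (C := 2 * M / (M + 2))
    (g := fun κ => Real.exp κ ^ 2) (b := (M - 2) / (2 * M) / 8) (by fun_prop)
    (by rw [Real.exp_zero, one_pow, one_lt_div] <;> linarith) (by positivity)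
  obtain ⟨δ, hδ0, hδπ, hδ⟩ := exists_pos_le_and_apply_lt (C := 2 * (M - 2) / (3 * M))
    (g := fun δ => ((κ + 1) * Real.exp κ * δ / 2) ^ 2) (by fun_prop)
    (by rw [mul_zero, zero_div, zero_pow two_ne_zero]; positivity) Real.pi_pos
  obtain ⟨d, hd0, hdc, hd⟩ := exists_forall_nearCircle_logRadius hc hper hf hκ0
  refine ⟨d, δ, hd0, hdc, hδ0, hδπ, fun ε ξ₀ ξ₁ hε hξ => ?_⟩
  obtain ⟨hh, hpos⟩ := hd ε hε
  refine exists_unique_isOuterArc hh hpos hω hM hM2 (by linarith) ?_ ?_ <;>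
    rw [boundaryCurve_eq_polarCurve hpos]
  · refine lt_of_le_of_lt (pow_le_pow_left₀ (by positivity) ?_ 2) hκm
    linarith [norm_add_le (polarCurve (logRadius f ε) ξ₀) (polarCurve (logRadius f ε) ξ₁),
      hh.norm_polarCurve_le ξ₀, hh.norm_polarCurve_le ξ₁]
  · refine lt_of_le_of_lt (pow_le_pow_left₀ (by positivity) ?_ 2) hδ
    gcongr
    exact (hh.norm_polarCurve_sub_le ξ₀ ξ₁).trans (by gcongr)

end OuterArcs

end RefractionBilliard

end

theorem mainTheorem11 (E h μ ω Cε : ℝ) (hEh : 0 < E + h) (hμ : 0 < μ) (hω : 0 < ω)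
    (hCε : 0 < Cε) (f : ℝ → ℝ → ℝ)
    (hper : ∀ ε ∈ Set.Icc (-Cε) Cε, Function.Periodic (fun ξ => f ξ ε) (2 * Real.pi))
    (hf : ContDiffOn ℝ 2 (fun p : ℝ × ℝ => f p.1 p.2) (Set.univ ×ˢ Set.Icc (-Cε) Cε)) :
    -- inner arcs
    (∃ εI δI C : ℝ, 0 < εI ∧ εI ≤ Cε ∧ 0 < δI ∧ δI ≤ Real.pi ∧ 0 < C ∧
      ∀ ε : ℝ, |ε| < εI →
        ∃ (T : ℝ → ℝ → ℝ) (z : ℝ → ℝ → ℝ → ℂ),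
          (∀ ξ₀ ξ₁ : ℝ, |ξ₀ - ξ₁| < δI →
            RefractionBilliard.IsInnerArc E h μ f ε ξ₀ ξ₁ (T ξ₀ ξ₁) (z ξ₀ ξ₁) ∧
            (∀ (T' : ℝ) (z' : ℝ → ℂ), RefractionBilliard.IsInnerArc E h μ f ε ξ₀ ξ₁ T' z' →
              T' = T ξ₀ ξ₁ ∧ Set.EqOn z' (z ξ₀ ξ₁) (Set.Icc 0 (T ξ₀ ξ₁))) ∧
            InnerProductGeometry.angle (deriv (RefractionBilliard.boundaryCurve f ε) ξ₀)
              (derivWithin (z ξ₀ ξ₁) (Set.Icc 0 (T ξ₀ ξ₁)) 0) ∈ Set.Ioo C (Real.pi - C) ∧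
            InnerProductGeometry.angle (deriv (RefractionBilliard.boundaryCurve f ε) ξ₁)
              (derivWithin (z ξ₀ ξ₁) (Set.Icc 0 (T ξ₀ ξ₁)) (T ξ₀ ξ₁)) ∈ Set.Ioo C (Real.pi - C)) ∧
          RefractionBilliard.IsC1InEndpoints δI T z) ∧
    -- outer arcs
    (ω ^ 2 < E →
      ∃ εE δE : ℝ, 0 < εE ∧ εE ≤ Cε ∧ 0 < δE ∧ δE ≤ Real.pi ∧
        ∀ ε ξ₀ ξ₁ : ℝ, |ε| < εE → |ξ₀ - ξ₁| < δE →
          ∃ (T : ℝ) (z : ℝ → ℂ), T < Real.pi / ω ∧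
            RefractionBilliard.IsOuterArc E ω f ε ξ₀ ξ₁ T z ∧
            (∀ z' : ℝ → ℂ, RefractionBilliard.IsOuterFixedEnds E ω f ε ξ₀ ξ₁ T z' →
              Set.EqOn z' z (Set.Icc 0 T)) ∧
            (∀ (T' : ℝ) (z' : ℝ → ℂ), T' < Real.pi / ω →
              RefractionBilliard.IsOuterArc E ω f ε ξ₀ ξ₁ T' z' →
              T' = T ∧ Set.EqOn z' z (Set.Icc 0 T))) :=
  ⟨RefractionBilliard.exists_isInnerArc_isC1InEndpoints hEh hμ hCε hper hf,
    RefractionBilliard.exists_forall_exists_unique_isOuterArc hω hCε hper hf⟩
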